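/- **Theorem 1.3.** Let $S\subset\mathbb R^3$ be a smooth (embedded, not necessarily closed) hypersurface with surface measure $d\sigma$. For $x^0\in S$, apply a Euclidean motion that moves $x^0$ to $(0,0,1)$ and, near this point, $S$ to the graph $\{(x_1,x_2,1+\phi(x_1,x_2))\}$ of a function $1+\phi$, where $\phi$ is smooth near the origin of $\mathbb R^2$, $\phi(0,0)=0$ and $\nabla\phi(0,0)=0$. The *Newton polyhedron* of a smooth function near the origin of $\mathbb R^2$ with Taylor series $\sum c_{jk}x_1^jx_2^k$ is the convex hull of the union of the quadrants $(j,k)+[0,\infty)^2$ with $c_{jk}\neq0$, and its *distance* is the number $d$ such that the line $t_1=t_2$ meets the boundary of the Newton polyhedron at $(d,d)$. The height $h(x^0,S):=h(\phi)$ is the supremum of the distances of $\phi$ expressed in $y$, over all smooth local coordinate systems $y$ at the origin of $\mathbb R^2$ that fix the origin; it does not depend on the choice of the motion. Assume that $S$ is of finite type, i.e. at each point of $S$ the corresponding function $\phi$ has a non-zero Taylor series at the origin, and that for every $x\in S$ the affine tangent plane $x+T_xS$ does not pass through the origin of $\mathbb R^3$. Let $\rho\ge0$ be a smooth function on $S$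 with compact support in $S$, and put $$A_tf(x)=\int_S f(x-ty)\,\rho(y)\,d\sigma(y),\qquad \mathcal Mf(x)=\sup_{t>0}|A_tf(x)|,\qquad x\in\mathbb R^3.$$ Let $1<p\le\infty$ and suppose that $\mathcal M$ is bounded on $L^p(\mathbb R^3)$, i.e. that there is a constant $C$ with $\|\mathcal Mf\|_{p}\le C\|f\|_{p}$ for all $f\in C_0^\infty(\mathbb R^3)$. Then $h(x^0,S)\le p$ for every $x^0\in S$ with $\rho(x^0)>0$. If moreover $S$ is real analytic near such a point $x^0$, then $h(x^0,S)<p$. -/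

import Mathlib

open Set Filter Topology MeasureTheory
open scoped ENNReal NNReal ContDiff

noncomputable section

/-- Euclidean three-space. -/
abbrev E3 : Type := EuclideanSpace ℝ (Fin 3)

/-! ### Hypersurfaces in three-space -/

/-- Near `x` the set `S` is a hypersurface of class `C^n`: it is the zero set, in an open
neighbourhood of `x`, of a `C^n` function without critical points
(`n = ∞` means smooth, `n = ω` means real analytic). -/
def IsHypersurfaceNear (n : WithTop ℕ∞) (S : Set E3) (x : E3) : Prop :=
  ∃ (U : Set E3) (g : E3 → ℝ), IsOpen U ∧ x ∈ U ∧ ContDiffOn ℝ n g U ∧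
    (∀ y ∈ U, fderiv ℝ g y ≠ 0) ∧ S ∩ U = {y ∈ U | g y = 0}

/-- Smooth (embedded, not necessarily closed) hypersurfaces of three-space. -/
def IsSmoothHypersurface (S : Set E3) : Prop :=
  ∀ x ∈ S, IsHypersurfaceNear ∞ S x

/-- The hypersurface `S` is analytic at `x`. -/
def IsAnalyticHypersurfaceAt (S : Set E3) (x : E3) : Prop :=
  IsHypersurfaceNear ω S x

/-- The tangent space `T_x S`: velocities at `x` of smooth curves in `S`. -/
def tangentSpaceAt (S : Set E3) (x : E3) : Set E3 :=
  {v | ∃ γ : ℝ → E3, γ 0 = x ∧ (∀ᶠ s in 𝓝 0, γ s ∈ S) ∧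
    ContDiffAt ℝ ∞ γ 0 ∧ HasDerivAt γ v 0}

/-- The affine tangent plane `x + T_x S`. -/
def affineTangentPlane (S : Set E3) (x : E3) : Set E3 :=
  (fun v => x + v) '' tangentSpaceAt S x

/-- Transversality: no affine tangent plane of `S` passes through the origin. -/
def IsTransversal (S : Set E3) : Prop :=
  ∀ x ∈ S, (0 : E3) ∉ affineTangentPlane S x

/-- The point `(u₁, u₂, 1 + φ (u₁, u₂))` of the graph of `1 + φ`. -/
def graphPoint (φ : ℝ × ℝ → ℝ) (u : ℝ × ℝ) : E3 :=
  !₂[u.1, u.2, 1 + φ u]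

/-- `φ` represents `S` at `x`: some Euclidean motion `F` moves `x` to `(0, 0, 1)` and `S`, near
that point, to the graph of `1 + φ`, where `φ` is smooth on a neighbourhood `Ω` of the origin of
the plane, `φ 0 = 0` and `∇φ 0 = 0` (so that the tangent plane is moved to `{x₃ = 0}`). -/
def RepresentsAt (S : Set E3) (x : E3) (φ : ℝ × ℝ → ℝ) : Prop :=
  ∃ (F : E3 ≃ᵃⁱ[ℝ] E3) (U : Set E3) (Ω : Set (ℝ × ℝ)),
    F x = !₂[0, 0, 1] ∧ IsOpen U ∧ F x ∈ U ∧ IsOpen Ω ∧ (0 : ℝ × ℝ) ∈ Ω ∧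
    ContDiffOn ℝ ∞ φ Ω ∧ φ 0 = 0 ∧ fderiv ℝ φ 0 = 0 ∧
    (F '' S) ∩ U = graphPoint φ '' Ω

/-! ### Newton polyhedra and height -/

/-- The Taylor coefficient `c_{jk} = ∂₁^j ∂₂^k φ (0, 0) / (j! k!)`. -/
def taylorCoeff (φ : ℝ × ℝ → ℝ) (j k : ℕ) : ℝ :=
  iteratedDeriv j (fun s => iteratedDeriv k (fun t => φ (s, t)) 0) 0 / ((j.factorial : ℝ) * (k.factorial : ℝ))

/-- The Taylor support of `φ` at the origin. -/
def taylorSupport (φ : ℝ × ℝ → ℝ) : Set (ℕ × ℕ) :=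
  {jk | taylorCoeff φ jk.1 jk.2 ≠ 0}

/-- The Newton polyhedron: the convex hull of the union of the quadrants `(j, k) + ℝ²₊`,
`(j, k)` in the Taylor support. -/
def newtonPolyhedron (φ : ℝ × ℝ → ℝ) : Set (ℝ × ℝ) :=
  convexHull ℝ (⋃ jk ∈ taylorSupport φ, {t : ℝ × ℝ | (jk.1 : ℝ) ≤ t.1 ∧ (jk.2 : ℝ) ≤ t.2})

/-- The Newton distance: the `d` for which the bisectrix `t₁ = t₂` enters the Newton polyhedron,
that is, meets its boundary, at `(d, d)` (it is `∞` if the Newton polyhedron is empty). -/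
def newtonDistance (φ : ℝ × ℝ → ℝ) : ℝ≥0∞ :=
  ⨅ (d : ℝ≥0) (_ : ((d : ℝ), (d : ℝ)) ∈ newtonPolyhedron φ), (d : ℝ≥0∞)

/-- Local smooth coordinate systems at the origin of the plane: diffeomorphisms between open
neighbourhoods of the origin that fix the origin. -/
def IsLocalCoordinates (e : OpenPartialHomeomorph (ℝ × ℝ) (ℝ × ℝ)) : Prop :=
  (0 : ℝ × ℝ) ∈ e.source ∧ e 0 = 0 ∧
    ContDiffOn ℝ ∞ e e.source ∧ ContDiffOn ℝ ∞ e.symm e.target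

/-- The height `h(φ)`: the supremum of the Newton distances of `φ`, written in the local
coordinates `y = e x`, over all local smooth coordinate systems at the origin. -/
def functionHeight (φ : ℝ × ℝ → ℝ) : ℝ≥0∞ :=
  ⨆ (e : OpenPartialHomeomorph (ℝ × ℝ) (ℝ × ℝ)) (_ : IsLocalCoordinates e),
    newtonDistance (φ ∘ e.symm)

/-- The height `h(x, S) = h(φ)`, where `φ` represents `S` at `x`. All such `φ` have the same
height, so the supremum only serves to avoid a choice. -/
def surfaceHeight (S : Set E3) (x : E3) : ℝ≥0∞ :=
  ⨆ (φ : ℝ × ℝ → ℝ) (_ : RepresentsAt S x φ), functionHeight φ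

/-- `S` is of finite type: at every point the tangent plane has finite order of contact, i.e. the
functions that represent `S` are not flat at the origin. -/
def IsFiniteType (S : Set E3) : Prop :=
  ∀ x ∈ S, ∀ φ : ℝ × ℝ → ℝ, RepresentsAt S x φ → (taylorSupport φ).Nonempty

/-! ### The maximal operator -/

/-- The surface measure `dσ` of `S`, as a measure on three-space: the two-dimensional Hausdorff
measure, normalised to agree with Lebesgue measure on planes, restricted to `S`. -/
def surfaceMeasure (S : Set E3) : Measure E3 :=
  (Measure.euclideanHausdorffMeasure 2).restrict S

/-- `ρ` is (on `S`) a smooth function on `S` with compact support in `S`. Its values off `S` play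
no role. -/
def IsSmoothCompactlySupportedOn (S : Set E3) (ρ : E3 → ℝ) : Prop :=
  (∀ x ∈ S, ∃ g : E3 → ℝ, ContDiff ℝ ∞ g ∧ ρ =ᶠ[𝓝[S] x] g) ∧
    ∃ K ⊆ S, IsCompact K ∧ ∀ x ∈ S \ K, ρ x = 0

/-- The averages `A_t f (x) = ∫_S f (x - t y) ρ(y) dσ(y)`. -/
def average (S : Set E3) (ρ : E3 → ℝ) (f : E3 → ℝ) (t : ℝ) (x : E3) : ℝ :=
  ∫ y, f (x - t • y) * ρ y ∂(surfaceMeasure S)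

/-- The maximal operator `M f (x) = sup_{t > 0} |A_t f (x)|`. -/
def maximalOperator (S : Set E3) (ρ : E3 → ℝ) (f : E3 → ℝ) (x : E3) : ℝ≥0∞ :=
  ⨆ (t : ℝ) (_ : 0 < t), ‖average S ρ f t x‖ₑ

/-- `M` is bounded on `L^p(ℝ³)`, in the sense of the a priori inequality
`‖M f‖_p ≤ C ‖f‖_p` for all test functions `f`. -/
def MaximalOperatorBounded (S : Set E3) (ρ : E3 → ℝ) (p : ℝ≥0∞) : Prop :=
  ∃ C : ℝ≥0, ∀ f : E3 → ℝ, ContDiff ℝ ∞ f → HasCompactSupport f →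
    eLpNorm (maximalOperator S ρ f) p volume ≤ C * eLpNorm f p volume

end

/-! ### Partial derivatives in the last variable -/

/-! Everything passes through the volume of the sublevel sets {|φ| ≤ ε} near the origin: the maximal
inequality forbids them to be large, while a large height forces them to be large.

Maximal inequality. Let L be the linear part of the motion. On S near x₀ the third coordinate of L
is c + φ, and transversality says that the constant c is nonzero. The test function is a cutoff
times a smooth version of |v|^(-1/p), where v is the third coordinate of L x, truncated at |v| ~
2^(-J); the p-th power of its norm is O(J). For x near x₀ the dilation t = v(x)/c turns v(x - t y)
into -t φ, so the average meets the whole singularity. This gives ∑_{j<J} 2^(j/p) |{|φ| ≤ 2^(-j)}| =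
O(J^(1/p)) (`exists_sum_volume_sublevelSet_le`). As p > 1, a lower bound c ε^s for these volumes is
impossible for every s ≤ 1/p, endpoint included
(`MaximalOperatorBounded.exists_not_le_volume_sublevelSet`).

The inequality h ≤ p. If h > p, then in some coordinates a point (d, d) with d > p lies off the
Newton polyhedron. A separating line provides weights with κ₁ + κ₂ < 1/p such that φ = O(ε) on the
box with sides ε^κ₁ and ε^κ₂, so the sublevel sets have volume at least a multiple of ε^(κ₁+κ₂)
(`exists_le_volume_sublevelSet`): a contradiction.

The strict inequality. For analytic φ and s = 1/p, either the sublevel volumes are at least c ε^s,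
which is excluded, or they are O(ε^κ) for some κ > s (`AnalyticAt.sublevelSet_dichotomy`); in the
second case the box argument yields h ≤ 1/κ < p. The dichotomy rests on `analytic_dichotomy`, an
induction on the order of vanishing in the second variable. A shear removes the subleading Taylor
coefficient, and a weighted blow-up along the lowest Newton slope then produces a function of
smaller order at every point of the exceptional line. Lower bounds push down from a single point of
this line; upper bounds are glued by compactness, and a monomial estimate covers the remaining
region. Blow-ups introduce powers of t, which is why masses with weights t^β and t^γ are carried
along. -/

lemma eventually_snd_slice {E : Type*} [TopologicalSpace E] {P : E × ℝ → Prop} {s : E} {t : ℝ} (h : ∀ᶠ x in 𝓝 (s, t), P x) :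
    ∀ᶠ r in 𝓝 t, P (s, r) :=
  (Continuous.prodMk_right s).continuousAt.eventually h

section PartialDerivative

variable {E : Type*} [NormedAddCommGroup E] [NormedSpace ℝ E]

/-- The partial derivative of a function on `E × ℝ` in the last variable. -/
noncomputable def sndDeriv (f : E × ℝ → ℝ) : E × ℝ → ℝ := fun x => fderiv ℝ f x (0, 1)

lemma ContDiffAt.sndDeriv {n : WithTop ℕ∞} (hn : n + 1 ≤ n) {f : E × ℝ → ℝ} {x : E × ℝ}
    (hf : ContDiffAt ℝ n f x) : ContDiffAt ℝ n (sndDeriv f) x :=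
  (hf.fderiv_right hn).clm_apply contDiffAt_const

lemma ContDiffAt.sndDeriv_iterate {n : WithTop ℕ∞} (hn : n + 1 ≤ n) {f : E × ℝ → ℝ} {x : E × ℝ}
    (hf : ContDiffAt ℝ n f x) (k : ℕ) : ContDiffAt ℝ n (_root_.sndDeriv^[k] f) x := by
  induction k with
  | zero => simpa using hf
  | succ k ih => rw [Function.iterate_succ_apply']; exact ih.sndDeriv hn

lemma AnalyticAt.sndDeriv_iterate {f : E × ℝ → ℝ} {x : E × ℝ}
    (hf : AnalyticAt ℝ f x) (k : ℕ) : AnalyticAt ℝ (_root_.sndDeriv^[k] f) x := by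
  induction k with
  | zero => simpa using hf
  | succ k ih =>
    rw [Function.iterate_succ_apply']
    exact ((ContinuousLinearMap.apply ℝ ℝ ((0, 1) : E × ℝ)).analyticAt _).comp ih.fderiv

lemma Filter.EventuallyEq.sndDeriv {f g : E × ℝ → ℝ} {x : E × ℝ} (h : f =ᶠ[𝓝 x] g) :
    _root_.sndDeriv f =ᶠ[𝓝 x] _root_.sndDeriv g :=
  (h.fderiv (𝕜 := ℝ)).mono fun y hy => by simp only [_root_.sndDeriv, hy]

lemma hasDerivAt_slice {f : E × ℝ → ℝ} {s : E} {t : ℝ} (hf : DifferentiableAt ℝ f (s, t)) :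
    HasDerivAt (fun t => f (s, t)) (sndDeriv f (s, t)) t :=
  hf.hasFDerivAt.comp_hasDerivAt t ((hasDerivAt_const t s).prodMk (hasDerivAt_id t))

/-- Smoothness is required near the point, not only at it, because the induction step differentiates
an identity that must hold on a neighbourhood of `t`. -/
lemma iteratedDeriv_slice {f : E × ℝ → ℝ} {s : E} {t : ℝ}
    (hf : ∀ᶠ x in 𝓝 (s, t), ContDiffAt ℝ ∞ f x) (k : ℕ) :
    iteratedDeriv k (fun t => f (s, t)) t = sndDeriv^[k] f (s, t) := by
  induction k generalizing t with
  | zero => simp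
  | succ k ih =>
    rw [iteratedDeriv_succ, Function.iterate_succ_apply']
    have h1 : iteratedDeriv k (fun t => f (s, t)) =ᶠ[𝓝 t] fun r => sndDeriv^[k] f (s, r) := by
      have := eventually_snd_slice hf.eventually_nhds
      exact this.mono fun r hr => ih hr
    rw [h1.deriv_eq]
    exact (hasDerivAt_slice
      ((hf.self_of_nhds.sndDeriv_iterate (by simp) k).differentiableAt (by simp))).deriv

/-- The implicit function theorem for one scalar equation, solved for a real variable. -/
lemma ContDiffAt.exists_implicit [CompleteSpace E] {n : WithTop ℕ∞} (hn : n ≠ 0)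
    {f : E × ℝ → ℝ} {a : E} {b : ℝ}
    (hf : ContDiffAt ℝ n f (a, b)) (h0 : f (a, b) = 0) (h1 : _root_.sndDeriv f (a, b) ≠ 0) :
    ∃ ψ : E → ℝ, ContDiffAt ℝ n ψ a ∧ ψ a = b ∧ ∀ᶠ x in 𝓝 (a, b), f x = 0 ↔ ψ x.1 = x.2 := by
  have hinv : (fderiv ℝ f (a, b) ∘L .inr ℝ E ℝ).IsInvertible := by
    refine ⟨ContinuousLinearEquiv.unitsEquivAut ℝ (Units.mk0 _ h1), ?_⟩
    ext
    simp [_root_.sndDeriv]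
  refine ⟨hf.implicitFunction hn hinv, hf.contDiffAt_implicitFunction hn hinv,
    hf.implicitFunction_apply_self hn hinv, ?_⟩
  simpa [h0] using hf.eventually_apply_eq_iff_implicitFunction hn hinv

end PartialDerivative

/-! ### Taylor's formula -/

/-- The derivative of the remainder of f is the remainder of f' of one order less, so induction and
the mean value inequality suffice. The factor 1/M! is given up, since only the power of |y| matters.
-/
lemma abs_sub_taylor_le {f : ℝ → ℝ} {r C : ℝ} (M : ℕ)
    (hf : ∀ y, |y| ≤ r → ContDiffAt ℝ ∞ f y)
    (hC : ∀ y, |y| ≤ r → |iteratedDeriv M f y| ≤ C) (y : ℝ) (hy : |y| ≤ r) :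
    |f y - ∑ k ∈ Finset.range M, iteratedDeriv k f 0 * y ^ k / k.factorial| ≤ C * |y| ^ M := by
  induction M generalizing f y with
  | zero => simpa using hC y hy
  | succ M ih =>
    have h0C : 0 ≤ C := (abs_nonneg _).trans (hC y hy)
    have hd : ∀ x, |x| ≤ r →
        HasDerivAt (fun y => f y - ∑ k ∈ Finset.range (M + 1),
          iteratedDeriv k f 0 * y ^ k / k.factorial)
        (deriv f x - ∑ k ∈ Finset.range M,
          iteratedDeriv k (deriv f) 0 * x ^ k / k.factorial) x := by
      intro x hx
      refine ((hf x hx).differentiableAt (by simp)).hasDerivAt.sub ?_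
      simp_rw [Finset.sum_range_succ']
      have h1 : HasDerivAt (fun y : ℝ => ∑ k ∈ Finset.range M,
          iteratedDeriv (k + 1) f 0 * y ^ (k + 1) / (k + 1).factorial)
          (∑ k ∈ Finset.range M, iteratedDeriv k (deriv f) 0 * x ^ k / k.factorial) x := by
        refine HasDerivAt.fun_sum fun k _ => ?_
        have := ((hasDerivAt_pow (k + 1) x).const_mul (iteratedDeriv (k + 1) f 0)).div_const
          ((k + 1).factorial : ℝ)
        convert! this using 1
        rw [iteratedDeriv_succ', Nat.factorial_succ]
        have : (k.factorial : ℝ) ≠ 0 := by positivity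
        push_cast
        field_simp
      simpa using h1
    have key := Convex.norm_image_sub_le_of_norm_hasDerivWithin_le
      (f := fun y => f y - ∑ k ∈ Finset.range (M + 1), iteratedDeriv k f 0 * y ^ k / k.factorial)
      (s := Icc (-|y|) |y|) (C := C * |y| ^ M) (x := 0) (y := y)
      (fun x hx => (hd x ((abs_le.2 hx).trans hy)).hasDerivWithinAt) ?_ (convex_Icc _ _)
      (by simp) ⟨neg_abs_le y, le_abs_self y⟩
    · simp only [Finset.sum_range_succ', Real.norm_eq_abs] at key ⊢
      simpa [pow_succ, mul_assoc] using key
    · intro x hx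
      have hx' : |x| ≤ |y| := abs_le.2 hx
      have := ih (f := deriv f) (fun y hy => (hf y hy).derivWithin (by simp)) ?_ x (hx'.trans hy)
      · refine this.trans ?_
        gcongr
      · intro z hz
        rw [← iteratedDeriv_succ']
        exact hC z hz

/-! ### Division of analytic functions by a coordinate -/

lemma tendsto_killSnd {E : Type*} [TopologicalSpace E] (a : E) : Tendsto (fun x : E × ℝ => (x.1, (0 : ℝ))) (𝓝 (a, 0))
    (𝓝 (a, 0)) := by
  have : Continuous fun x : E × ℝ => (x.1, (0 : ℝ)) := by fun_prop
  exact this.tendsto (a, 0)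

section Division

variable {E : Type*} [NormedAddCommGroup E] [NormedSpace ℝ E]

/-- The projection `(u, y) ↦ (u, 0)`. -/
noncomputable def killSnd (E : Type*) [NormedAddCommGroup E] [NormedSpace ℝ E] :
    E × ℝ →L[ℝ] E × ℝ :=
  (ContinuousLinearMap.inl ℝ E ℝ).comp (ContinuousLinearMap.fst ℝ E ℝ)

lemma norm_killSnd_le : ‖killSnd E‖ ≤ 1 := by
  refine ContinuousLinearMap.opNorm_le_bound _ zero_le_one fun x => ?_
  simpa [killSnd] using norm_fst_le x

/-- The formal series of `(f (u, y) - f (u, 0)) / y`, where `p` is the series of `f`. -/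
noncomputable def FormalMultilinearSeries.divSnd (p : FormalMultilinearSeries ℝ (E × ℝ) ℝ) :
    FormalMultilinearSeries ℝ (E × ℝ) ℝ := fun n =>
  ∑ i : Fin (n + 1), ((p (n + 1)).compContinuousLinearMap
    (fun j => if j < i then killSnd E else .id ℝ (E × ℝ))).curryMid i (0, 1)

lemma FormalMultilinearSeries.norm_divSnd_le (p : FormalMultilinearSeries ℝ (E × ℝ) ℝ) (n : ℕ) :
    ‖p.divSnd n‖ ≤ (n + 1) * ‖p (n + 1)‖ := by
  have key : ∀ i : Fin (n + 1), ‖((p (n + 1)).compContinuousLinearMap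
      (fun j => if j < i then killSnd E else .id ℝ (E × ℝ))).curryMid i (0, 1)‖
      ≤ ‖p (n + 1)‖ := by
    intro i
    refine (ContinuousLinearMap.le_opNorm _ _).trans ?_
    rw [ContinuousMultilinearMap.norm_curryMid]
    have h1 : ‖((0, 1) : E × ℝ)‖ = 1 := by simp [Prod.norm_def]
    rw [h1, mul_one]
    refine (ContinuousMultilinearMap.norm_compContinuousLinearMap_le _ _).trans ?_
    refine mul_le_of_le_one_right (norm_nonneg _) (Finset.prod_le_one (fun _ _ => norm_nonneg _) ?_)
    intro j _
    split_ifs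
    · exact norm_killSnd_le
    · exact ContinuousLinearMap.norm_id_le
  refine (norm_sum_le _ _).trans ((Finset.sum_le_sum fun i _ => key i).trans ?_)
  simp

lemma FormalMultilinearSeries.divSnd_radius_pos {p : FormalMultilinearSeries ℝ (E × ℝ) ℝ}
    (hp : 0 < p.radius) : 0 < p.divSnd.radius := by
  obtain ⟨r, hr0, hr⟩ := ENNReal.lt_iff_exists_nnreal_btwn.1 hp
  have hr0' : 0 < r := by exact_mod_cast hr0
  obtain ⟨C, hC0, hC⟩ := p.norm_mul_pow_le_of_lt_radius hr
  -- Halving the radius absorbs the number n + 1 ≤ 2 ^ n of summands.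
  have : ((r / 2 : ℝ≥0) : ℝ≥0∞) ≤ p.divSnd.radius := by
    refine p.divSnd.le_radius_of_bound (C / r) fun n => ?_
    have h1 := hC (n + 1)
    have h2 := p.norm_divSnd_le n
    have h3 : ((n : ℝ) + 1) ≤ 2 ^ n := by exact_mod_cast Nat.lt_two_pow_self
    have hr1 : (0 : ℝ) < r := hr0'
    rw [le_div_iff₀ hr1]
    calc ‖p.divSnd n‖ * ((r / 2 : ℝ≥0) : ℝ) ^ n * r
        ≤ ((n + 1) * ‖p (n + 1)‖) * ((r / 2 : ℝ≥0) : ℝ) ^ n * r := by gcongr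
      _ = (‖p (n + 1)‖ * r ^ (n + 1)) * ((n + 1) / 2 ^ n) := by
          push_cast; rw [div_pow, pow_succ]; ring
      _ ≤ C * 1 := by
          gcongr
          rw [div_le_one (by positivity)]; exact h3
      _ = C := mul_one _
  exact lt_of_lt_of_le (by exact_mod_cast (half_pos hr0')) this

/-- A telescoping sum: `T i` has the projected vector in the first i slots and v in the others.
Consecutive terms differ in one slot, by v minus its projection, which is v.2 • (0, 1). -/
lemma FormalMultilinearSeries.snd_mul_divSnd (p : FormalMultilinearSeries ℝ (E × ℝ) ℝ) (n : ℕ)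
    (v : E × ℝ) : v.2 * p.divSnd n (fun _ => v) =
      p (n + 1) (fun _ => v) - p (n + 1) (fun _ => killSnd E v) := by
  set T : ℕ → ℝ := fun i => p (n + 1) (fun j => if (j : ℕ) < i then killSnd E v else v) with hT
  have hstep : ∀ i : Fin (n + 1), v.2 * ((p (n + 1)).compContinuousLinearMap
      (fun j => if j < i then killSnd E else .id ℝ (E × ℝ))).curryMid i (0, 1) (fun _ => v)
      = T i - T (i + 1) := by
    intro i
    have hv : v = killSnd E v + v.2 • ((0, 1) : E × ℝ) := by
      ext <;> simp [killSnd]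
    set m : Fin (n + 1) → E × ℝ := fun j => if (j : ℕ) < i then killSnd E v else v with hm
    have e1 : T i = p (n + 1) (Function.update m i v) := by
      simp only [hT]
      congr 1
      ext1 j
      by_cases hj : j = i
      · subst hj; simp
      · simp [hm, hj]
    have e2 : T (i + 1) = p (n + 1) (Function.update m i (killSnd E v)) := by
      simp only [hT]
      congr 1
      ext1 j
      by_cases hj : j = i
      · subst hj; simp
      · have : (j : ℕ) ≠ i := fun h => hj (Fin.ext h)
        have h2 : ((j : ℕ) < i + 1) ↔ (j : ℕ) < i := by omega
        simp [hm, hj, h2]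
    have e3 : ((p (n + 1)).compContinuousLinearMap
      (fun j => if j < i then killSnd E else .id ℝ (E × ℝ))).curryMid i (0, 1) (fun _ => v)
        = p (n + 1) (Function.update m i (0, 1)) := by
      rw [ContinuousMultilinearMap.curryMid_apply,
        ContinuousMultilinearMap.compContinuousLinearMap_apply]
      congr 1
      ext1 j
      by_cases hj : j = i
      · subst hj; simp
      · obtain ⟨j', rfl⟩ := Fin.exists_succAbove_eq hj
        simp only [Fin.insertNth_apply_succAbove, hm, Function.update_of_ne hj, Fin.lt_def]
        split_ifs <;> simp
    rw [e1, e2, e3]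
    nth_rewrite 2 [hv]
    rw [ContinuousMultilinearMap.map_update_add, ContinuousMultilinearMap.map_update_smul]
    simp
  have hsum : v.2 * p.divSnd n (fun _ => v) = ∑ i : Fin (n + 1), (T i - T (i + 1)) := by
    rw [FormalMultilinearSeries.divSnd, _root_.sum_apply, Finset.mul_sum]
    exact Finset.sum_congr rfl fun i _ => hstep i
  rw [hsum, Fin.sum_univ_eq_sum_range (fun i => T i - T (i + 1)), Finset.sum_range_sub']
  simp only [hT]
  congr 2
  ext1 j
  rw [if_pos j.2]

/-- Division with remainder by the last coordinate. -/
lemma AnalyticAt.exists_eq_add_snd_mul {f : E × ℝ → ℝ} {a : E} (hf : AnalyticAt ℝ f (a, 0)) :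
    ∃ h : E × ℝ → ℝ, AnalyticAt ℝ h (a, 0) ∧
      ∀ᶠ x in 𝓝 (a, (0 : ℝ)), f x = f (x.1, 0) + x.2 * h x := by
  obtain ⟨p, r, hp⟩ := hf
  have hrad : 0 < p.radius := hp.r_pos.trans_le hp.r_le
  have hq := p.divSnd.hasFPowerSeriesOnBall (FormalMultilinearSeries.divSnd_radius_pos hrad)
  refine ⟨fun x => p.divSnd.sum (x - (a, 0)), ?_, ?_⟩
  · have h1 : AnalyticAt ℝ p.divSnd.sum ((a, (0 : ℝ)) - (a, 0)) := by
      rw [sub_self]; exact hq.analyticAt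
    exact h1.comp (f := fun x : E × ℝ => x - (a, 0)) (analyticAt_id.sub analyticAt_const)
  · have hc : Tendsto (fun x : E × ℝ => x - (a, 0)) (𝓝 (a, 0)) (𝓝 0) := by
      have : Continuous fun x : E × ℝ => x - (a, 0) := by fun_prop
      simpa using this.tendsto (a, 0)
    have hc' : Tendsto (fun x : E × ℝ => killSnd E (x - (a, 0))) (𝓝 (a, 0)) (𝓝 0) := by
      have : Continuous fun x : E × ℝ => killSnd E (x - (a, 0)) := by fun_prop
      simpa using this.tendsto (a, 0)
    filter_upwards [hc (Metric.eball_mem_nhds _ hp.r_pos), hc' (Metric.eball_mem_nhds _ hp.r_pos),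
      hc (Metric.eball_mem_nhds _ (FormalMultilinearSeries.divSnd_radius_pos hrad))] with x h1 h2 h3
    set v := x - (a, (0 : ℝ)) with hv
    have s1 := hp.hasSum h1
    have s2 := hp.hasSum h2
    have s3 : HasSum (fun n => v.2 * p.divSnd n (fun _ => v)) (v.2 * p.divSnd.sum v) := by
      have := hq.hasSum h3
      rw [zero_add] at this
      exact this.mul_left v.2
    have t1 : (a, (0 : ℝ)) + v = x := by simp [hv]
    have t2 : (a, (0 : ℝ)) + killSnd E v = (x.1, 0) := by simp [hv, killSnd]
    have t3 : v.2 = x.2 := by simp [hv]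
    rw [t1] at s1
    rw [t2] at s2
    have s4 := (hasSum_nat_add_iff' 1).2 (s1.sub s2)
    simp_rw [FormalMultilinearSeries.snd_mul_divSnd] at s3
    have := s3.unique s4
    simp only [Finset.range_one, Finset.sum_singleton] at this
    have h0 : p 0 (fun _ => v) = p 0 (fun _ => killSnd E v) := by
      congr 1; ext1 j; exact j.elim0
    rw [h0, sub_self, sub_zero, t3] at this
    linarith

lemma sndDeriv_snd_mul {F : E × ℝ → ℝ} {x : E × ℝ} (hF : DifferentiableAt ℝ F x) :
    sndDeriv (fun x => x.2 * F x) x = F x + x.2 * sndDeriv F x := by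
  have h := ((hasFDerivAt_snd (𝕜 := ℝ) (p := x)).mul hF.hasFDerivAt).fderiv
  simp only [sndDeriv]
  have h' : fderiv ℝ (fun x : E × ℝ => x.2 * F x) x
    = x.2 • fderiv ℝ F x + F x • ContinuousLinearMap.snd ℝ E ℝ := h
  rw [h']
  simp [add_comm]

lemma sndDeriv_add {F G : E × ℝ → ℝ} {x : E × ℝ} (hF : DifferentiableAt ℝ F x)
    (hG : DifferentiableAt ℝ G x) :
    sndDeriv (fun x => F x + G x) x = sndDeriv F x + sndDeriv G x := by
  simp only [sndDeriv]
  rw [show (fun x => F x + G x) = F + G from rfl, fderiv_add hF hG]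
  rfl

lemma sndDeriv_const_mul {F : E × ℝ → ℝ} {x : E × ℝ} (c : ℝ) (hF : DifferentiableAt ℝ F x) :
    sndDeriv (fun x => c * F x) x = c * sndDeriv F x := by
  simp only [sndDeriv]
  rw [fderiv_const_mul hF]
  rfl

lemma sndDeriv_comp_killSnd {f : E × ℝ → ℝ} {x : E × ℝ}
    (hf : DifferentiableAt ℝ f (x.1, 0)) : sndDeriv (fun x => f (x.1, 0)) x = 0 := by
  have h : HasFDerivAt (fun x : E × ℝ => f (x.1, 0)) ((fderiv ℝ f (x.1, 0)).comp (killSnd E)) x :=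
    HasFDerivAt.comp x (f := fun x : E × ℝ => killSnd E x) hf.hasFDerivAt (killSnd E).hasFDerivAt
  have h0 : killSnd E ((0, 1) : E × ℝ) = 0 := by simp [killSnd]
  rw [sndDeriv, h.fderiv, ContinuousLinearMap.comp_apply, h0, map_zero]

/-- Leibniz' rule, where only the first derivative of the factor `x.2` survives. On the axis `x.2 =
0` it links the Taylor coefficients of the quotient to those of f, shifted by one. -/
lemma sndDeriv_iterate_succ_of_eq {f h : E × ℝ → ℝ} {a : E} (hf : AnalyticAt ℝ f (a, 0))
    (hh : AnalyticAt ℝ h (a, 0)) (H : ∀ᶠ x in 𝓝 (a, (0 : ℝ)), f x = f (x.1, 0) + x.2 * h x)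
    (k : ℕ) : sndDeriv^[k + 1] f =ᶠ[𝓝 (a, 0)]
      fun x => x.2 * sndDeriv^[k + 1] h x + (k + 1) * sndDeriv^[k] h x := by
  induction k with
  | zero =>
    have H' : f =ᶠ[𝓝 (a, 0)] fun x => f (x.1, 0) + x.2 * h x := H
    refine H'.sndDeriv.trans ?_
    filter_upwards [hh.eventually_analyticAt,
      (tendsto_killSnd a).eventually hf.eventually_analyticAt] with x hx hx'
    have hd : DifferentiableAt ℝ (fun x : E × ℝ => f (x.1, 0)) x :=
      DifferentiableAt.comp x (f := fun x : E × ℝ => killSnd E x) hx'.differentiableAt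
        (killSnd E).differentiableAt
    rw [sndDeriv_add hd (differentiableAt_snd.fun_mul hx.differentiableAt),
      sndDeriv_snd_mul hx.differentiableAt, sndDeriv_comp_killSnd hx'.differentiableAt]
    simp [add_comm]
  | succ k ih =>
    rw [Function.iterate_succ_apply']
    refine ih.sndDeriv.trans ?_
    filter_upwards [(hh.sndDeriv_iterate k).eventually_analyticAt,
      (hh.sndDeriv_iterate (k + 1)).eventually_analyticAt] with x hx hx'
    rw [sndDeriv_add (differentiableAt_snd.fun_mul hx'.differentiableAt)
      (hx.differentiableAt.const_mul _), sndDeriv_snd_mul hx'.differentiableAt,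
      sndDeriv_const_mul _ hx.differentiableAt, ← Function.iterate_succ_apply' sndDeriv (k + 1) h,
      ← Function.iterate_succ_apply' sndDeriv k h]
    push_cast
    ring

/-- Taylor expansion of an analytic function in the last variable, with analytic remainder. -/
lemma AnalyticAt.exists_taylor_snd (n : ℕ) {f : E × ℝ → ℝ} {a : E} (hf : AnalyticAt ℝ f (a, 0)) :
    ∃ h : E × ℝ → ℝ, AnalyticAt ℝ h (a, 0) ∧ h (a, 0) = sndDeriv^[n] f (a, 0) / n.factorial ∧
      ∀ᶠ x in 𝓝 (a, (0 : ℝ)), f x = ∑ k ∈ Finset.range n,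
        sndDeriv^[k] f (x.1, 0) / k.factorial * x.2 ^ k + x.2 ^ n * h x := by
  induction n generalizing f with
  | zero => exact ⟨f, hf, by simp, by simp⟩
  | succ n ih =>
    obtain ⟨g, hg, H⟩ := hf.exists_eq_add_snd_mul
    obtain ⟨h, hh, h0, H'⟩ := ih hg
    have key : ∀ k, ∀ᶠ x in 𝓝 (a, (0 : ℝ)),
        sndDeriv^[k + 1] f (x.1, 0) = (k + 1) * sndDeriv^[k] g (x.1, 0) := fun k => by
      filter_upwards [(tendsto_killSnd a).eventually (sndDeriv_iterate_succ_of_eq hf hg H k)]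
        with x hx
      simpa using hx
    refine ⟨h, hh, ?_, ?_⟩
    · have := (key n).self_of_nhds
      simp only at this
      rw [h0, this, Nat.factorial_succ]
      push_cast
      have : (n.factorial : ℝ) ≠ 0 := by positivity
      field_simp
    · filter_upwards [H, H', (Filter.eventually_all_finset (Finset.range n)).2 fun k _ => key k]
        with x h1 h2 h3
      rw [h1, h2, Finset.sum_range_succ']
      have : ∑ k ∈ Finset.range n, sndDeriv^[k + 1] f (x.1, 0) / (k + 1).factorial * x.2 ^ (k + 1)
          = x.2 * ∑ k ∈ Finset.range n, sndDeriv^[k] g (x.1, 0) / k.factorial * x.2 ^ k := by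
        rw [Finset.mul_sum]
        refine Finset.sum_congr rfl fun k hk => ?_
        rw [h3 k hk, Nat.factorial_succ]
        push_cast
        have : (k.factorial : ℝ) ≠ 0 := by positivity
        field_simp
        ring
      rw [this]
      simp
      ring
end Division

/-! ### Weighted sublevel masses -/

section SublevelMass

/-- The mass `∫ t ^ γ` of the part of `A` where `t ^ β * |g (t, y)| ≤ ε`. -/
noncomputable def sublevelMass (g : ℝ × ℝ → ℝ) (β γ : ℕ) (A : Set (ℝ × ℝ)) (ε : ℝ) : ℝ≥0∞ :=
  ∫⁻ x in A, {x : ℝ × ℝ | x.1 ^ β * |g x| ≤ ε}.indicator (fun x => ENNReal.ofReal (x.1 ^ γ)) x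

/-- The box `(0, δ) × (y₀ - δ, y₀ + δ)`. -/
def halfBox (y₀ δ : ℝ) : Set (ℝ × ℝ) := Ioo 0 δ ×ˢ Ioo (y₀ - δ) (y₀ + δ)

lemma mem_halfBox {y₀ δ : ℝ} {x : ℝ × ℝ} :
    x ∈ halfBox y₀ δ ↔ 0 < x.1 ∧ x.1 < δ ∧ |x.2 - y₀| < δ := by
  simp only [halfBox, mem_prod, mem_Ioo, abs_lt]
  constructor
  · rintro ⟨⟨h1, h2⟩, h3, h4⟩; exact ⟨h1, h2, by linarith, by linarith⟩
  · rintro ⟨h1, h2, h3, h4⟩; exact ⟨⟨h1, h2⟩, by linarith, by linarith⟩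

lemma measurableSet_halfBox (y₀ δ : ℝ) : MeasurableSet (halfBox y₀ δ) :=
  measurableSet_Ioo.prod measurableSet_Ioo

lemma halfBox_mono {y₀ δ δ' : ℝ} (h : δ ≤ δ') : halfBox y₀ δ ⊆ halfBox y₀ δ' := by
  intro x hx
  rw [mem_halfBox] at hx ⊢
  exact ⟨hx.1, hx.2.1.trans_le h, hx.2.2.trans_le h⟩

lemma exists_halfBox_of_eventually {P : ℝ × ℝ → Prop} {y₀ : ℝ} (h : ∀ᶠ x in 𝓝 (0, y₀), P x) :
    ∃ δ > 0, ∀ x ∈ halfBox y₀ δ, P x := by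
  obtain ⟨δ, hδ, H⟩ := Metric.eventually_nhds_iff_ball.1 h
  refine ⟨δ, hδ, fun x hx => H x ?_⟩
  rw [mem_halfBox] at hx
  rw [Metric.mem_ball, Prod.dist_eq, max_lt_iff, Real.dist_eq, Real.dist_eq, sub_zero,
    abs_of_pos hx.1]
  exact hx.2

variable {g : ℝ × ℝ → ℝ} {β γ : ℕ} {s : ℝ}

lemma sublevelMass_mono {A B : Set (ℝ × ℝ)} (h : A ⊆ B) (ε : ℝ) :
    sublevelMass g β γ A ε ≤ sublevelMass g β γ B ε :=
  lintegral_mono_set h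

lemma sublevelMass_union_le (A B : Set (ℝ × ℝ)) (ε : ℝ) :
    sublevelMass g β γ (A ∪ B) ε ≤ sublevelMass g β γ A ε + sublevelMass g β γ B ε :=
  lintegral_union_le _ _ _

/-- The masses on `A` are bounded by a power with exponent bigger than `s`. -/
def PowerUpper (g : ℝ × ℝ → ℝ) (β γ : ℕ) (s : ℝ) (A : Set (ℝ × ℝ)) : Prop :=
  ∃ η > 0, ∃ C : ℝ, ∀ ε, 0 < ε → ε ≤ 1 → sublevelMass g β γ A ε ≤ ENNReal.ofReal (C * ε ^ (s + η))

/-- The masses on `A` are bounded from below by the power with exponent `s`. -/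
def PowerLower (g : ℝ × ℝ → ℝ) (β γ : ℕ) (s : ℝ) (A : Set (ℝ × ℝ)) : Prop :=
  ∃ c > 0, ∃ ε₀ > 0, ∀ ε, 0 < ε → ε < ε₀ → ENNReal.ofReal (c * ε ^ s) ≤ sublevelMass g β γ A ε

lemma PowerUpper.mono {A B : Set (ℝ × ℝ)} (hB : PowerUpper g β γ s B) (h : A ⊆ B) :
    PowerUpper g β γ s A := by
  obtain ⟨η, hη, C, hC⟩ := hB
  exact ⟨η, hη, C, fun ε h1 h2 => (sublevelMass_mono h ε).trans (hC ε h1 h2)⟩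

lemma PowerUpper.union {A B : Set (ℝ × ℝ)} (hA : PowerUpper g β γ s A)
    (hB : PowerUpper g β γ s B) : PowerUpper g β γ s (A ∪ B) := by
  obtain ⟨η, hη, C, hC⟩ := hA
  obtain ⟨θ, hθ, D, hD⟩ := hB
  refine ⟨min η θ, lt_min hη hθ, |C| + |D|, fun ε h1 h2 => ?_⟩
  refine (sublevelMass_union_le A B ε).trans ?_
  have e1 : ε ^ (s + η) ≤ ε ^ (s + min η θ) :=
    Real.rpow_le_rpow_of_exponent_ge h1 h2 (by gcongr; exact min_le_left _ _)
  have e2 : ε ^ (s + θ) ≤ ε ^ (s + min η θ) :=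
    Real.rpow_le_rpow_of_exponent_ge h1 h2 (by gcongr; exact min_le_right _ _)
  have p1 := Real.rpow_nonneg h1.le (s + η)
  have p2 := Real.rpow_nonneg h1.le (s + θ)
  rw [add_mul, ENNReal.ofReal_add (by positivity) (by positivity)]
  refine add_le_add ((hC ε h1 h2).trans (ENNReal.ofReal_le_ofReal ?_))
    ((hD ε h1 h2).trans (ENNReal.ofReal_le_ofReal ?_))
  · exact mul_le_mul (le_abs_self C) e1 p1 (abs_nonneg C)
  · exact mul_le_mul (le_abs_self D) e2 p2 (abs_nonneg D)

lemma PowerUpper.empty : PowerUpper g β γ s ∅ :=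
  ⟨1, one_pos, 0, fun ε _ _ => by simp [sublevelMass]⟩

/-- Weighted homogeneous change of variables. -/
def blowMap (p q : ℕ) (ψ : ℝ → ℝ) (x : ℝ × ℝ) : ℝ × ℝ := (x.1 ^ q, x.1 ^ p * x.2 + ψ (x.1 ^ q))

lemma injOn_blowMap {p q : ℕ} (hq : q ≠ 0) (ψ : ℝ → ℝ) {A : Set (ℝ × ℝ)}
    (hA : ∀ x ∈ A, 0 < x.1) : InjOn (blowMap p q ψ) A := by
  intro x hx y hy hxy
  simp only [blowMap, Prod.mk.injEq] at hxy
  have h1 : x.1 = y.1 := (pow_left_inj₀ (hA x hx).le (hA y hy).le hq).1 hxy.1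
  have h2 := hxy.2
  rw [h1] at h2
  have := pow_pos (hA y hy) p
  refine Prod.ext h1 ?_
  have h3 : y.1 ^ p * x.2 = y.1 ^ p * y.2 := by linarith
  exact mul_left_cancel₀ this.ne' h3

lemma hasFDerivAt_blowMap {p q : ℕ} {ψ : ℝ → ℝ} {x : ℝ × ℝ} (hψ : DifferentiableAt ℝ ψ (x.1 ^ q)) :
    HasFDerivAt (blowMap p q ψ) (LinearMap.toContinuousLinearMap
      (Matrix.toLin (Module.Basis.finTwoProd ℝ) (Module.Basis.finTwoProd ℝ)
        !![q * x.1 ^ (q - 1), 0;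
          p * x.1 ^ (p - 1) * x.2 + deriv ψ (x.1 ^ q) * (q * x.1 ^ (q - 1)), x.1 ^ p])) x := by
  rw [Matrix.toLin_finTwoProd_toContinuousLinearMap]
  have h1 : HasFDerivAt (fun x : ℝ × ℝ => x.1) (ContinuousLinearMap.fst ℝ ℝ ℝ) x := hasFDerivAt_fst
  have h2 : HasFDerivAt (fun x : ℝ × ℝ => x.2) (ContinuousLinearMap.snd ℝ ℝ ℝ) x := hasFDerivAt_snd
  have hq := (hasDerivAt_pow q x.1).comp_hasFDerivAt x h1
  have hp := (hasDerivAt_pow p x.1).comp_hasFDerivAt x h1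
  have hψ' := hψ.hasDerivAt.comp_hasFDerivAt x hq
  refine (hq.prodMk ((hp.mul h2).add hψ')).congr_fderiv ?_
  ext <;> simp
  ring

/-- The derivative is triangular with Jacobian q τ^(q-1) τ^p. It joins the weight, and the factor
τ^m split off from g joins the constraint, so weighted masses form a class stable under blow-up. -/
lemma sublevelMass_image_blowMap {p q m : ℕ} (hq : q ≠ 0) {ψ : ℝ → ℝ} {A : Set (ℝ × ℝ)}
    (hAm : MeasurableSet A) (hA : ∀ x ∈ A, 0 < x.1)
    (hψ : ∀ x ∈ A, DifferentiableAt ℝ ψ (x.1 ^ q)) {G : ℝ × ℝ → ℝ}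
    (hG : ∀ x ∈ A, g (blowMap p q ψ x) = x.1 ^ m * G x) (ε : ℝ) :
    sublevelMass g β γ (blowMap p q ψ '' A) ε =
      q * sublevelMass G (q * β + m) (q * γ + (q - 1) + p) A ε := by
  rw [sublevelMass, lintegral_image_eq_lintegral_abs_det_fderiv_mul volume hAm
    (fun x hx => (hasFDerivAt_blowMap (hψ x hx)).hasFDerivWithinAt) (injOn_blowMap hq ψ hA),
    sublevelMass, ← lintegral_const_mul' _ _ (ENNReal.natCast_ne_top q)]
  refine setLIntegral_congr_fun hAm fun x hx => ?_
  have hx0 := hA x hx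
  have hdet : |(LinearMap.toContinuousLinearMap
      (Matrix.toLin (Module.Basis.finTwoProd ℝ) (Module.Basis.finTwoProd ℝ)
        !![q * x.1 ^ (q - 1), 0;
          p * x.1 ^ (p - 1) * x.2 + deriv ψ (x.1 ^ q) * (q * x.1 ^ (q - 1)), x.1 ^ p])).det|
      = q * (x.1 ^ (q - 1) * x.1 ^ p) := by
    rw [ContinuousLinearMap.det, LinearMap.coe_toContinuousLinearMap, LinearMap.det_toLin,
      Matrix.det_fin_two_of, abs_of_nonneg]
    · ring
    · simp only [zero_mul, sub_zero]; positivity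
  have hiff : blowMap p q ψ x ∈ {x : ℝ × ℝ | x.1 ^ β * |g x| ≤ ε} ↔
      x ∈ {x : ℝ × ℝ | x.1 ^ (q * β + m) * |G x| ≤ ε} := by
    simp only [mem_ofPred_eq, hG x hx, abs_mul, abs_of_pos (pow_pos hx0 m)]
    simp only [blowMap, pow_add, pow_mul, mul_assoc]
  rw [hdet]
  by_cases h : x ∈ {x : ℝ × ℝ | x.1 ^ (q * β + m) * |G x| ≤ ε}
  · rw [indicator_of_mem h, indicator_of_mem (hiff.2 h), ENNReal.ofReal_mul (by positivity),
      ENNReal.ofReal_natCast, mul_assoc, ← ENNReal.ofReal_mul (by positivity)]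
    congr 2
    simp only [blowMap, pow_add, pow_mul]
    ring
  · rw [indicator_of_notMem h, indicator_of_notMem (mt hiff.1 h)]
    simp

end SublevelMass

/-! ### Explicit lower and upper bounds for weighted masses -/

section Bounds

variable {g : ℝ × ℝ → ℝ} {β γ : ℕ} {s : ℝ}

lemma le_sublevelMass_of_rectangle {A : Set (ℝ × ℝ)} {a b c d w ε : ℝ} (ha : 0 ≤ a) (hab : a ≤ b)
    (hw : w ≤ a ^ γ) (hw0 : 0 ≤ w)
    (hsub : Ioo a b ×ˢ Ioo c d ⊆ A)
    (h : ∀ x ∈ Ioo a b ×ˢ Ioo c d, x.1 ^ β * |g x| ≤ ε) :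
    ENNReal.ofReal (w * ((b - a) * (d - c))) ≤ sublevelMass g β γ A ε := by
  refine le_trans ?_ (sublevelMass_mono hsub ε)
  have hR : MeasurableSet (Ioo a b ×ˢ Ioo c d) := measurableSet_Ioo.prod measurableSet_Ioo
  calc ENNReal.ofReal (w * ((b - a) * (d - c)))
      = ∫⁻ _ in Ioo a b ×ˢ Ioo c d, ENNReal.ofReal w := by
        rw [setLIntegral_const, Measure.volume_eq_prod, Measure.prod_prod, Real.volume_Ioo,
          Real.volume_Ioo, ENNReal.ofReal_mul hw0, ENNReal.ofReal_mul (sub_nonneg.2 hab)]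
    _ ≤ _ := by
        refine setLIntegral_mono' hR fun x hx => ?_
        rw [indicator_of_mem (show x ∈ {x : ℝ × ℝ | x.1 ^ β * |g x| ≤ ε} from h x hx)]
        refine ENNReal.ofReal_le_ofReal (hw.trans ?_)
        exact pow_le_pow_left₀ ha hx.1.1.le _

/-- Lower bound for the mass near a point, from a thin vertical strip at `t = 0`. -/
lemma powerLower_of_bounded {y₀ C δ₁ : ℝ} (hδ₁ : 0 < δ₁)
    (hg : ∀ x ∈ halfBox y₀ δ₁, |g x| ≤ C) (hs : (γ : ℝ) + 1 ≤ s * β) {δ : ℝ} (hδ : 0 < δ) :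
    PowerLower g β γ s (halfBox y₀ δ) := by
  have hβ : 0 < β := by
    rcases Nat.eq_zero_or_pos β with h | h
    · exfalso; subst h; simp at hs; have : (0 : ℝ) ≤ γ := Nat.cast_nonneg γ; linarith
    · exact h
  have hβ' : (0 : ℝ) < β := by exact_mod_cast hβ
  set D := max C 1 with hD
  have hD0 : 0 < D := lt_max_of_lt_right one_pos
  set δ' := min δ δ₁ with hδ'
  have hδ'0 : 0 < δ' := lt_min hδ hδ₁
  set K : ℝ := (D ^ (-(1 / β : ℝ)) / 2) ^ (γ + 1) * (2 * δ') with hK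
  have hK0 : 0 < K := by positivity
  refine ⟨K, hK0, min 1 (D * δ' ^ β), by positivity, fun ε h0 h1 => ?_⟩
  have hε1 : ε < 1 := h1.trans_le (min_le_left _ _)
  have hε2 : ε < D * δ' ^ β := h1.trans_le (min_le_right _ _)
  -- T solves T^β D = ε. On T/2 < t < T the weight t^γ is comparable to T^γ, so the strip has mass
  -- about T^(γ+1), that is, ε^((γ+1)/β).
  set T := (ε / D) ^ (1 / β : ℝ) with hT
  have hT0 : 0 < T := by positivity
  have hTβ : T ^ β = ε / D := by
    rw [hT, ← Real.rpow_natCast, ← Real.rpow_mul (by positivity), one_div_mul_cancel (by positivity),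
      Real.rpow_one]
  have hTδ : T ≤ δ' := by
    refine le_of_pow_le_pow_left₀ hβ.ne' hδ'0.le ?_
    rw [hTβ, div_le_iff₀ hD0]; linarith
  refine le_trans (ENNReal.ofReal_le_ofReal ?_) (le_sublevelMass_of_rectangle (a := T / 2) (b := T)
    (c := y₀ - δ') (d := y₀ + δ') (w := (T / 2) ^ γ) (by positivity) (by linarith) le_rfl
    (by positivity) ?_ ?_)
  · have e1 : (T / 2) ^ γ * ((T - T / 2) * (y₀ + δ' - (y₀ - δ'))) = (T / 2) ^ (γ + 1) * (2 * δ') := by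
      ring
    have e2 : T = ε ^ (1 / β : ℝ) * D ^ (-(1 / β : ℝ)) := by
      rw [hT, Real.div_rpow h0.le hD0.le, Real.rpow_neg hD0.le]; rfl
    have e3 : (ε ^ (1 / β : ℝ)) ^ (γ + 1) = ε ^ (((γ : ℝ) + 1) / β) := by
      rw [← Real.rpow_natCast, ← Real.rpow_mul h0.le]; congr 1; push_cast; ring
    have e4 : ε ^ s ≤ ε ^ (((γ : ℝ) + 1) / β) :=
      Real.rpow_le_rpow_of_exponent_ge h0 hε1.le (by rw [div_le_iff₀ hβ']; exact hs)
    rw [e1, e2, mul_div_assoc, mul_pow, e3, hK]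
    calc _ ≤ (D ^ (-(1 / β : ℝ)) / 2) ^ (γ + 1) * (2 * δ') * ε ^ (((γ : ℝ) + 1) / β) := by gcongr
      _ = _ := by ring
  · intro x hx
    rw [mem_halfBox]
    refine ⟨lt_trans (by positivity) hx.1.1, hx.1.2.trans_le (hTδ.trans (min_le_left _ _)), ?_⟩
    rw [abs_lt]
    have := min_le_left δ δ₁
    constructor <;> [linarith [hx.2.1]; linarith [hx.2.2]]
  · intro x hx
    have hx0 : 0 < x.1 := lt_trans (by positivity) hx.1.1
    have hxB : x ∈ halfBox y₀ δ₁ := by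
      rw [mem_halfBox]
      refine ⟨hx0, hx.1.2.trans_le (hTδ.trans (min_le_right _ _)), ?_⟩
      rw [abs_lt]
      have := min_le_right δ δ₁
      constructor <;> [linarith [hx.2.1]; linarith [hx.2.2]]
    calc x.1 ^ β * |g x| ≤ T ^ β * D := by
          gcongr
          · exact hx.1.2.le
          · exact (hg x hxB).trans (le_max_left _ _)
      _ = ε := by rw [hTβ]; field_simp

/-- Lower bound for the mass near a zero of order `n` in the second variable. -/
lemma powerLower_of_le_pow {n : ℕ} (hn : n ≠ 0) {C δ₁ : ℝ} (hδ₁ : 0 < δ₁)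
    (hg : ∀ x ∈ halfBox 0 δ₁, |g x| ≤ C * |x.2| ^ n) (hs : 1 ≤ s * n) {δ : ℝ} (hδ : 0 < δ) :
    PowerLower g β γ s (halfBox 0 δ) := by
  have hn' : (0 : ℝ) < n := by exact_mod_cast Nat.pos_of_ne_zero hn
  set D := max C 1 with hD
  have hD0 : 0 < D := lt_max_of_lt_right one_pos
  set δ' := min 1 (min δ δ₁) with hδ'
  have hδ'0 : 0 < δ' := lt_min one_pos (lt_min hδ hδ₁)
  have hd1 : δ' ≤ 1 := min_le_left _ _
  have hd2 : δ' ≤ δ := (min_le_right _ _).trans (min_le_left _ _)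
  have hd3 : δ' ≤ δ₁ := (min_le_right _ _).trans (min_le_right _ _)
  refine ⟨(δ' / 2) ^ γ * (δ' / 2 * (2 * D ^ (-(1 / n : ℝ)))), by positivity,
    min 1 (D * δ' ^ n), by positivity, fun ε h0 h1 => ?_⟩
  have hε1 : ε < 1 := h1.trans_le (min_le_left _ _)
  have hε2 : ε < D * δ' ^ n := h1.trans_le (min_le_right _ _)
  -- T solves D T^n = ε. The rectangle |y| < T keeps t between δ'/2 and δ' ≤ 1, so that t^β ≤ 1 and
  -- the weight t^γ is bounded below.
  set T := (ε / D) ^ (1 / n : ℝ) with hT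
  have hT0 : 0 < T := by positivity
  have hTn : T ^ n = ε / D := by
    rw [hT, ← Real.rpow_natCast, ← Real.rpow_mul (by positivity), one_div_mul_cancel (by positivity),
      Real.rpow_one]
  have hTδ : T ≤ δ' := by
    refine le_of_pow_le_pow_left₀ hn hδ'0.le ?_
    rw [hTn, div_le_iff₀ hD0]; linarith
  have hmem : ∀ x ∈ Ioo (δ' / 2) δ' ×ˢ Ioo (-T) T, x ∈ halfBox 0 δ' := by
    intro x hx
    rw [mem_halfBox, sub_zero]
    exact ⟨lt_trans (by positivity) hx.1.1, hx.1.2, (abs_lt.2 hx.2).trans_le hTδ⟩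
  refine le_trans (ENNReal.ofReal_le_ofReal ?_) (le_sublevelMass_of_rectangle (a := δ' / 2) (b := δ')
    (c := -T) (d := T) (w := (δ' / 2) ^ γ) (by positivity) (by linarith) le_rfl
    (by positivity) (fun x hx => halfBox_mono hd2 (hmem x hx)) ?_)
  · have e2 : T = ε ^ (1 / n : ℝ) * D ^ (-(1 / n : ℝ)) := by
      rw [hT, Real.div_rpow h0.le hD0.le, Real.rpow_neg hD0.le]; rfl
    have e4 : ε ^ s ≤ ε ^ (1 / n : ℝ) :=
      Real.rpow_le_rpow_of_exponent_ge h0 hε1.le (by rw [div_le_iff₀ hn']; exact hs)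
    calc _ ≤ (δ' / 2) ^ γ * (δ' / 2 * (2 * D ^ (-(1 / n : ℝ)))) * ε ^ (1 / n : ℝ) := by gcongr
      _ = _ := by rw [e2]; ring
  · intro x hx
    have hxB := halfBox_mono hd3 (hmem x hx)
    have hx0 : 0 < x.1 := lt_trans (by positivity) hx.1.1
    calc x.1 ^ β * |g x| ≤ 1 * (D * T ^ n) := by
          gcongr
          · exact pow_le_one₀ hx0.le (hx.1.2.le.trans hd1)
          · refine (hg x hxB).trans ?_
            gcongr
            · exact le_max_left _ _
            · exact (abs_lt.2 hx.2).le
      _ = ε := by rw [hTn]; field_simp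

lemma lintegral_rpow_Ioo_lt_top {a : ℝ} (ha : -1 < a) {δ : ℝ} (hδ : 0 < δ) :
    ∫⁻ t in Ioo 0 δ, ENNReal.ofReal (t ^ a) < ⊤ :=
  ((intervalIntegral.integrableOn_Ioo_rpow_iff hδ).2 ha).lintegral_lt_top

lemma lintegral_abs_rpow_Ioo_lt_top {a : ℝ} (ha : -1 < a) {δ : ℝ} (hδ : 0 < δ) :
    ∫⁻ t in Ioo (-δ) δ, ENNReal.ofReal (|t| ^ a) < ⊤ := by
  have h1 : ∫⁻ t in Ioo 0 δ, ENNReal.ofReal (|t| ^ a) < ⊤ := by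
    rw [setLIntegral_congr_fun measurableSet_Ioo (g := fun t => ENNReal.ofReal (t ^ a))
      fun t ht => by simp only [abs_of_pos ht.1]]
    exact lintegral_rpow_Ioo_lt_top ha hδ
  have h2 : ∫⁻ t in Ioo (-δ) 0, ENNReal.ofReal (|t| ^ a) < ⊤ := by
    have := (Measure.measurePreserving_neg (volume : Measure ℝ)).setLIntegral_comp_preimage_emb
      (MeasurableEquiv.neg ℝ).measurableEmbedding (fun t => ENNReal.ofReal (|t| ^ a)) (Ioo (-δ) 0)
    rw [← this]
    simpa using h1
  have hsub : Ioo (-δ) δ ⊆ (Ioo (-δ) 0 ∪ Ioo 0 δ) ∪ {0} := by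
    intro t ht
    rcases lt_trichotomy t 0 with h | h | h
    · exact Or.inl (Or.inl ⟨ht.1, h⟩)
    · exact Or.inr h
    · exact Or.inl (Or.inr ⟨h, ht.2⟩)
  refine (lintegral_mono_set hsub).trans_lt ((lintegral_union_le _ _ _).trans_lt ?_)
  refine ENNReal.add_lt_top.2 ⟨(lintegral_union_le _ _ _).trans_lt
    (ENNReal.add_lt_top.2 ⟨h2, h1⟩), ?_⟩
  simp

/-- Upper bound for the mass where `t ^ β * |g|` dominates a monomial. -/
lemma powerUpper_of_monomial_le {A : Set (ℝ × ℝ)} (hAm : MeasurableSet A) {δ c b m : ℝ}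
    (hδ : 0 < δ) (hA : A ⊆ halfBox 0 δ) (hc : 0 < c) (hs : 0 ≤ s) (hb : s * b < γ + 1)
    (hm : s * m < 1)
    (h : ∀ x ∈ A, c * (x.1 ^ b * |x.2| ^ m) ≤ x.1 ^ β * |g x|) : PowerUpper g β γ s A := by
  -- The hypotheses are strict, hence survive a small increase of the exponent; this is the source
  -- of the power gain.
  obtain ⟨η, hη, h1, h2⟩ : ∃ η > 0, (s + η) * b < γ + 1 ∧ (s + η) * m < 1 := by
    have t1 : Tendsto (fun η : ℝ => (s + η) * b) (𝓝[>] 0) (𝓝 (s * b)) := by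
      have : Continuous fun η : ℝ => (s + η) * b := by fun_prop
      have := this.tendsto 0
      rw [add_zero] at this
      exact this.mono_left nhdsWithin_le_nhds
    have t2 : Tendsto (fun η : ℝ => (s + η) * m) (𝓝[>] 0) (𝓝 (s * m)) := by
      have : Continuous fun η : ℝ => (s + η) * m := by fun_prop
      have := this.tendsto 0
      rw [add_zero] at this
      exact this.mono_left nhdsWithin_le_nhds
    obtain ⟨η, ⟨h1, h2⟩, h3⟩ := (((t1.eventually_lt_const hb).and
      (t2.eventually_lt_const hm)).and self_mem_nhdsWithin).exists
    exact ⟨η, h3, h1, h2⟩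
  set σ := s + η with hσ
  have hσ0 : 0 < σ := by positivity
  -- Chebyshev with exponent σ: the indicator of the sublevel set is at most (ε / (c t^b |y|^m))^σ.
  -- Against t^γ this is integrable because σ b < γ + 1 and σ m < 1.
  set I : ℝ≥0∞ := ∫⁻ x in halfBox 0 δ,
    ENNReal.ofReal (x.1 ^ ((γ : ℝ) - σ * b)) * ENNReal.ofReal (|x.2| ^ (-(σ * m))) with hI
  have hI' : I < ⊤ := by
    rw [hI, halfBox, Measure.volume_eq_prod, ← Measure.prod_restrict,
      lintegral_prod_mul (f := fun t : ℝ => ENNReal.ofReal (t ^ ((γ : ℝ) - σ * b)))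
        (g := fun t : ℝ => ENNReal.ofReal (|t| ^ (-(σ * m)))) (by fun_prop) (by fun_prop)]
    refine ENNReal.mul_lt_top (lintegral_rpow_Ioo_lt_top (by linarith) hδ) ?_
    rw [zero_sub, zero_add]
    exact lintegral_abs_rpow_Ioo_lt_top (by linarith) hδ
  refine ⟨η, hη, c ^ (-σ) * I.toReal, fun ε h0 _ => ?_⟩
  rw [mul_right_comm, ENNReal.ofReal_mul (by positivity), ENNReal.ofReal_toReal hI'.ne]
  -- A negative real power of 0 is 0 by convention, so the pointwise bound can fail on the axis y =
  -- 0 and is claimed almost everywhere only.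
  have hnull : ∀ᵐ x : ℝ × ℝ, x.2 ≠ 0 := by
    have : (volume : Measure (ℝ × ℝ)) {x | x.2 = 0} = 0 := by
      have e : {x : ℝ × ℝ | x.2 = 0} = univ ×ˢ {0} := by ext; simp
      rw [e, Measure.volume_eq_prod, Measure.prod_prod]; simp
    simpa [ae_iff] using this
  calc sublevelMass g β γ A ε
      ≤ ∫⁻ x in A, ENNReal.ofReal (c ^ (-σ) * ε ^ σ) * (ENNReal.ofReal (x.1 ^ ((γ : ℝ) - σ * b)) *
          ENNReal.ofReal (|x.2| ^ (-(σ * m)))) := by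
        refine setLIntegral_mono_ae' hAm (hnull.mono fun x hx0 hx => ?_)
        by_cases hxe : x.1 ^ β * |g x| ≤ ε
        · rw [indicator_of_mem (show x ∈ {x : ℝ × ℝ | x.1 ^ β * |g x| ≤ ε} from hxe)]
          have hx1 := (mem_halfBox.1 (hA hx)).1
          have hx2 : 0 < |x.2| := abs_pos.2 hx0
          rw [← ENNReal.ofReal_mul (by positivity), ← ENNReal.ofReal_mul (by positivity)]
          refine ENNReal.ofReal_le_ofReal ?_
          have key : (c * (x.1 ^ b * |x.2| ^ m)) ^ σ ≤ ε ^ σ :=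
            Real.rpow_le_rpow (by positivity) ((h x hx).trans hxe) hσ0.le
          rw [Real.mul_rpow hc.le (by positivity), Real.mul_rpow (by positivity) (by positivity),
            ← Real.rpow_mul hx1.le, ← Real.rpow_mul hx2.le] at key
          rw [Real.rpow_sub hx1, Real.rpow_natCast, Real.rpow_neg hx2.le, Real.rpow_neg hc.le,
            mul_comm σ b, mul_comm σ m]
          have p1 : 0 < c ^ σ := by positivity
          have p2 : 0 < x.1 ^ (b * σ) := by positivity
          have p3 : 0 < |x.2| ^ (m * σ) := by positivity
          have e : (c ^ σ)⁻¹ * ε ^ σ * (x.1 ^ γ / x.1 ^ (b * σ) * (|x.2| ^ (m * σ))⁻¹)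
            = ε ^ σ * x.1 ^ γ / (c ^ σ * (x.1 ^ (b * σ) * |x.2| ^ (m * σ))) := by
            field_simp
          rw [e, le_div_iff₀ (by positivity), mul_comm]
          gcongr
        · rw [indicator_of_notMem (by exact hxe)]
          exact zero_le
    _ = ENNReal.ofReal (c ^ (-σ) * ε ^ σ) * ∫⁻ x in A, ENNReal.ofReal (x.1 ^ ((γ : ℝ) - σ * b)) *
          ENNReal.ofReal (|x.2| ^ (-(σ * m))) := lintegral_const_mul' _ _ ENNReal.ofReal_ne_top
    _ ≤ _ := by gcongr; exact lintegral_mono_set hA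

end Bounds

/-! ### Lower and upper alternatives, and their behaviour under substitutions -/

section Dichotomy

variable {g : ℝ × ℝ → ℝ} {β γ : ℕ} {s : ℝ}

/-- The masses near `(0, y₀)` decay at most like the power with positive exponent `s`. -/
def LowerAt (g : ℝ × ℝ → ℝ) (β γ : ℕ) (s y₀ : ℝ) : Prop :=
  0 < s ∧ ∀ δ > 0, PowerLower g β γ s (halfBox y₀ δ)

/-- The masses near `(0, y₀)` decay faster than the power with exponent `s`, by a power. -/
def UpperAt (g : ℝ × ℝ → ℝ) (β γ : ℕ) (s y₀ : ℝ) : Prop :=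
  ∃ δ > 0, PowerUpper g β γ s (halfBox y₀ δ)

lemma PowerUpper.image_blowMap {p q m : ℕ} (hq : q ≠ 0) {ψ : ℝ → ℝ} {A : Set (ℝ × ℝ)}
    (hAm : MeasurableSet A) (hA : ∀ x ∈ A, 0 < x.1)
    (hψ : ∀ x ∈ A, DifferentiableAt ℝ ψ (x.1 ^ q)) {G : ℝ × ℝ → ℝ}
    (hG : ∀ x ∈ A, g (blowMap p q ψ x) = x.1 ^ m * G x)
    (h : PowerUpper G (q * β + m) (q * γ + (q - 1) + p) s A) :
    PowerUpper g β γ s (blowMap p q ψ '' A) := by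
  obtain ⟨η, hη, C, hC⟩ := h
  refine ⟨η, hη, q * C, fun ε h1 h2 => ?_⟩
  rw [sublevelMass_image_blowMap hq hAm hA hψ hG, mul_assoc, ENNReal.ofReal_mul (by positivity),
    ENNReal.ofReal_natCast]
  gcongr
  exact hC ε h1 h2

/-- A lower bound needs only part of the domain: the image of a small box at a single point of the
exceptional line already has enough mass, and the factor q ≥ 1 can be dropped. -/
lemma LowerAt.of_blowMap {p q m : ℕ} (hq : q ≠ 0) {ψ : ℝ → ℝ} {G : ℝ × ℝ → ℝ} {y₀ z₀ : ℝ}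
    (h : LowerAt G (q * β + m) (q * γ + (q - 1) + p) s z₀)
    (H : ∀ δ > 0, ∃ δ' > 0, ∀ x ∈ halfBox z₀ δ', blowMap p q ψ x ∈ halfBox y₀ δ ∧
      DifferentiableAt ℝ ψ (x.1 ^ q) ∧ g (blowMap p q ψ x) = x.1 ^ m * G x) :
    LowerAt g β γ s y₀ := by
  refine ⟨h.1, fun δ hδ => ?_⟩
  obtain ⟨δ', hδ', H'⟩ := H δ hδ
  obtain ⟨c, hc, ε₀, hε₀, hl⟩ := h.2 δ' hδ'
  refine ⟨c, hc, ε₀, hε₀, fun ε h1 h2 => (hl ε h1 h2).trans ?_⟩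
  refine le_trans ?_ (sublevelMass_mono (g := g) (β := β) (γ := γ)
    (image_subset_iff.2 fun x hx => (H' x hx).1) ε)
  rw [sublevelMass_image_blowMap hq (measurableSet_halfBox _ _)
    (fun x hx => (mem_halfBox.1 hx).1) (fun x hx => (H' x hx).2.1) (fun x hx => (H' x hx).2.2)]
  refine le_mul_of_one_le_left zero_le ?_
  exact_mod_cast Nat.one_le_iff_ne_zero.2 hq

/-- A shear is the substitution with p = 0, q = 1, m = 0: both weights are unchanged. Boxes and
sheared boxes contain each other after shrinking, by continuity of ψ, so either alternative
transfers. -/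
lemma dichotomy_of_shear {ψ : ℝ → ℝ} {y₀ : ℝ} (hψ : ContDiffAt ℝ 1 ψ 0) (h0 : ψ 0 = y₀)
    (h : LowerAt (fun x => g (x.1, x.2 + ψ x.1)) β γ s 0 ∨
      UpperAt (fun x => g (x.1, x.2 + ψ x.1)) β γ s 0) :
    LowerAt g β γ s y₀ ∨ UpperAt g β γ s y₀ := by
  have hev : ∀ᶠ t in 𝓝 (0 : ℝ), DifferentiableAt ℝ ψ t :=
    (hψ.eventually (by simp)).mono fun t ht => ht.differentiableAt (by simp)
  have hbm : ∀ x, blowMap 0 1 ψ x = (x.1, x.2 + ψ x.1) := fun x => by simp [blowMap]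
  have hcl : ∀ δ > 0, ∃ δ' > 0, ∀ t, 0 < t → t < δ' → |ψ t - y₀| < δ / 2 ∧
      DifferentiableAt ℝ ψ t := by
    intro δ hδ
    have h1 : ∀ᶠ t in 𝓝 (0 : ℝ), |ψ t - y₀| < δ / 2 := by
      have := hψ.continuousAt.eventually (Metric.ball_mem_nhds (ψ 0) (half_pos hδ))
      rw [h0] at this
      exact this
    obtain ⟨r, hr, H⟩ := Metric.eventually_nhds_iff.1 (h1.and hev)
    refine ⟨r, hr, fun t ht ht' => H ?_⟩
    rwa [Real.dist_eq, sub_zero, abs_of_pos ht]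
  rcases h with h | ⟨δ, hδ, h⟩
  · left
    refine LowerAt.of_blowMap (p := 0) (q := 1) (m := 0) (ψ := ψ)
      (G := fun x => g (x.1, x.2 + ψ x.1)) (z₀ := 0) one_ne_zero (by simpa using h) fun δ hδ => ?_
    obtain ⟨r, hr, H⟩ := hcl δ hδ
    refine ⟨min r (δ / 2), lt_min hr (half_pos hδ), fun x hx => ?_⟩
    rw [mem_halfBox, sub_zero] at hx
    obtain ⟨h1, h2, h3⟩ := hx
    have := H x.1 h1 (h2.trans_le (min_le_left _ _))
    refine ⟨?_, by simpa using this.2, by simp [hbm]⟩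
    rw [hbm, mem_halfBox]
    refine ⟨h1, h2.trans_le ((min_le_right _ _).trans (by linarith)), ?_⟩
    have h4 : |x.2| < δ / 2 := h3.trans_le (min_le_right _ _)
    calc |x.2 + ψ x.1 - y₀| = |x.2 + (ψ x.1 - y₀)| := by ring_nf
      _ ≤ |x.2| + |ψ x.1 - y₀| := abs_add_le _ _
      _ < δ := by linarith [this.1]
  · right
    obtain ⟨r, hr, H⟩ := hcl δ hδ
    set δ' := min r (δ / 2) with hδ'
    have hδ'0 : 0 < δ' := lt_min hr (half_pos hδ)
    have hAm : MeasurableSet (halfBox 0 δ ∩ {x | x.1 < r}) :=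
      (measurableSet_halfBox _ _).inter (measurableSet_lt measurable_fst measurable_const)
    have key := PowerUpper.image_blowMap (g := g) (β := β) (γ := γ) (s := s) (p := 0) (q := 1)
      (m := 0) (ψ := ψ) (G := fun x => g (x.1, x.2 + ψ x.1)) one_ne_zero hAm
      (fun x hx => (mem_halfBox.1 hx.1).1)
      (fun x hx => by simpa using (H x.1 (mem_halfBox.1 hx.1).1 hx.2).2) (fun x _ => by simp [hbm])
      (by simpa using h.mono inter_subset_left)
    refine ⟨δ', hδ'0, key.mono fun x hx => ?_⟩
    rw [mem_halfBox] at hx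
    obtain ⟨h1, h2, h3⟩ := hx
    have h4 := (H x.1 h1 (h2.trans_le (min_le_left _ _))).1
    refine ⟨(x.1, x.2 - ψ x.1), ⟨?_, h2.trans_le (min_le_left _ _)⟩, by simp [hbm]⟩
    rw [mem_halfBox, sub_zero]
    refine ⟨h1, h2.trans_le ((min_le_right _ _).trans (by linarith)), ?_⟩
    have h5 : |x.2 - y₀| < δ / 2 := h3.trans_le (min_le_right _ _)
    calc |x.2 - ψ x.1| = |(x.2 - y₀) - (ψ x.1 - y₀)| := by ring_nf
      _ ≤ |x.2 - y₀| + |ψ x.1 - y₀| := abs_sub _ _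
      _ < δ := by linarith

lemma pos_of_add_one_le_mul (hs : 0 ≤ s) (h : (γ : ℝ) + 1 ≤ s * β) : 0 < s := by
  rcases hs.eq_or_lt with h0 | h0
  · rw [← h0, zero_mul] at h
    have : (0 : ℝ) ≤ γ := Nat.cast_nonneg γ
    linarith
  · exact h0

lemma LowerAt.of_continuousAt {y₀ : ℝ} (hg : ContinuousAt g (0, y₀)) (hs : 0 ≤ s)
    (h : (γ : ℝ) + 1 ≤ s * β) : LowerAt g β γ s y₀ := by
  have h1 : ∀ᶠ x in 𝓝 ((0 : ℝ), y₀), |g x| ≤ |g (0, y₀)| + 1 :=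
    (hg.abs.eventually_lt_const (lt_add_one _)).mono fun x hx => hx.le
  obtain ⟨δ₁, hδ₁, H⟩ := exists_halfBox_of_eventually h1
  exact ⟨pos_of_add_one_le_mul hs h, fun δ hδ => powerLower_of_bounded hδ₁ H h hδ⟩

/-- The terminal case of the induction. Here |g| is comparable to |y|^n, and the two thresholds s β
< γ + 1 and s n < 1 are those for integrability of t^γ (t^β |y|^n)^(-s). If one fails, a thin strip
along the corresponding axis gives the lower bound. -/
lemma dichotomy_of_pow_mul_unit {n : ℕ} {h : ℝ × ℝ → ℝ} (hh : ContinuousAt h (0, 0))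
    (hh0 : h (0, 0) ≠ 0) (hs : 0 ≤ s) (hg : ∀ᶠ x in 𝓝 ((0 : ℝ), (0 : ℝ)), g x = x.2 ^ n * h x) :
    LowerAt g β γ s 0 ∨ UpperAt g β γ s 0 := by
  have hpos : 0 < |h (0, 0)| := abs_pos.2 hh0
  obtain ⟨δ₁, hδ₁, H⟩ := exists_halfBox_of_eventually (hg.and
    ((hh.abs.eventually_lt_const (show |h (0, 0)| < 2 * |h (0, 0)| by linarith)).and
      (hh.abs.eventually_const_lt (show |h (0, 0)| / 2 < |h (0, 0)| by linarith))))
  by_cases h1 : (γ : ℝ) + 1 ≤ s * β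
  · left
    refine LowerAt.of_continuousAt ?_ hs h1
    have : ContinuousAt (fun x : ℝ × ℝ => x.2 ^ n * h x) (0, 0) :=
      (continuousAt_snd.pow n).mul hh
    exact this.congr (hg.mono fun x hx => hx.symm)
  by_cases h2 : 1 ≤ s * n
  · left
    have hn : n ≠ 0 := by rintro rfl; simp at h2; linarith
    have hs0 : 0 < s := by
      rcases hs.eq_or_lt with h0 | h0
      · rw [← h0, zero_mul] at h2; linarith
      · exact h0
    refine ⟨hs0, fun δ hδ => powerLower_of_le_pow hn (C := 2 * |h (0, 0)|) hδ₁ (fun x hx => ?_)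
      h2 hδ⟩
    obtain ⟨e1, e2, e3⟩ := H x hx
    rw [e1, abs_mul, abs_pow, mul_comm]
    gcongr
  · right
    refine ⟨δ₁, hδ₁, powerUpper_of_monomial_le (c := |h (0, 0)| / 2) (b := β) (m := n)
      (measurableSet_halfBox _ _) hδ₁ Subset.rfl (by positivity) hs (not_le.1 h1) (not_le.1 h2)
      fun x hx => ?_⟩
    obtain ⟨e1, e2, e3⟩ := H x hx
    have hx1 := (mem_halfBox.1 hx).1
    rw [e1, abs_mul, abs_pow, Real.rpow_natCast, Real.rpow_natCast]
    calc |h (0, 0)| / 2 * (x.1 ^ β * |x.2| ^ n) = x.1 ^ β * (|x.2| ^ n * (|h (0, 0)| / 2)) := by ring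
      _ ≤ _ := by gcongr

/-- Compactness of [-R, R]: a finite union keeps the smallest of finitely many gains η and of
finitely many sizes δ. -/
lemma exists_powerUpper_strip {G : ℝ × ℝ → ℝ} (hG : ∀ z, UpperAt G β γ s z) (R : ℝ) :
    ∃ δ > 0, PowerUpper G β γ s (Ioo 0 δ ×ˢ Icc (-R) R) := by
  refine (isCompact_Icc (a := -R) (b := R)).induction_on
    (p := fun Z => ∃ δ > 0, PowerUpper G β γ s (Ioo 0 δ ×ˢ Z)) ?_ ?_ ?_ ?_
  · exact ⟨1, one_pos, by simpa using PowerUpper.empty⟩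
  · rintro Z Z' hZ ⟨δ, hδ, h⟩
    exact ⟨δ, hδ, h.mono (prod_mono Subset.rfl hZ)⟩
  · rintro Z Z' ⟨δ, hδ, h⟩ ⟨δ', hδ', h'⟩
    refine ⟨min δ δ', lt_min hδ hδ', (h.union h').mono ?_⟩
    rintro x ⟨hx, hx'⟩
    rcases hx' with hx' | hx'
    · exact Or.inl ⟨⟨hx.1, hx.2.trans_le (min_le_left _ _)⟩, hx'⟩
    · exact Or.inr ⟨⟨hx.1, hx.2.trans_le (min_le_right _ _)⟩, hx'⟩
  · intro z _
    obtain ⟨δ, hδ, h⟩ := hG z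
    exact ⟨Ioo (z - δ) (z + δ), mem_nhdsWithin_of_mem_nhds
      (Ioo_mem_nhds (by linarith) (by linarith)), δ, hδ, h⟩

/-- Where |y| is at least a multiple of t^(p/q), a portion |y|^κ of |y|^n can be traded for t^(κ
p/q). The resulting monomial must satisfy both integrability thresholds; for s n ≥ 1 this asks for n
- 1/s < κ < ((γ+1)/s - β)/(p/q), an interval whose nonemptiness is exactly the threshold `h2` for
the blown-up weights. -/
lemma exists_split_exponent {n p q : ℕ} (hp : p ≠ 0) (hq : q ≠ 0) (hs : 0 ≤ s)
    (h1 : s * β < γ + 1)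
    (h2 : s * ((q * β + p * n : ℕ) : ℝ) < ((q * γ + (q - 1) + p : ℕ) : ℝ) + 1) :
    ∃ κ : ℝ, 0 ≤ κ ∧ s * (β + κ * (p / q)) < γ + 1 ∧ s * (n - κ) < 1 := by
  have hp' : (0 : ℝ) < p := by exact_mod_cast Nat.pos_of_ne_zero hp
  have hq' : (0 : ℝ) < q := by exact_mod_cast Nat.pos_of_ne_zero hq
  rcases lt_or_ge (s * n) 1 with h | h
  · exact ⟨0, le_rfl, by simpa using h1, by simpa using h⟩
  have hs0 : 0 < s := by
    rcases hs.eq_or_lt with h0 | h0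
    · rw [← h0, zero_mul] at h; linarith
    · exact h0
  have h3 : s * (q * β + p * n) < q * (γ + 1) + p := by
    have : ((q - 1 : ℕ) : ℝ) = q - 1 := by
      rw [Nat.cast_sub (Nat.one_le_iff_ne_zero.2 hq)]; simp
    push_cast [this] at h2
    linarith
  have h4 : (n : ℝ) - 1 / s < ((γ + 1) / s - β) / (p / q) := by
    rw [lt_div_iff₀ (by positivity), ← sub_pos]
    have : ((γ + 1) / s - β - (n - 1 / s) * (p / q) : ℝ)
      = (q * (γ + 1) + p - s * (q * β + p * n)) / (s * q) := by field_simp; ring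
    rw [this]
    exact div_pos (by linarith) (by positivity)
  obtain ⟨κ, hκ1, hκ2⟩ := exists_between h4
  refine ⟨κ, le_trans ?_ hκ1.le, ?_, ?_⟩
  · rw [sub_nonneg, div_le_iff₀ hs0]; linarith
  · rw [lt_div_iff₀ (by positivity), lt_sub_iff_add_lt, lt_div_iff₀ hs0] at hκ2
    linarith
  · have : s * (n - 1 / s) < s * κ := by gcongr
    rw [mul_sub, mul_one_div_cancel hs0.ne'] at this
    linarith

end Dichotomy

/-! ### Descending from the weighted blow-up -/

section BlowUp

variable {g : ℝ × ℝ → ℝ} {β γ : ℕ} {s : ℝ}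

/-- The function obtained from `∑ a k t * y ^ k + y ^ n * h (t, y)` by a weighted blow-up. -/
def blowUp (n p q : ℕ) (B : ℕ → ℝ → ℝ) (h : ℝ × ℝ → ℝ) (x : ℝ × ℝ) : ℝ :=
  ∑ k ∈ Finset.range n, B k x.1 * x.2 ^ k + x.2 ^ n * h (x.1 ^ q, x.1 ^ p * x.2)

/-- For large |z| the term z^n times a unit dominates the lower powers. No upper bound on z is
imposed, only smallness of τ^p z, so the estimate reaches from |z| = R to the edge of a fixed box in
the original variables. -/
lemma exists_le_abs_blowUp {n p q : ℕ} (hn : n ≠ 0) (hq : q ≠ 0)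
    {B : ℕ → ℝ → ℝ} {h : ℝ × ℝ → ℝ} (hB : ∀ k < n, ContinuousAt (B k) 0)
    (hh : ContinuousAt h (0, 0)) (hh0 : h (0, 0) ≠ 0) :
    ∃ δ > 0, ∃ c > 0, ∃ R > 0, ∀ τ z, 0 < τ → τ < δ → |τ ^ p * z| < δ → R ≤ |z| →
      c * |z| ^ n ≤ |blowUp n p q B h (τ, z)| := by
  have hpos : 0 < |h (0, 0)| := abs_pos.2 hh0
  obtain ⟨M, hM0, hM⟩ : ∃ M : ℝ, 0 ≤ M ∧ ∀ k ∈ Finset.range n, |B k 0| < M := by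
    refine ⟨∑ k ∈ Finset.range n, |B k 0| + 1, by positivity, fun k hk => ?_⟩
    have := Finset.single_le_sum (f := fun k => |B k 0|) (fun i _ => abs_nonneg _) hk
    linarith
  have e1 : ∀ᶠ τ in 𝓝 (0 : ℝ), ∀ k ∈ Finset.range n, |B k τ| < M :=
    (Filter.eventually_all_finset _).2 fun k hk =>
      (hB k (Finset.mem_range.1 hk)).abs.eventually_lt_const (hM k hk)
  obtain ⟨r₁, hr₁, H₁⟩ := Metric.eventually_nhds_iff.1 e1
  obtain ⟨r₂, hr₂, H₂⟩ := Metric.eventually_nhds_iff.1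
    (hh.abs.eventually_const_lt (show |h (0, 0)| / 2 < |h (0, 0)| by linarith))
  -- With |z| ≥ 4 n M / |h(0,0)| the n lower terms are at most a quarter of |h(0,0)| |z|^n, while
  -- the leading one is at least half of it.
  refine ⟨min 1 (min r₁ r₂), by positivity, |h (0, 0)| / 4, by positivity,
    max 1 (4 * (n * M) / |h (0, 0)|), by positivity, fun τ z h0 h1 h2 h3 => ?_⟩
  have hτ1 : τ < 1 := h1.trans_le (min_le_left _ _)
  have hτ2 : τ < r₁ := h1.trans_le ((min_le_right _ _).trans (min_le_left _ _))
  have hτ3 : τ < r₂ := h1.trans_le ((min_le_right _ _).trans (min_le_right _ _))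
  have hz2 : |τ ^ p * z| < r₂ := h2.trans_le ((min_le_right _ _).trans (min_le_right _ _))
  have hz1 : 1 ≤ |z| := (le_max_left _ _).trans h3
  have hz3 : n * M ≤ |h (0, 0)| / 4 * |z| := by
    have := (le_max_right _ _).trans h3
    rw [div_le_iff₀ hpos] at this
    linarith
  have hb : |h (0, 0)| / 2 ≤ |h (τ ^ q, τ ^ p * z)| := by
    refine (H₂ ?_).le
    rw [Prod.dist_eq, Real.dist_eq, Real.dist_eq, sub_zero, sub_zero, abs_of_pos (pow_pos h0 q)]
    exact max_lt ((pow_le_of_le_one h0.le hτ1.le hq).trans_lt hτ3) hz2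
  have ha : |∑ k ∈ Finset.range n, B k τ * z ^ k| ≤ |h (0, 0)| / 4 * |z| ^ n := by
    calc |∑ k ∈ Finset.range n, B k τ * z ^ k|
        ≤ ∑ k ∈ Finset.range n, |B k τ * z ^ k| := Finset.abs_sum_le_sum_abs _ _
      _ ≤ ∑ k ∈ Finset.range n, M * |z| ^ (n - 1) := by
          refine Finset.sum_le_sum fun k hk => ?_
          rw [abs_mul, abs_pow]
          have hk' := Finset.mem_range.1 hk
          have := H₁ (show dist τ 0 < r₁ by rwa [Real.dist_eq, sub_zero, abs_of_pos h0]) k hk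
          gcongr
          omega
      _ = n * M * |z| ^ (n - 1) := by simp [mul_assoc]
      _ ≤ |h (0, 0)| / 4 * |z| * |z| ^ (n - 1) := by gcongr
      _ = |h (0, 0)| / 4 * |z| ^ n := by
          rw [mul_assoc, ← pow_succ', Nat.sub_add_cancel (Nat.one_le_iff_ne_zero.2 hn)]
  have hc : |h (0, 0)| / 2 * |z| ^ n ≤ |z ^ n * h (τ ^ q, τ ^ p * z)| := by
    rw [abs_mul, abs_pow, mul_comm]
    gcongr
  have := abs_sub_abs_le_abs_sub (z ^ n * h (τ ^ q, τ ^ p * z))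
    (-∑ k ∈ Finset.range n, B k τ * z ^ k)
  rw [abs_neg, sub_neg_eq_add, add_comm (z ^ n * _)] at this
  rw [blowUp]
  simp only
  linarith

/-- If the lower alternative holds at one point z, it descends. Otherwise the upper one holds at all
z and, by compactness, on |z| ≤ R, which is the region |y| ≤ R t^(p/q) below. Outside it |g| is at
least a multiple of |y|^n and the split exponent κ applies. Masses at two thresholds not yet
excluded are handled by thin strips in t or τ. -/
lemma dichotomy_of_blowUp {n p q : ℕ} (hn : n ≠ 0) (hp : p ≠ 0) (hq : q ≠ 0) (hs : 0 ≤ s)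
    {B : ℕ → ℝ → ℝ} {h : ℝ × ℝ → ℝ} (hB : ∀ k < n, ContinuousAt (B k) 0)
    (hh : ContinuousAt h (0, 0)) (hh0 : h (0, 0) ≠ 0) (hgc : ContinuousAt g (0, 0))
    (hg : ∃ δ₀ > 0, ∀ τ z, 0 < τ → τ < δ₀ → |τ ^ p * z| < δ₀ →
      g (τ ^ q, τ ^ p * z) = τ ^ (p * n) * blowUp n p q B h (τ, z))
    (hG : ∀ z, LowerAt (blowUp n p q B h) (q * β + p * n) (q * γ + (q - 1) + p) s z ∨
      UpperAt (blowUp n p q B h) (q * β + p * n) (q * γ + (q - 1) + p) s z) :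
    LowerAt g β γ s 0 ∨ UpperAt g β γ s 0 := by
  have hp' : (0 : ℝ) < p := by exact_mod_cast Nat.pos_of_ne_zero hp
  have hq' : (0 : ℝ) < q := by exact_mod_cast Nat.pos_of_ne_zero hq
  obtain ⟨δ₀, hδ₀, hg⟩ := hg
  have hlow : ∀ z, LowerAt (blowUp n p q B h) (q * β + p * n) (q * γ + (q - 1) + p) s z →
      LowerAt g β γ s 0 := by
    intro z hz
    refine hz.of_blowMap (ψ := fun _ => 0) hq fun δ hδ => ?_
    have hm : 0 < min δ (min δ₀ 1) := lt_min hδ (lt_min hδ₀ one_pos)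
    -- Dividing by |z| + 2 keeps |τ^p z'| within the required bound for all z' near z.
    refine ⟨min δ (min δ₀ 1) / (|z| + 2), by positivity, fun x hx => ?_⟩
    rw [mem_halfBox] at hx
    obtain ⟨h1, h2, h3⟩ := hx
    have h6 : min δ (min δ₀ 1) / (|z| + 2) ≤ min δ (min δ₀ 1) :=
      div_le_self hm.le (by linarith [abs_nonneg z])
    have h5 : min δ (min δ₀ 1) ≤ 1 := (min_le_right _ _).trans (min_le_right _ _)
    have h7 : x.1 < 1 := h2.trans_le (h6.trans h5)
    have h8 : |x.2| < |z| + 1 := by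
      have : |x.2| ≤ |x.2 - z| + |z| := by
        calc |x.2| = |(x.2 - z) + z| := by ring_nf
          _ ≤ _ := abs_add_le _ _
      linarith [h3.trans_le (h6.trans h5)]
    have h9 : |x.1 ^ p * x.2| < min δ (min δ₀ 1) := by
      rw [abs_mul, abs_of_pos (pow_pos h1 p)]
      calc x.1 ^ p * |x.2| ≤ x.1 * |x.2| := by
            gcongr; exact pow_le_of_le_one h1.le h7.le hp
        _ ≤ x.1 * (|z| + 2) := by gcongr; linarith
        _ < min δ (min δ₀ 1) := by rwa [← lt_div_iff₀ (by positivity)]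
    have h10 : x.1 < min δ (min δ₀ 1) := h2.trans_le h6
    refine ⟨?_, differentiableAt_const _, ?_⟩
    · rw [mem_halfBox]
      simp only [blowMap, add_zero, sub_zero]
      exact ⟨pow_pos h1 q, (pow_le_of_le_one h1.le h7.le hq).trans_lt
        (h10.trans_le (min_le_left _ _)), h9.trans_le (min_le_left _ _)⟩
    · simp only [blowMap, add_zero]
      exact hg x.1 x.2 h1 (h10.trans_le ((min_le_right _ _).trans (min_le_left _ _)))
        (h9.trans_le ((min_le_right _ _).trans (min_le_left _ _)))
  by_cases hex : ∃ z, LowerAt (blowUp n p q B h) (q * β + p * n) (q * γ + (q - 1) + p) s z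
  · obtain ⟨z, hz⟩ := hex
    exact Or.inl (hlow z hz)
  push Not at hex
  by_cases h1 : (γ : ℝ) + 1 ≤ s * β
  · exact Or.inl (LowerAt.of_continuousAt hgc hs h1)
  -- In this case a thin strip at τ = 0 gives the lower alternative at z = 0, by continuity of the
  -- blown-up function alone.
  by_cases h2 : ((q * γ + (q - 1) + p : ℕ) : ℝ) + 1 ≤ s * ((q * β + p * n : ℕ) : ℝ)
  · refine Or.inl (hlow 0 (LowerAt.of_continuousAt ?_ hs h2))
    refine ContinuousAt.add (tendsto_finsetSum _ fun k hk => ?_) ?_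
    · have h3 : ContinuousAt (fun x : ℝ × ℝ => B k x.1) (0, 0) :=
        ContinuousAt.comp (f := Prod.fst) (hB k (Finset.mem_range.1 hk)) continuousAt_fst
      exact h3.mul (continuousAt_snd.pow k)
    · refine (continuousAt_snd.pow n).mul ?_
      have h3 : ContinuousAt (fun x : ℝ × ℝ => (x.1 ^ q, x.1 ^ p * x.2)) (0, 0) := by fun_prop
      have h4 : ContinuousAt h ((fun x : ℝ × ℝ => (x.1 ^ q, x.1 ^ p * x.2)) (0, 0)) := by
        simpa [zero_pow hq] using hh
      exact ContinuousAt.comp h4 h3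
  right
  obtain ⟨κ, hκ0, hκ1, hκ2⟩ := exists_split_exponent hp hq hs (not_le.1 h1) (not_le.1 h2)
  obtain ⟨δ₁, hδ₁, c, hc, R, hR, Hout⟩ := exists_le_abs_blowUp (p := p) hn hq hB hh hh0
  obtain ⟨δ₂, hδ₂, Hin⟩ := exists_powerUpper_strip (fun z => (hG z).resolve_left (hex z)) R
  set δ : ℝ := min 1 (min δ₀ (min δ₁ δ₂)) / (R + 1) with hδ
  have hm : 0 < min 1 (min δ₀ (min δ₁ δ₂)) := lt_min one_pos (lt_min hδ₀ (lt_min hδ₁ hδ₂))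
  have hδ0 : 0 < δ := by positivity
  have hδm : δ ≤ min 1 (min δ₀ (min δ₁ δ₂)) := div_le_self hm.le (by linarith)
  have hδa : δ ≤ 1 := hδm.trans (min_le_left _ _)
  have hδb : δ ≤ δ₀ := hδm.trans ((min_le_right _ _).trans (min_le_left _ _))
  have hδc : δ ≤ δ₁ :=
    hδm.trans ((min_le_right _ _).trans ((min_le_right _ _).trans (min_le_left _ _)))
  have hδd : δ ≤ δ₂ :=
    hδm.trans ((min_le_right _ _).trans ((min_le_right _ _).trans (min_le_right _ _)))
  have hδR : R * δ < δ₀ := by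
    have : (R + 1) * δ = min 1 (min δ₀ (min δ₁ δ₂)) := by rw [hδ]; field_simp
    have h3 : min 1 (min δ₀ (min δ₁ δ₂)) ≤ δ₀ := (min_le_right _ _).trans (min_le_left _ _)
    linarith
  -- the inner region, near the axis `y = 0`
  have key1 : PowerUpper g β γ s (blowMap p q (fun _ => 0) '' (Ioo 0 δ ×ˢ Icc (-R) R)) := by
    refine PowerUpper.image_blowMap hq (measurableSet_Ioo.prod measurableSet_Icc)
      (fun x hx => hx.1.1) (fun x _ => differentiableAt_const _) (m := p * n)
      (G := blowUp n p q B h) (fun x hx => ?_)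
      (Hin.mono (prod_mono (Ioo_subset_Ioo_right hδd) Subset.rfl))
    simp only [blowMap, add_zero]
    refine hg x.1 x.2 hx.1.1 (hx.1.2.trans_le hδb) ?_
    rw [abs_mul, abs_of_pos (pow_pos hx.1.1 p)]
    calc x.1 ^ p * |x.2| ≤ x.1 * R := by
          gcongr
          · exact hx.1.1.le
          · exact pow_le_of_le_one hx.1.1.le (hx.1.2.le.trans hδa) hp
          · exact abs_le.2 hx.2
      _ ≤ R * δ := by rw [mul_comm]; gcongr; exact hx.1.2.le
      _ < δ₀ := hδR
  set A : Set (ℝ × ℝ) := {x | R * x.1 ^ (p / q : ℝ) < |x.2|} with hA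
  have hAm : MeasurableSet A := measurableSet_lt (by fun_prop) (by fun_prop)
  -- coordinates of a point in the blow-up
  have hroot : ∀ t : ℝ, 0 < t → (t ^ (1 / q : ℝ)) ^ q = t := fun t ht => by
    rw [← Real.rpow_natCast, ← Real.rpow_mul ht.le, one_div_mul_cancel hq'.ne', Real.rpow_one]
  have hrootp : ∀ t : ℝ, 0 < t → (t ^ (1 / q : ℝ)) ^ p = t ^ (p / q : ℝ) := fun t ht => by
    rw [← Real.rpow_natCast, ← Real.rpow_mul ht.le]; congr 1; ring
  have hrootδ : ∀ t : ℝ, 0 < t → t < δ ^ q → t ^ (1 / q : ℝ) < δ := fun t ht ht' => by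
    refine lt_of_pow_lt_pow_left₀ q hδ0.le ?_
    rwa [hroot t ht]
  have hδq : δ ^ q ≤ δ := pow_le_of_le_one hδ0.le hδa hq
  -- The outer region: |g| ≥ c |y|^n there, and |y|^κ ≥ R^κ t^(κ p/q) turns this into a monomial
  -- below both thresholds.
  have key2 : PowerUpper g β γ s (halfBox 0 (δ ^ q) ∩ A) := by
    refine powerUpper_of_monomial_le (c := c * R ^ κ) (b := β + κ * (p / q)) (m := n - κ)
      ((measurableSet_halfBox _ _).inter hAm) (pow_pos hδ0 q) inter_subset_left (by positivity) hs
      hκ1 hκ2 fun x hx => ?_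
    obtain ⟨hx1, hxA⟩ := hx
    rw [mem_halfBox, sub_zero] at hx1
    obtain ⟨h3, h4, h5⟩ := hx1
    set τ := x.1 ^ (1 / q : ℝ) with hτ
    have hτ0 : 0 < τ := by positivity
    have hτδ := hrootδ x.1 h3 h4
    have hτp : 0 < τ ^ p := pow_pos hτ0 p
    have hzy : τ ^ p * (x.2 / τ ^ p) = x.2 := by field_simp
    have hRz : R ≤ |x.2 / τ ^ p| := by
      rw [abs_div, abs_of_pos hτp, le_div_iff₀ hτp, hrootp x.1 h3]
      exact (show R * x.1 ^ (p / q : ℝ) < |x.2| from hxA).le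
    have hgx := hg τ (x.2 / τ ^ p) hτ0 (hτδ.trans_le hδb)
      (by rw [hzy]; exact h5.trans_le (hδq.trans hδb))
    have hbd := Hout τ (x.2 / τ ^ p) hτ0 (hτδ.trans_le hδc)
      (by rw [hzy]; exact h5.trans_le (hδq.trans hδc)) hRz
    rw [hzy, hroot x.1 h3] at hgx
    have hy0 : 0 < |x.2| := lt_of_le_of_lt (by positivity) (show R * x.1 ^ (p / q : ℝ) < |x.2| from hxA)
    have hgn : c * |x.2| ^ n ≤ |g x| := by
      rw [show g x = g (x.1, x.2) from rfl, hgx, abs_mul, abs_of_pos (pow_pos hτ0 _)]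
      calc c * |x.2| ^ n = τ ^ (p * n) * (c * |x.2 / τ ^ p| ^ n) := by
            rw [abs_div, abs_of_pos hτp, div_pow, ← pow_mul]; field_simp
        _ ≤ _ := by gcongr
    have hκb : (R * x.1 ^ (p / q : ℝ)) ^ κ ≤ |x.2| ^ κ :=
      Real.rpow_le_rpow (by positivity) (show R * x.1 ^ (p / q : ℝ) < |x.2| from hxA).le hκ0
    rw [Real.mul_rpow hR.le (by positivity), ← Real.rpow_mul h3.le] at hκb
    calc c * R ^ κ * (x.1 ^ ((β : ℝ) + κ * (p / q)) * |x.2| ^ ((n : ℝ) - κ))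
        = c * x.1 ^ β * |x.2| ^ ((n : ℝ) - κ) * (R ^ κ * x.1 ^ ((p / q : ℝ) * κ)) := by
          rw [Real.rpow_add h3, Real.rpow_natCast, mul_comm κ]; ring
      _ ≤ c * x.1 ^ β * |x.2| ^ ((n : ℝ) - κ) * |x.2| ^ κ := by gcongr
      _ = x.1 ^ β * (c * |x.2| ^ n) := by
          rw [mul_assoc _ _ (|x.2| ^ κ), ← Real.rpow_add hy0, sub_add_cancel, Real.rpow_natCast]
          ring
      _ ≤ x.1 ^ β * |g x| := by gcongr
  refine ⟨δ ^ q, pow_pos hδ0 q, (key1.union key2).mono fun x hx => ?_⟩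
  by_cases hxA : x ∈ A
  · exact Or.inr ⟨hx, hxA⟩
  · left
    rw [mem_halfBox, sub_zero] at hx
    obtain ⟨h3, h4, h5⟩ := hx
    have hτ0 : 0 < x.1 ^ (1 / q : ℝ) := by positivity
    refine ⟨(x.1 ^ (1 / q : ℝ), x.2 / x.1 ^ (p / q : ℝ)), ⟨⟨hτ0, hrootδ x.1 h3 h4⟩, ?_⟩, ?_⟩
    · rw [mem_Icc, ← abs_le]
      have : |x.2| ≤ R * x.1 ^ (p / q : ℝ) := not_lt.1 hxA
      rw [abs_div, abs_of_pos (by positivity : 0 < x.1 ^ (p / q : ℝ))]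
      rwa [div_le_iff₀ (by positivity)]
    · simp only [blowMap, add_zero]
      rw [hroot x.1 h3, hrootp x.1 h3]
      refine Prod.ext rfl ?_
      simp only
      field_simp

end BlowUp

/-! ### The analytic dichotomy by induction on the order -/

section AnalyticDichotomy

/-- The ratio p/q is the minimum of o_k/(n - k), with o_k the order of vanishing of a_k: the slope
of the Newton edge ending at y^n. Some coefficient therefore survives at τ = 0 after the blow-up.
All o_k are positive because a_k(0) = 0, whence p ≠ 0; p and q need not be coprime. -/
lemma exists_weights {n : ℕ} {a : ℕ → ℝ → ℝ} (ha : ∀ k < n, AnalyticAt ℝ (a k) 0 ∧ a k 0 = 0)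
    (hlast : ∀ᶠ t in 𝓝 0, a (n - 1) t = 0) (hne : ∃ k < n, ¬ ∀ᶠ t in 𝓝 0, a k t = 0) :
    ∃ p q : ℕ, p ≠ 0 ∧ q ≠ 0 ∧ ∃ B : ℕ → ℝ → ℝ,
      (∀ k < n, AnalyticAt ℝ (B k) 0 ∧ ∀ᶠ τ in 𝓝 0, a k (τ ^ q) = τ ^ (p * (n - k)) * B k τ) ∧
      B (n - 1) 0 = 0 ∧ ∃ k < n, B k 0 ≠ 0 := by
  classical
  set K := (Finset.range n).filter fun k => ¬ ∀ᶠ t in 𝓝 0, a k t = 0 with hK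
  have hKn : K.Nonempty := by
    obtain ⟨k, hk, hk'⟩ := hne
    exact ⟨k, Finset.mem_filter.2 ⟨Finset.mem_range.2 hk, hk'⟩⟩
  have hfac : ∀ k, ∃ (o : ℕ) (b : ℝ → ℝ), k ∈ K → AnalyticAt ℝ b 0 ∧ b 0 ≠ 0 ∧ o ≠ 0 ∧
      ∀ᶠ t in 𝓝 0, a k t = t ^ o * b t := by
    intro k
    by_cases hk : k ∈ K
    · obtain ⟨hk1, hk2⟩ := Finset.mem_filter.1 hk
      obtain ⟨ha1, ha0⟩ := ha k (Finset.mem_range.1 hk1)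
      have := ha1.analyticOrderAt_ne_top.1 (by rwa [Ne, analyticOrderAt_eq_top])
      obtain ⟨b, hb, hb0, hab⟩ := this
      have hab' : ∀ᶠ t in 𝓝 (0 : ℝ), a k t = t ^ analyticOrderNatAt (a k) 0 * b t := by
        simpa [Filter.EventuallyEq] using hab
      refine ⟨analyticOrderNatAt (a k) 0, b, fun _ => ⟨hb, hb0, fun h0 => ?_, hab'⟩⟩
      have := hab'.self_of_nhds
      rw [h0, pow_zero, one_mul, ha0] at this
      exact hb0 this.symm
    · exact ⟨0, 0, fun h => absurd h hk⟩
  choose o b hob using hfac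
  obtain ⟨k₀, hk₀, hmin⟩ := K.exists_min_image (fun k => (o k : ℝ) / ((n : ℝ) - k)) hKn
  have hlt : ∀ k ∈ K, k < n := fun k hk => Finset.mem_range.1 (Finset.mem_filter.1 hk).1
  have hq : n - k₀ ≠ 0 := by have := hlt k₀ hk₀; omega
  have hle : ∀ k ∈ K, o k₀ * (n - k) ≤ (n - k₀) * o k := by
    intro k hk
    have h1 := hmin k hk
    have h2 := hlt k hk
    have h3 := hlt k₀ hk₀
    have h2' : (0 : ℝ) < (n : ℝ) - k := by rw [sub_pos]; exact_mod_cast h2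
    have h3' : (0 : ℝ) < (n : ℝ) - k₀ := by rw [sub_pos]; exact_mod_cast h3
    rw [div_le_div_iff₀ h3' h2'] at h1
    rw [← Nat.cast_le (α := ℝ)]
    push_cast [Nat.cast_sub h2.le, Nat.cast_sub h3.le]
    linarith
  -- After t = τ^q the order of a_k is q o_k ≥ p (n - k), with equality for k₀. The excess is the
  -- power of τ left in B_k.
  refine ⟨o k₀, n - k₀, (hob k₀ hk₀).2.2.1, hq, fun k τ => if k ∈ K then
    τ ^ ((n - k₀) * o k - o k₀ * (n - k)) * b k (τ ^ (n - k₀)) else 0, ?_, ?_, k₀, hlt k₀ hk₀, ?_⟩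
  · intro k hk
    have htend : Tendsto (fun τ : ℝ => τ ^ (n - k₀)) (𝓝 0) (𝓝 0) := by
      have : Continuous fun τ : ℝ => τ ^ (n - k₀) := by fun_prop
      simpa [zero_pow hq] using this.tendsto 0
    by_cases hkK : k ∈ K
    · simp only [if_pos hkK]
      obtain ⟨h1, h2, h3, h4⟩ := hob k hkK
      constructor
      · refine (analyticAt_id.pow _).mul ?_
        exact h1.comp_of_eq (f := fun τ : ℝ => τ ^ (n - k₀)) (analyticAt_id.pow _) (zero_pow hq)
      · filter_upwards [htend.eventually h4] with τ hτ
        rw [hτ, ← mul_assoc, ← pow_add, Nat.add_sub_cancel' (hle k hkK), pow_mul]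
    · simp only [if_neg hkK]
      refine ⟨analyticAt_const, ?_⟩
      have : ∀ᶠ t in 𝓝 0, a k t = 0 := by
        by_contra h
        exact hkK (Finset.mem_filter.2 ⟨Finset.mem_range.2 hk, h⟩)
      filter_upwards [htend.eventually this] with τ hτ
      rw [hτ, mul_zero]
  · have : n - 1 ∉ K := fun h => (Finset.mem_filter.1 h).2 hlast
    simp only [if_neg this]
  · simp only [if_pos hk₀]
    rw [mul_comm (o k₀), Nat.sub_self, pow_zero, one_mul, zero_pow hq]
    exact (hob k₀ hk₀).2.1

lemma iteratedDeriv_polynomial_eval (P : Polynomial ℝ) (k : ℕ) :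
    iteratedDeriv k (fun z => P.eval z) = fun z => (Polynomial.derivative^[k] P).eval z := by
  induction k with
  | zero => simp
  | succ k ih =>
    rw [iteratedDeriv_succ, ih, Function.iterate_succ_apply']
    ext z
    exact Polynomial.deriv _

/-- A polynomial of degree `n` without term of degree `n - 1` that is not a monomial has no root of
multiplicity `n`. -/
lemma exists_iteratedDeriv_ne_zero {n : ℕ} {c : ℕ → ℝ} {d : ℝ} (hd : d ≠ 0)
    (hlast : c (n - 1) = 0) (hne : ∃ k < n, c k ≠ 0) (z₀ : ℝ) :
    ∃ k < n, iteratedDeriv k (fun z => ∑ k ∈ Finset.range n, c k * z ^ k + z ^ n * d) z₀ ≠ 0 := by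
  by_contra! hcon
  obtain ⟨k₁, hk₁, hck₁⟩ := hne
  set P : Polynomial ℝ := ∑ k ∈ Finset.range n, Polynomial.monomial k (c k) +
    Polynomial.monomial n d with hP
  have hev : (fun z => ∑ k ∈ Finset.range n, c k * z ^ k + z ^ n * d) = fun z => P.eval z := by
    ext z
    simp [hP, Polynomial.eval_finsetSum, Polynomial.eval_monomial, mul_comm]
  rw [hev] at hcon
  have hcoeff : ∀ k < n, P.coeff k = c k := by
    intro k hk
    simp [hP, Polynomial.coeff_monomial, hk, hk.ne']
  have hcoeffn : P.coeff n = d := by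
    simp [hP, Polynomial.coeff_monomial]
  have hdeg : P.natDegree ≤ n := by
    refine Polynomial.natDegree_add_le_of_degree_le (Polynomial.natDegree_sum_le_of_forall_le _ _
      fun k hk => ?_) (Polynomial.natDegree_monomial_le _)
    exact (Polynomial.natDegree_monomial_le _).trans (Finset.mem_range.1 hk).le
  -- If all derivatives below order n vanish at z₀, then P is a multiple of (X - z₀)^n. Its
  -- coefficient of degree n - 1 vanishes only for z₀ = 0, and then P is a monomial.
  have hT : Polynomial.taylor z₀ P =
      Polynomial.C ((Polynomial.taylor z₀ P).coeff n) * Polynomial.X ^ n := by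
    ext k
    rw [Polynomial.coeff_C_mul_X_pow]
    rcases lt_trichotomy k n with hk | hk | hk
    · rw [if_neg hk.ne, Polynomial.taylor_coeff]
      have h1 := hcon k hk
      rw [iteratedDeriv_polynomial_eval] at h1
      simp only at h1
      have h2 := congrArg (Polynomial.eval z₀) (congrFun
        (Polynomial.factorial_smul_hasseDeriv (R := ℝ) k) P)
      simp only [LinearMap.smul_apply] at h2
      rw [← h2, Polynomial.eval_smul] at h1
      have h3 : (k.factorial : ℝ) ≠ 0 := by positivity
      simpa [h3] using h1
    · rw [if_pos hk, hk]
    · rw [if_neg hk.ne']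
      refine Polynomial.coeff_eq_zero_of_natDegree_lt ?_
      rw [Polynomial.natDegree_taylor]; omega
  set t := (Polynomial.taylor z₀ P).coeff n
  have hPt : P = Polynomial.C t * (Polynomial.X + Polynomial.C (-z₀)) ^ n := by
    have h1 : Polynomial.taylor (-z₀) (Polynomial.taylor z₀ P) = P := by
      rw [Polynomial.taylor_taylor]; simp
    rw [← h1, hT]
    simp [Polynomial.taylor_mul, Polynomial.taylor_pow]
  have hc : ∀ k, P.coeff k = t * ((-z₀) ^ (n - k) * (n.choose k : ℝ)) := by
    intro k
    rw [hPt, Polynomial.coeff_C_mul, Polynomial.coeff_X_add_C_pow]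
  have ht : t ≠ 0 := by
    have := hc n
    rw [hcoeffn] at this
    simp at this
    rwa [← this]
  have hz : z₀ = 0 := by
    have h1 := hc (n - 1)
    rw [hcoeff (n - 1) (by omega), hlast] at h1
    have h2 : n - (n - 1) = 1 := by omega
    have h3 : (n.choose (n - 1) : ℝ) ≠ 0 := by
      exact_mod_cast (Nat.choose_pos (by omega)).ne'
    rw [h2, pow_one] at h1
    have := mul_eq_zero.1 h1.symm
    simpa [ht, h3] using this
  have := hc k₁
  rw [hcoeff k₁ hk₁, hz, neg_zero, zero_pow (by omega), zero_mul, mul_zero] at this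
  exact hck₁ this

/-- For fixed t the shear is a translation in y, so it commutes with differentiation in y. -/
lemma sndDeriv_iterate_shear {g : ℝ × ℝ → ℝ} {ψ : ℝ → ℝ} {y₀ : ℝ} (hg : AnalyticAt ℝ g (0, y₀))
    (hψ : AnalyticAt ℝ ψ 0) (h0 : ψ 0 = y₀) (k : ℕ) :
    sndDeriv^[k] (fun x => g (x.1, x.2 + ψ x.1)) =ᶠ[𝓝 (0, 0)]
      fun x => sndDeriv^[k] g (x.1, x.2 + ψ x.1) := by
  have hcont : Tendsto (fun x : ℝ × ℝ => (x.1, x.2 + ψ x.1)) (𝓝 (0, 0)) (𝓝 (0, y₀)) := by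
    have h1 : ContinuousAt (fun x : ℝ × ℝ => ψ x.1) (0, 0) :=
      ContinuousAt.comp (f := Prod.fst) hψ.continuousAt continuousAt_fst
    have h2 : ContinuousAt (fun x : ℝ × ℝ => (x.1, x.2 + ψ x.1)) (0, 0) :=
      continuousAt_fst.prodMk (continuousAt_snd.add h1)
    have := h2.tendsto
    simpa [h0] using this
  induction k with
  | zero => simp
  | succ k ih =>
    simp only [Function.iterate_succ_apply']
    refine ih.sndDeriv.trans ?_
    filter_upwards [hcont.eventually (hg.sndDeriv_iterate k).eventually_analyticAt,
      (continuousAt_fst (p := ((0 : ℝ), (0 : ℝ)))).eventually hψ.eventually_analyticAt] with x hx hx'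
    have hd : DifferentiableAt ℝ (fun x : ℝ × ℝ => (x.1, x.2 + ψ x.1)) x :=
      differentiableAt_fst.prodMk (differentiableAt_snd.add
        (DifferentiableAt.comp (f := Prod.fst) x hx'.differentiableAt differentiableAt_fst))
    have hd' : DifferentiableAt ℝ (fun x : ℝ × ℝ => sndDeriv^[k] g (x.1, x.2 + ψ x.1)) (x.1, x.2) :=
      DifferentiableAt.comp x (f := fun x : ℝ × ℝ => (x.1, x.2 + ψ x.1)) hx.differentiableAt hd
    have e1 := hasDerivAt_slice hd'
    have e2 := (hasDerivAt_slice hx.differentiableAt).comp_add_const x.2 (ψ x.1)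
    exact e1.unique e2

/-- Near a point on the axis `t = 0`, the weighted sublevel masses of an analytic function that is
not flat in the second variable either decay at most like a given power, or faster than it by a
power. -/
theorem analytic_dichotomy {s : ℝ} (hs : 0 ≤ s) (n : ℕ) {g : ℝ × ℝ → ℝ} {y₀ : ℝ} (β γ : ℕ)
    (hg : AnalyticAt ℝ g (0, y₀)) (hn : sndDeriv^[n] g (0, y₀) ≠ 0) :
    LowerAt g β γ s y₀ ∨ UpperAt g β γ s y₀ := by
  induction n using Nat.strong_induction_on generalizing g y₀ β γ with
  | _ n ih =>
  by_cases hlow : ∃ k < n, sndDeriv^[k] g (0, y₀) ≠ 0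
  · obtain ⟨k, hk, hk'⟩ := hlow
    exact ih k hk β γ hg hk'
  push Not at hlow
  -- A Tschirnhaus shift: ψ parametrises the zeros of the derivative of order n - 1, which has
  -- nonvanishing y-derivative. Shearing by ψ kills the coefficient of y^(n-1).
  obtain ⟨ψ, hψ, hψ0, hψn⟩ : ∃ ψ : ℝ → ℝ, AnalyticAt ℝ ψ 0 ∧ ψ 0 = y₀ ∧
      (n ≠ 0 → ∀ᶠ t in 𝓝 (0 : ℝ), sndDeriv^[n - 1] g (t, ψ t) = 0) := by
    rcases Nat.eq_zero_or_pos n with h | h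
    · exact ⟨fun _ => y₀, analyticAt_const, rfl, fun h' => absurd h h'⟩
    · have h1 : sndDeriv (sndDeriv^[n - 1] g) (0, y₀) ≠ 0 := by
        rw [← Function.iterate_succ_apply' sndDeriv]
        rwa [Nat.succ_eq_add_one, Nat.sub_add_cancel h]
      obtain ⟨ψ, hψ, hψ0, H⟩ := ContDiffAt.exists_implicit (n := ω) (by simp)
        (hg.sndDeriv_iterate (n - 1)).contDiffAt (hlow (n - 1) (by omega)) h1
      refine ⟨ψ, hψ.analyticAt, hψ0, fun _ => ?_⟩
      have hcont : Tendsto (fun t : ℝ => (t, ψ t)) (𝓝 0) (𝓝 (0, y₀)) := by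
        have := (continuousAt_id (x := (0 : ℝ))).prodMk hψ.continuousAt
        have := this.tendsto
        rwa [id, hψ0] at this
      exact (hcont.eventually H).mono fun t ht => ht.2 rfl
  refine dichotomy_of_shear hψ.contDiffAt hψ0 ?_
  set g₁ : ℝ × ℝ → ℝ := fun x => g (x.1, x.2 + ψ x.1) with hg₁
  have hg₁a : AnalyticAt ℝ g₁ (0, 0) := by
    have h1 : AnalyticAt ℝ (fun x : ℝ × ℝ => ψ x.1) (0, 0) :=
      AnalyticAt.comp (f := Prod.fst) (x := ((0 : ℝ), (0 : ℝ))) hψ analyticAt_fst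
    have h2 : AnalyticAt ℝ (fun x : ℝ × ℝ => (x.1, x.2 + ψ x.1)) (0, 0) :=
      analyticAt_fst.prod (analyticAt_snd.add h1)
    exact hg.comp_of_eq h2 (by simp [hψ0])
  have hD := sndDeriv_iterate_shear hg hψ hψ0
  have hD0 : ∀ k, sndDeriv^[k] g₁ (0, 0) = sndDeriv^[k] g (0, y₀) := fun k => by
    have := (hD k).self_of_nhds
    simpa [hψ0] using this
  obtain ⟨h, hha, hh0, hexp⟩ := hg₁a.exists_taylor_snd n
  have hh0' : h (0, 0) ≠ 0 := by
    rw [hh0, hD0]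
    exact div_ne_zero hn (by positivity)
  set a : ℕ → ℝ → ℝ := fun k t => sndDeriv^[k] g₁ (t, 0) / k.factorial with ha
  have haa : ∀ k, AnalyticAt ℝ (a k) 0 := fun k => by
    refine AnalyticAt.div ?_ analyticAt_const (by positivity)
    exact AnalyticAt.comp (f := fun t : ℝ => (t, (0 : ℝ))) (hg₁a.sndDeriv_iterate k)
      (analyticAt_id.prod analyticAt_const)
  have ha0 : ∀ k < n, a k 0 = 0 := fun k hk => by
    simp only [ha, hD0, hlow k hk, zero_div]
  by_cases hall : ∀ k < n, ∀ᶠ t in 𝓝 0, a k t = 0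
  · refine dichotomy_of_pow_mul_unit hha.continuousAt hh0' hs (n := n) ?_
    have h1 : ∀ᶠ t in 𝓝 (0 : ℝ), ∀ k ∈ Finset.range n, a k t = 0 :=
      (Filter.eventually_all_finset _).2 fun k hk => hall k (Finset.mem_range.1 hk)
    filter_upwards [hexp, (continuousAt_fst (p := ((0 : ℝ), (0 : ℝ)))).eventually h1] with x hx hx'
    rw [hx, Finset.sum_eq_zero, zero_add]
    intro k hk
    have := hx' k hk
    simp only [ha] at this
    rw [this, zero_mul]
  replace hall : ∃ k < n, ¬ ∀ᶠ t in 𝓝 0, a k t = 0 := by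
    by_contra h
    exact hall fun k hk => by_contra fun h' => h ⟨k, hk, h'⟩
  have hn0 : n ≠ 0 := by
    obtain ⟨k, hk, _⟩ := hall
    omega
  have hlast : ∀ᶠ t in 𝓝 0, a (n - 1) t = 0 := by
    have h1 : Tendsto (fun t : ℝ => (t, (0 : ℝ))) (𝓝 0) (𝓝 (0, 0)) := by
      have : Continuous fun t : ℝ => (t, (0 : ℝ)) := by fun_prop
      exact this.tendsto 0
    filter_upwards [h1.eventually (hD (n - 1)), hψn hn0] with t ht ht'
    simp only [ha]
    rw [ht]
    simp [ht']
  obtain ⟨p, q, hp, hq, B, hB, hBlast, hBne⟩ := exists_weights (fun k hk => ⟨haa k, ha0 k hk⟩)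
    hlast hall
  refine dichotomy_of_blowUp hn0 hp hq hs (fun k hk => (hB k hk).1.continuousAt) hha.continuousAt
    hh0' hg₁a.continuousAt ?_ ?_
  · obtain ⟨r₁, hr₁, H₁⟩ := Metric.eventually_nhds_iff.1 hexp
    obtain ⟨r₂, hr₂, H₂⟩ := Metric.eventually_nhds_iff.1
      ((Filter.eventually_all_finset (Finset.range n)).2 fun k hk => (hB k (Finset.mem_range.1 hk)).2)
    refine ⟨min 1 (min r₁ r₂), by positivity, fun τ z h0 h1 h2 => ?_⟩
    have hτ1 : τ < 1 := h1.trans_le (min_le_left _ _)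
    have hτ2 : τ < r₁ := h1.trans_le ((min_le_right _ _).trans (min_le_left _ _))
    have hτ3 : τ < r₂ := h1.trans_le ((min_le_right _ _).trans (min_le_right _ _))
    have hz2 : |τ ^ p * z| < r₁ := h2.trans_le ((min_le_right _ _).trans (min_le_left _ _))
    have e1 := H₁ (y := (τ ^ q, τ ^ p * z)) (by
      rw [Prod.dist_eq, Real.dist_eq, Real.dist_eq, sub_zero, sub_zero, abs_of_pos (pow_pos h0 q)]
      exact max_lt ((pow_le_of_le_one h0.le hτ1.le hq).trans_lt hτ2) hz2)
    have e2 := H₂ (y := τ) (by rwa [Real.dist_eq, sub_zero, abs_of_pos h0])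
    rw [e1, blowUp]
    simp only
    rw [mul_add, Finset.mul_sum]
    congr 1
    · refine Finset.sum_congr rfl fun k hk => ?_
      have e3 := e2 k hk
      simp only [ha] at e3
      rw [e3]
      have e4 : p * n = p * (n - k) + p * k := by
        rw [← mul_add, Nat.sub_add_cancel (Finset.mem_range.1 hk).le]
      rw [e4, pow_add, mul_pow, ← pow_mul]
      ring
    · rw [mul_pow, ← pow_mul]; ring
  · intro z₀
    have hGa : AnalyticAt ℝ (blowUp n p q B h) (0, z₀) := by
      refine AnalyticAt.add (Finset.analyticAt_fun_sum _ fun k hk => ?_) ?_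
      · exact (AnalyticAt.comp (f := Prod.fst) (x := ((0 : ℝ), z₀))
          (hB k (Finset.mem_range.1 hk)).1 analyticAt_fst).mul (analyticAt_snd.pow k)
      · refine (analyticAt_snd.pow n).mul ?_
        have h1 : AnalyticAt ℝ (fun x : ℝ × ℝ => (x.1 ^ q, x.1 ^ p * x.2)) (0, z₀) :=
          (analyticAt_fst.pow q).prod ((analyticAt_fst.pow p).mul analyticAt_snd)
        exact hha.comp_of_eq h1 (by simp [zero_pow hq, zero_pow hp])
    -- On τ = 0 the blown-up function is a polynomial of degree n without term of degree n - 1, and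
    -- not a monomial. Its order at every z₀ is thus below n, and the induction hypothesis applies.
    obtain ⟨k, hk, hk'⟩ := exists_iteratedDeriv_ne_zero (c := fun k => B k 0) hh0' hBlast hBne z₀
    refine ih k hk _ _ hGa ?_
    rw [← iteratedDeriv_slice (hGa.eventually_analyticAt.mono fun x hx => hx.contDiffAt)]
    convert hk' using 2
    ext z
    simp [blowUp, zero_pow hq, zero_pow hp]

end AnalyticDichotomy

/-! ### From the Newton polyhedron to large sublevel sets -/

section NewtonBox

lemma ContDiffAt.iteratedDeriv_infty {f : ℝ → ℝ} {x : ℝ} (hf : ContDiffAt ℝ ∞ f x) (k : ℕ) :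
    ContDiffAt ℝ ∞ (iteratedDeriv k f) x := by
  induction k with
  | zero => simpa using hf
  | succ k ih => rw [iteratedDeriv_succ]; exact ih.derivWithin (by simp)

/-- On boxes adapted to weights for which the Taylor support lies above the line
`κ₁ t₁ + κ₂ t₂ = 1`, a smooth function is as small as its homogeneous size. -/
lemma exists_abs_le_on_box {ψ : ℝ × ℝ → ℝ} {W : Set (ℝ × ℝ)} (hW : IsOpen W) (h0 : 0 ∈ W)
    (hψ : ContDiffOn ℝ ∞ ψ W) {κ₁ κ₂ : ℝ} (hκ₁ : 0 < κ₁) (hκ₂ : 0 < κ₂)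
    (hsupp : ∀ jk ∈ taylorSupport ψ, 1 ≤ κ₁ * jk.1 + κ₂ * jk.2) :
    ∃ C > 0, ∃ ε₀ > 0, ∀ ε, 0 < ε → ε < ε₀ → ∀ x : ℝ × ℝ, |x.1| ≤ ε ^ κ₁ → |x.2| ≤ ε ^ κ₂ →
      |ψ x| ≤ C * ε := by
  -- With this M, Taylor remainders of order M in either variable are O(ε) on the box. The function
  -- is expanded in the second variable, then each coefficient in the first; the finitely many
  -- monomials that remain are O(ε) by the support condition.
  obtain ⟨M, hM⟩ : ∃ M : ℕ, 1 ≤ κ₁ * M ∧ 1 ≤ κ₂ * M := by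
    obtain ⟨M, hM⟩ := exists_nat_ge (max (1 / κ₁) (1 / κ₂))
    refine ⟨M, ?_, ?_⟩
    · have := (le_max_left _ _).trans hM
      rw [div_le_iff₀ hκ₁] at this; linarith
    · have := (le_max_right _ _).trans hM
      rw [div_le_iff₀ hκ₂] at this; linarith
  obtain ⟨r, hr, hrW⟩ : ∃ r > 0, ∀ x : ℝ × ℝ, |x.1| ≤ r → |x.2| ≤ r → x ∈ W := by
    obtain ⟨r, hr, H⟩ := Metric.nhds_basis_closedBall.mem_iff.1 (hW.mem_nhds h0)
    refine ⟨r, hr, fun x h1 h2 => H ?_⟩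
    rw [Metric.mem_closedBall, dist_zero_right, Prod.norm_def]
    exact max_le h1 h2
  have hat : ∀ x ∈ W, ContDiffAt ℝ ∞ ψ x := fun x hx => hψ.contDiffAt (hW.mem_nhds hx)
  have hev : ∀ x ∈ W, ∀ᶠ y in 𝓝 x, ContDiffAt ℝ ∞ ψ y := fun x hx =>
    (hW.eventually_mem hx).mono hat
  have hslice : ∀ s t : ℝ, (s, t) ∈ W → ∀ k,
      iteratedDeriv k (fun t => ψ (s, t)) t = sndDeriv^[k] ψ (s, t) :=
    fun s t hst k => iteratedDeriv_slice (hev _ hst) k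
  set a : ℕ → ℝ → ℝ := fun k s => iteratedDeriv k (fun t => ψ (s, t)) 0 with ha
  have hac : ∀ k s, |s| ≤ r → ContDiffAt ℝ ∞ (a k) s := by
    intro k s hs
    have hsW : (s, (0 : ℝ)) ∈ W := hrW _ hs (by simpa using hr.le)
    have h1 : ContDiffAt ℝ ∞ (fun s : ℝ => sndDeriv^[k] ψ (s, 0)) s :=
      ContDiffAt.comp (f := fun s : ℝ => (s, (0 : ℝ))) s ((hat _ hsW).sndDeriv_iterate (by simp) k)
        (contDiffAt_id.prodMk contDiffAt_const)
    refine h1.congr_of_eventuallyEq ?_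
    have h2 : Continuous fun s : ℝ => (s, (0 : ℝ)) := by fun_prop
    filter_upwards [h2.continuousAt.eventually (hW.mem_nhds hsW)] with u hu
    exact hslice u 0 hu k
  -- uniform bounds
  obtain ⟨C₁, hC₁⟩ : ∃ C₁ : ℝ, ∀ s t : ℝ, |s| ≤ r → |t| ≤ r →
      |iteratedDeriv M (fun t => ψ (s, t)) t| ≤ C₁ := by
    have hK : IsCompact (Icc (-r) r ×ˢ Icc (-r) r) := isCompact_Icc.prod isCompact_Icc
    have hc : ContinuousOn (sndDeriv^[M] ψ) (Icc (-r) r ×ˢ Icc (-r) r) := fun x hx =>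
      ((hat x (hrW x (abs_le.2 hx.1) (abs_le.2 hx.2))).sndDeriv_iterate
        (by simp) M).continuousAt.continuousWithinAt
    obtain ⟨C, hC⟩ := hK.exists_bound_of_continuousOn hc
    refine ⟨C, fun s t hs ht => ?_⟩
    rw [hslice s t (hrW _ hs ht)]
    exact hC (s, t) ⟨abs_le.1 hs, abs_le.1 ht⟩
  have hC₂ : ∀ k, ∃ C₂ : ℝ, ∀ s : ℝ, |s| ≤ r → |iteratedDeriv M (a k) s| ≤ C₂ := by
    intro k
    have hc : ContinuousOn (iteratedDeriv M (a k)) (Icc (-r) r) := fun s hs => by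
      exact ((hac k s (abs_le.2 hs)).iteratedDeriv_infty M).continuousAt.continuousWithinAt
    obtain ⟨C, hC⟩ := isCompact_Icc.exists_bound_of_continuousOn hc
    exact ⟨C, fun s hs => hC s (abs_le.1 hs)⟩
  choose C₂ hC₂ using hC₂
  have hC₁0 : 0 ≤ C₁ := (abs_nonneg _).trans (hC₁ 0 0 (by simpa using hr.le) (by simpa using hr.le))
  have hC₂0 : ∀ k, 0 ≤ C₂ k := fun k => (abs_nonneg _).trans (hC₂ k 0 (by simpa using hr.le))
  set D : ℝ := C₁ + ∑ k ∈ Finset.range M, (C₂ k + ∑ j ∈ Finset.range M, |taylorCoeff ψ j k|) with hD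
  have hD0 : 0 ≤ D := add_nonneg hC₁0 (Finset.sum_nonneg fun k _ =>
    add_nonneg (hC₂0 k) (Finset.sum_nonneg fun j _ => abs_nonneg _))
  obtain ⟨ε₀, hε₀, hsmall⟩ : ∃ ε₀ > 0, ∀ ε, 0 < ε → ε < ε₀ → ε < 1 ∧ ε ^ κ₁ ≤ r ∧ ε ^ κ₂ ≤ r := by
    refine ⟨min 1 (min (r ^ (1 / κ₁)) (r ^ (1 / κ₂))), by positivity, fun ε h1 h2 => ⟨?_, ?_, ?_⟩⟩
    · exact h2.trans_le (min_le_left _ _)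
    · have h3 : ε ≤ r ^ (1 / κ₁) := (h2.trans_le ((min_le_right _ _).trans (min_le_left _ _))).le
      have := Real.rpow_le_rpow h1.le h3 hκ₁.le
      rwa [← Real.rpow_mul hr.le, one_div_mul_cancel hκ₁.ne', Real.rpow_one] at this
    · have h3 : ε ≤ r ^ (1 / κ₂) := (h2.trans_le ((min_le_right _ _).trans (min_le_right _ _))).le
      have := Real.rpow_le_rpow h1.le h3 hκ₂.le
      rwa [← Real.rpow_mul hr.le, one_div_mul_cancel hκ₂.ne', Real.rpow_one] at this
  refine ⟨D + 1, by linarith, ε₀, hε₀, fun ε hε hεε x hx1 hx2 => ?_⟩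
  obtain ⟨hε1, hεr1, hεr2⟩ := hsmall ε hε hεε
  have hx1r := hx1.trans hεr1
  have hx2r := hx2.trans hεr2
  have hx2one : |x.2| ≤ 1 := hx2.trans (Real.rpow_le_one hε.le hε1.le hκ₂.le)
  have hpow : ∀ (κ : ℝ) (j : ℕ) (y : ℝ), |y| ≤ ε ^ κ → |y| ^ j ≤ ε ^ (κ * j) := fun κ j y hy => by
    rw [Real.rpow_mul hε.le, Real.rpow_natCast]
    gcongr
  have hone : ∀ e : ℝ, 1 ≤ e → ε ^ e ≤ ε := fun e he => by
    simpa using Real.rpow_le_rpow_of_exponent_ge hε hε1.le he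
  have hfac : ∀ k : ℕ, (1 : ℝ) ≤ k.factorial := fun k => by exact_mod_cast k.factorial_pos
  have hy : |ψ x - ∑ k ∈ Finset.range M, a k x.1 * x.2 ^ k / k.factorial| ≤ C₁ * ε := by
    refine (abs_sub_taylor_le (f := fun t => ψ (x.1, t)) (r := r) M (fun t ht => ?_)
      (fun t ht => hC₁ x.1 t hx1r ht) x.2 hx2r).trans ?_
    · exact ContDiffAt.comp (f := fun t : ℝ => (x.1, t)) t (hat _ (hrW _ hx1r ht))
        (contDiffAt_const.prodMk contDiffAt_id)
    · gcongr
      exact (hpow κ₂ M x.2 hx2).trans (hone _ hM.2)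
  have hterm : ∀ k ∈ Finset.range M, |a k x.1 * x.2 ^ k / k.factorial| ≤
      (C₂ k + ∑ j ∈ Finset.range M, |taylorCoeff ψ j k|) * ε := by
    intro k _
    have h1 := abs_sub_taylor_le (f := a k) (r := r) M (hac k) (hC₂ k) x.1 hx1r
    have h2 : a k x.1 * x.2 ^ k / k.factorial =
        (a k x.1 - ∑ j ∈ Finset.range M, iteratedDeriv j (a k) 0 * x.1 ^ j / j.factorial) *
          (x.2 ^ k / k.factorial) + ∑ j ∈ Finset.range M, taylorCoeff ψ j k * x.1 ^ j * x.2 ^ k := by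
      have h3 : ∑ j ∈ Finset.range M, taylorCoeff ψ j k * x.1 ^ j * x.2 ^ k =
          (∑ j ∈ Finset.range M, iteratedDeriv j (a k) 0 * x.1 ^ j / j.factorial) *
          (x.2 ^ k / k.factorial) := by
        rw [Finset.sum_mul]
        refine Finset.sum_congr rfl fun j _ => ?_
        rw [taylorCoeff]
        have := hfac k
        have := hfac j
        simp only [ha]
        field_simp
      rw [h3]; ring
    rw [h2, add_mul, Finset.sum_mul]
    refine (abs_add_le _ _).trans (add_le_add ?_ ?_)
    · rw [abs_mul]
      have h4 : |x.2 ^ k / k.factorial| ≤ 1 := by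
        rw [abs_div, abs_pow, Nat.abs_cast, div_le_one (by linarith [hfac k])]
        exact (pow_le_one₀ (abs_nonneg _) hx2one).trans (hfac k)
      have h5 : |x.1| ^ M ≤ ε := (hpow κ₁ M x.1 hx1).trans (hone _ hM.1)
      calc _ ≤ (C₂ k * |x.1| ^ M) * 1 := by
            gcongr
            have := hC₂0 k
            positivity
        _ ≤ C₂ k * ε := by rw [mul_one]; gcongr; exact hC₂0 k
    · refine (Finset.abs_sum_le_sum_abs _ _).trans (Finset.sum_le_sum fun j _ => ?_)
      by_cases hc : taylorCoeff ψ j k = 0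
      · simp [hc]
      · rw [abs_mul, abs_mul, abs_pow, abs_pow, mul_assoc]
        gcongr
        calc |x.1| ^ j * |x.2| ^ k ≤ ε ^ (κ₁ * j) * ε ^ (κ₂ * k) := by
              gcongr
              · exact hpow κ₁ j x.1 hx1
              · exact hpow κ₂ k x.2 hx2
          _ = ε ^ (κ₁ * j + κ₂ * k) := (Real.rpow_add hε _ _).symm
          _ ≤ ε := hone _ (hsupp (j, k) hc)
  have hsum : |∑ k ∈ Finset.range M, a k x.1 * x.2 ^ k / k.factorial| ≤
      (∑ k ∈ Finset.range M, (C₂ k + ∑ j ∈ Finset.range M, |taylorCoeff ψ j k|)) * ε := by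
    rw [Finset.sum_mul]
    exact (Finset.abs_sum_le_sum_abs _ _).trans (Finset.sum_le_sum hterm)
  have := abs_sub_abs_le_abs_sub (ψ x) (∑ k ∈ Finset.range M, a k x.1 * x.2 ^ k / k.factorial)
  have hDe : D * ε = C₁ * ε +
    (∑ k ∈ Finset.range M, (C₂ k + ∑ j ∈ Finset.range M, |taylorCoeff ψ j k|)) * ε := by
    rw [hD]; ring
  rw [add_mul, hDe]
  linarith

lemma add_mem_newtonPolyhedron {ψ : ℝ × ℝ → ℝ} {t v : ℝ × ℝ} (ht : t ∈ newtonPolyhedron ψ)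
    (hv : 0 ≤ v.1 ∧ 0 ≤ v.2) : t + v ∈ newtonPolyhedron ψ := by
  have hconv : Convex ℝ ((fun t => t + v) ⁻¹' newtonPolyhedron ψ) :=
    (convex_convexHull ℝ _).translate_preimage_left v
  refine convexHull_min ?_ hconv ht
  intro u hu
  refine subset_convexHull ℝ _ ?_
  simp only [mem_iUnion, mem_ofPred_eq] at hu ⊢
  obtain ⟨jk, hjk, h1, h2⟩ := hu
  exact ⟨jk, hjk, by simpa using h1.trans (le_add_of_nonneg_right hv.1),
    by simpa using h2.trans (le_add_of_nonneg_right hv.2)⟩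

/-- Weights whose line separates the point `(d, d)` from the Newton polyhedron. -/
lemma exists_weights_of_notMem {ψ : ℝ × ℝ → ℝ} {d r : ℝ} (hd : 0 < d)
    (hN : (d, d) ∉ newtonPolyhedron ψ) (hr : 1 / d < r) :
    ∃ κ₁ κ₂ : ℝ, 0 < κ₁ ∧ 0 < κ₂ ∧ κ₁ + κ₂ < r ∧
      ∀ jk ∈ taylorSupport ψ, 1 ≤ κ₁ * jk.1 + κ₂ * jk.2 := by
  have hQc : Convex ℝ (Iio d ×ˢ Iio d) := (convex_Iio d).prod (convex_Iio d)
  have hQo : IsOpen (Iio d ×ˢ Iio d) := isOpen_Iio.prod isOpen_Iio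
  -- The polyhedron is stable under adding vectors of the positive quadrant, so missing (d, d) it
  -- misses everything below and to the left. The open convex set obtained in this way can be
  -- separated by Hahn–Banach.
  have hdisj : Disjoint (Iio d ×ˢ Iio d) (newtonPolyhedron ψ) := by
    rw [Set.disjoint_left]
    rintro t ⟨h1, h2⟩ ht
    have h1' : t.1 < d := h1
    have h2' : t.2 < d := h2
    refine hN ?_
    have := add_mem_newtonPolyhedron ht (v := (d - t.1, d - t.2))
      ⟨by simpa using h1'.le, by simpa using h2'.le⟩
    convert this using 1
    ext <;> simp
  obtain ⟨f, u, hf1, hf2⟩ := geometric_hahn_banach_open hQc hQo (convex_convexHull ℝ _) hdisj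
  set a := f (1, 0) with ha
  set b := f (0, 1) with hb
  have hf : ∀ t : ℝ × ℝ, f t = a * t.1 + b * t.2 := by
    intro t
    have : t = t.1 • ((1, 0) : ℝ × ℝ) + t.2 • ((0, 1) : ℝ × ℝ) := by ext <;> simp
    conv_lhs => rw [this, map_add, map_smul, map_smul]
    simp only [smul_eq_mul, ← ha, ← hb]
    ring
  have hlt : ∀ x y : ℝ, x < d → y < d → a * x + b * y < u := fun x y hx hy => by
    have := hf1 (x, y) ⟨hx, hy⟩
    rwa [hf] at this
  -- A negative coefficient would make the functional unbounded above on the quadrant, whose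
  -- coordinates may tend to -∞.
  have ha0 : 0 ≤ a := by
    by_contra! h
    have h1 := hlt (min ((u - b * (d - 1)) / a) (d - 1)) (d - 1)
      ((min_le_right _ _).trans_lt (by linarith)) (by linarith)
    have h2 : a * ((u - b * (d - 1)) / a) ≤ a * min ((u - b * (d - 1)) / a) (d - 1) :=
      mul_le_mul_of_nonpos_left (min_le_left _ _) h.le
    rw [mul_div_cancel₀ _ h.ne] at h2
    linarith
  have hb0 : 0 ≤ b := by
    by_contra! h
    have h1 := hlt (d - 1) (min ((u - a * (d - 1)) / b) (d - 1)) (by linarith)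
      ((min_le_right _ _).trans_lt (by linarith))
    have h2 : b * ((u - a * (d - 1)) / b) ≤ b * min ((u - a * (d - 1)) / b) (d - 1) :=
      mul_le_mul_of_nonpos_left (min_le_left _ _) h.le
    rw [mul_div_cancel₀ _ h.ne] at h2
    linarith
  have hu : 0 < u := by
    have := hlt (d / 2) (d / 2) (by linarith) (by linarith)
    have h1 : 0 ≤ a * (d / 2) := by positivity
    have h2 : 0 ≤ b * (d / 2) := by positivity
    linarith
  have hab : (a + b) * d ≤ u := by
    by_contra! h
    have hab0 : 0 < a + b := by
      by_contra! h'
      have : (a + b) * d ≤ 0 := mul_nonpos_of_nonpos_of_nonneg h' hd.le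
      linarith
    have h1 : u / (a + b) < d := by rw [div_lt_iff₀ hab0]; linarith
    have h2 := hlt _ _ h1 h1
    rw [← add_mul, mul_div_cancel₀ _ hab0.ne'] at h2
    exact lt_irrefl _ h2
  have hab' : a / u + b / u ≤ 1 / d := by
    rw [← add_div, div_le_div_iff₀ hu hd]; linarith
  have hρ : 0 < (r - 1 / d) / 4 := by linarith
  -- A separating line may be parallel to an axis. Adding a quarter of the slack r - 1/d makes both
  -- weights positive and still leaves their sum below r.
  refine ⟨a / u + (r - 1 / d) / 4, b / u + (r - 1 / d) / 4, by positivity, by positivity,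
    by linarith, fun jk hjk => ?_⟩
  have hmem : ((jk.1 : ℝ), (jk.2 : ℝ)) ∈ newtonPolyhedron ψ := by
    refine subset_convexHull ℝ _ ?_
    simp only [mem_iUnion, mem_ofPred_eq]
    exact ⟨jk, hjk, le_rfl, le_rfl⟩
  have h1 := hf2 _ hmem
  rw [hf] at h1
  simp only at h1
  have h2 : 1 ≤ a / u * jk.1 + b / u * jk.2 := by
    rw [div_mul_eq_mul_div, div_mul_eq_mul_div, ← add_div, le_div_iff₀ hu]
    linarith
  have h3 : 0 ≤ (r - 1 / d) / 4 * jk.1 := by positivity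
  have h4 : 0 ≤ (r - 1 / d) / 4 * jk.2 := by positivity
  linarith

/-- The sublevel set of `φ` in the ball of radius `δ` about the origin. -/
def sublevelSet (φ : ℝ × ℝ → ℝ) (δ ε : ℝ) : Set (ℝ × ℝ) := {u | ‖u‖ < δ ∧ |φ u| ≤ ε}

/-- If the height of `φ` exceeds `1 / r`, the sublevel sets of `φ` are large. -/
lemma exists_le_volume_sublevelSet {φ : ℝ × ℝ → ℝ} {Ω : Set (ℝ × ℝ)} (hΩ : IsOpen Ω) (h0 : 0 ∈ Ω)
    (hφ : ContDiffOn ℝ ∞ φ Ω) {r : ℝ} (hr : 0 < r)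
    (hh : ENNReal.ofReal (1 / r) < functionHeight φ) {δ : ℝ} (hδ : 0 < δ) :
    ∃ r' < r, ∃ c > 0, ∃ ε₀ > 0, ∀ ε, 0 < ε → ε < ε₀ →
      ENNReal.ofReal (c * ε ^ r') ≤ volume (sublevelSet φ δ ε) := by
  simp only [functionHeight, lt_iSup_iff] at hh
  obtain ⟨e, ⟨he0, hee, hes, het⟩, hd⟩ := hh
  obtain ⟨d, hd1, hd2⟩ := ENNReal.lt_iff_exists_nnreal_btwn.1 hd
  have hd1' : 1 / r < (d : ℝ) := by
    rw [ENNReal.ofReal_lt_coe_iff (by positivity)] at hd1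
    exact hd1
  have hd0 : (0 : ℝ) < d := lt_trans (by positivity) hd1'
  have hN : ((d : ℝ), (d : ℝ)) ∉ newtonPolyhedron (φ ∘ e.symm) := fun hmem =>
    absurd (iInf₂_le (α := ℝ≥0∞) (f := fun (d : ℝ≥0) (_ : ((d : ℝ), (d : ℝ)) ∈
      newtonPolyhedron (φ ∘ e.symm)) => (d : ℝ≥0∞)) d hmem) (not_le.2 hd2)
  obtain ⟨κ₁, κ₂, hκ₁, hκ₂, hκ, hsupp⟩ := exists_weights_of_notMem hd0 hN
    (r := r) (by rw [div_lt_comm₀ hd0 hr]; exact hd1')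
  have hes0 : e.symm 0 = 0 := by
    have := e.left_inv he0
    rwa [hee] at this
  have ht0 : (0 : ℝ × ℝ) ∈ e.target := by
    have := e.map_source he0
    rwa [hee] at this
  have hWo : IsOpen (e.target ∩ e.symm ⁻¹' Ω) := e.symm.isOpen_inter_preimage hΩ
  obtain ⟨C, hC, ε₀, hε₀, hbox⟩ := exists_abs_le_on_box hWo ⟨ht0, by simpa [hes0] using h0⟩
    (hφ.comp (het.mono inter_subset_left) fun x hx => hx.2) hκ₁ hκ₂ hsupp
  -- Volumes are compared through the Lipschitz bound for the coordinate map and Hausdorff measure: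
  -- the box is the image of a piece of the sublevel set, so its volume is at most L² times that of
  -- the piece.
  obtain ⟨K, T, hT, hK⟩ := ((hes.contDiffAt (e.open_source.mem_nhds he0)).of_le
    (m := 1) (by exact_mod_cast le_top)).exists_lipschitzOnWith
  have hsc : ContinuousAt e.symm 0 := e.symm.continuousAt ht0
  have hev : ∀ᶠ x in 𝓝 (0 : ℝ × ℝ), x ∈ e.target ∧ e.symm x ∈ T ∧ ‖e.symm x‖ < δ := by
    have h1 : ∀ᶠ y in 𝓝 (e.symm 0), y ∈ T := by rw [hes0]; exact hT
    have h2 : ∀ᶠ y in 𝓝 (e.symm 0), ‖y‖ < δ := by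
      rw [hes0]
      filter_upwards [Metric.ball_mem_nhds (0 : ℝ × ℝ) hδ] with y hy
      simpa using hy
    exact (e.open_target.eventually_mem ht0).and ((hsc.eventually h1).and (hsc.eventually h2))
  obtain ⟨ρ, hρ, H⟩ := Metric.eventually_nhds_iff.1 hev
  set L : ℝ≥0 := K + 1 with hL
  have hL0 : (0 : ℝ) < L := by positivity
  have hKL : LipschitzOnWith L e T := hK.weaken (by simp [hL])
  set κ := κ₁ + κ₂ with hκdef
  refine ⟨κ, hκ, 4 / ((L : ℝ) ^ 2 * C ^ κ), by positivity,
    C * min (min ε₀ 1) (min ((ρ / 2) ^ (1 / κ₁)) ((ρ / 2) ^ (1 / κ₂))), by positivity,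
    fun ε h1 h2 => ?_⟩
  set ε' := ε / C with hε'
  have h1' : 0 < ε' := by positivity
  have h2' : ε' < min (min ε₀ 1) (min ((ρ / 2) ^ (1 / κ₁)) ((ρ / 2) ^ (1 / κ₂))) := by
    rw [hε', div_lt_iff₀ hC]; linarith
  have hρ1 : ε' ^ κ₁ ≤ ρ / 2 := by
    have := Real.rpow_le_rpow h1'.le
      (h2'.trans_le ((min_le_right _ _).trans (min_le_left _ _))).le hκ₁.le
    rwa [← Real.rpow_mul (by positivity), one_div_mul_cancel hκ₁.ne', Real.rpow_one] at this
  have hρ2 : ε' ^ κ₂ ≤ ρ / 2 := by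
    have := Real.rpow_le_rpow h1'.le
      (h2'.trans_le ((min_le_right _ _).trans (min_le_right _ _))).le hκ₂.le
    rwa [← Real.rpow_mul (by positivity), one_div_mul_cancel hκ₂.ne', Real.rpow_one] at this
  set R : Set (ℝ × ℝ) := Icc (-ε' ^ κ₁) (ε' ^ κ₁) ×ˢ Icc (-ε' ^ κ₂) (ε' ^ κ₂) with hR
  have hRH : ∀ x ∈ R, x ∈ e.target ∧ e.symm x ∈ T ∧ ‖e.symm x‖ < δ := by
    rintro x ⟨hx1, hx2⟩
    refine H ?_
    rw [Prod.dist_eq, Real.dist_eq, Real.dist_eq]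
    refine max_lt ?_ ?_
    · have := abs_le.2 hx1
      simp only [Prod.fst_zero, sub_zero]; linarith
    · have := abs_le.2 hx2
      simp only [Prod.snd_zero, sub_zero]; linarith
  have hsub : e.symm '' R ⊆ sublevelSet φ δ ε := by
    rintro _ ⟨x, hx, rfl⟩
    refine ⟨(hRH x hx).2.2, ?_⟩
    have := hbox ε' h1' (h2'.trans_le ((min_le_left _ _).trans (min_le_left _ _))) x
      (abs_le.2 hx.1) (abs_le.2 hx.2)
    rwa [hε', mul_div_cancel₀ _ hC.ne'] at this
  have himg : e '' (e.symm '' R) = R := by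
    rw [← image_comp]
    refine (image_congr fun x hx => ?_).trans (image_id R)
    exact e.right_inv (hRH x hx).1
  have hvol : volume R ≤ (L : ℝ≥0∞) ^ (2 : ℝ) * volume (e.symm '' R) := by
    rw [← hausdorffMeasure_prod_real]
    conv_lhs => rw [← himg]
    refine (hKL.mono ?_).hausdorffMeasure_image_le (by norm_num)
    rintro _ ⟨x, hx, rfl⟩
    exact (hRH x hx).2.1
  have hvolR : volume R = ENNReal.ofReal (4 * ε' ^ κ) := by
    rw [hR, Measure.volume_eq_prod, Measure.prod_prod, Real.volume_Icc, Real.volume_Icc,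
      ← ENNReal.ofReal_mul (by linarith [Real.rpow_pos_of_pos h1' κ₁]), hκdef, Real.rpow_add h1']
    congr 1
    ring
  have hL2 : (L : ℝ≥0∞) ^ (2 : ℝ) = ENNReal.ofReal ((L : ℝ) ^ 2) := by
    rw [ENNReal.ofReal_pow hL0.le, ENNReal.ofReal_coe_nnreal]
    norm_num
  rw [hvolR, hL2] at hvol
  have hval : 4 / ((L : ℝ) ^ 2 * C ^ κ) * ε ^ κ = (4 * ε' ^ κ) / (L : ℝ) ^ 2 := by
    rw [hε', Real.div_rpow h1.le hC.le]
    field_simp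
  rw [hval, ENNReal.ofReal_div_of_pos (by positivity)]
  refine (ENNReal.div_le_of_le_mul' hvol).trans (measure_mono hsub)

end NewtonBox

/-! ### The surface measure: local finiteness and comparison with the parameter plane -/

section SurfaceMeasure

lemma LipschitzOnWith.euclideanHausdorffMeasure_image_le {X Y : Type*}
    [EMetricSpace X] [MeasurableSpace X] [BorelSpace X]
    [EMetricSpace Y] [MeasurableSpace Y] [BorelSpace Y] {K : ℝ≥0} {f : X → Y} {s : Set X}
    (h : LipschitzOnWith K f s) (d : ℕ) :
    Measure.euclideanHausdorffMeasure d (f '' s) ≤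
      (K : ℝ≥0∞) ^ (d : ℝ) * Measure.euclideanHausdorffMeasure d s := by
  rw [Measure.euclideanHausdorffMeasure_def, Measure.euclideanHausdorffMeasure_def,
    Measure.smul_apply, Measure.smul_apply, ENNReal.smul_def, ENNReal.smul_def, smul_eq_mul,
    smul_eq_mul, mul_left_comm]
  gcongr
  exact h.hausdorffMeasure_image_le d.cast_nonneg

/-- S need not be closed, but it is relatively closed in a neighbourhood of each of its points, and
countably many of these neighbourhoods cover it. -/
lemma IsSmoothHypersurface.measurableSet {S : Set E3} (hS : IsSmoothHypersurface S) :
    MeasurableSet S := by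
  have h : ∀ x : E3, ∃ U : Set E3, x ∈ S → IsOpen U ∧ x ∈ U ∧ MeasurableSet (S ∩ U) := by
    intro x
    by_cases hx : x ∈ S
    · obtain ⟨U, g, hU, hxU, hg, -, hSU⟩ := hS x hx
      refine ⟨U, fun _ => ⟨hU, hxU, ?_⟩⟩
      have h1 : IsOpen (U ∩ g ⁻¹' {0}ᶜ) := hg.continuousOn.isOpen_inter_preimage hU
        isOpen_compl_singleton
      have h2 : S ∩ U = U \ (U ∩ g ⁻¹' {0}ᶜ) := by
        rw [hSU]
        ext y
        simp
      rw [h2]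
      exact hU.measurableSet.diff h1.measurableSet
    · exact ⟨∅, fun h => absurd h hx⟩
  choose U hU using h
  obtain ⟨t, htS, htc, hcov⟩ := TopologicalSpace.countable_cover_nhdsWithin (f := U) (s := S)
    fun x hx => mem_nhdsWithin_of_mem_nhds ((hU x hx).1.mem_nhds (hU x hx).2.1)
  have : S = ⋃ x ∈ t, S ∩ U x := by
    rw [← inter_iUnion₂]
    exact (inter_eq_left.2 hcov).symm
  rw [this]
  exact MeasurableSet.biUnion htc fun x hx => (hU x (htS hx)).2.2

/-- Near x the surface is a graph over the kernel of the derivative of g. The parametrisation is C¹,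
hence locally Lipschitz, and balls in this two-dimensional kernel have finite measure. -/
lemma IsHypersurfaceNear.exists_measure_lt_top {S : Set E3} {x : E3} (hx : x ∈ S)
    (h : IsHypersurfaceNear ∞ S x) : ∃ V ∈ 𝓝 x, Measure.euclideanHausdorffMeasure 2 (S ∩ V) < ⊤ := by
  obtain ⟨U, g, hU, hxU, hg, hg', hSU⟩ := h
  have hgx : g x = 0 := by
    have : x ∈ S ∩ U := ⟨hx, hxU⟩
    rw [hSU] at this
    exact this.2
  set L := fderiv ℝ g x with hL
  obtain ⟨v, hv⟩ : ∃ v, L v ≠ 0 := by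
    by_contra! hcon
    exact hg' x hxU (ContinuousLinearMap.ext hcon)
  set k := LinearMap.ker (L : E3 →ₗ[ℝ] ℝ) with hk
  have hrank : Module.finrank ℝ k = 2 := by
    have h1 := LinearMap.finrank_range_add_finrank_ker (L : E3 →ₗ[ℝ] ℝ)
    have h2 : LinearMap.range (L : E3 →ₗ[ℝ] ℝ) = ⊤ :=
      LinearMap.range_eq_top.2 (LinearMap.surjective (by
        intro h0
        exact hv (by simpa using LinearMap.congr_fun h0 v)))
    rw [h2, finrank_top, Module.finrank_self, finrank_euclideanSpace_fin, ← hk] at h1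
    omega
  set f : k × ℝ → ℝ := fun z => g (x + (z.1 : E3) + z.2 • v) with hf
  have hpar : ContDiff ℝ ∞ fun z : k × ℝ => x + (z.1 : E3) + z.2 • v := by
    have h1 : ContDiff ℝ ∞ fun z : k × ℝ => (z.1 : E3) :=
      (k.subtypeL.contDiff).comp contDiff_fst
    exact (contDiff_const.add h1).add (contDiff_snd.smul contDiff_const)
  have hf0 : f (0, 0) = 0 := by simp [hf, hgx]
  have hgat : ContDiffAt ℝ ∞ g x := hg.contDiffAt (hU.mem_nhds hxU)
  have hfc : ContDiffAt ℝ ∞ f (0, 0) := by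
    refine ContDiffAt.comp (0, 0) (f := fun z : k × ℝ => x + (z.1 : E3) + z.2 • v) ?_
      hpar.contDiffAt
    simpa using hgat
  have hfd : sndDeriv f (0, 0) ≠ 0 := by
    have h1 := hasDerivAt_slice (hfc.differentiableAt (by simp))
    have h2 : HasDerivAt (fun t : ℝ => g (x + t • v)) (L v) 0 := by
      have h3 : HasDerivAt (fun t : ℝ => x + t • v) v 0 := by
        simpa using ((hasDerivAt_id (0 : ℝ)).smul_const v).const_add x
      have h4 : HasFDerivAt g L (x + (0 : ℝ) • v) := by
        simpa using (hgat.differentiableAt (by simp)).hasFDerivAt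
      exact h4.comp_hasDerivAt 0 h3
    have h5 : (fun t : ℝ => f (0, t)) = fun t : ℝ => g (x + t • v) := by
      ext t; simp [hf]
    rw [h5] at h1
    rw [h1.unique h2]
    exact hv
  obtain ⟨ψ, hψ, -, hψf⟩ := hfc.exists_implicit (by simp) hf0 hfd
  set Φ : k → E3 := fun w => x + (w : E3) + ψ w • v with hΦ
  have hΦc : ContDiffAt ℝ 1 Φ 0 :=
    (hpar.contDiffAt.comp (0 : k) (f := fun w : k => (w, ψ w))
      (contDiffAt_id.prodMk hψ)).of_le (by exact_mod_cast le_top)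
  obtain ⟨K, T, hT, hK⟩ := hΦc.exists_lipschitzOnWith
  -- the coordinates of a point
  have hmem : ∀ y : E3, (y - x) - (L (y - x) / L v) • v ∈ k := by
    intro y
    rw [hk, LinearMap.mem_ker]
    simp [hv]
  set P : E3 → k × ℝ := fun y => (⟨(y - x) - (L (y - x) / L v) • v, hmem y⟩, L (y - x) / L v) with hP
  have hPc : Continuous P := by
    refine Continuous.prodMk (Continuous.subtype_mk ?_ _) ?_ <;> fun_prop
  have hPx : P x = (0, 0) := by simp [hP]
  have hPy : ∀ y, x + ((P y).1 : E3) + (P y).2 • v = y := by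
    intro y
    simp only [hP]
    abel
  have hB : T ∩ Metric.ball 0 1 ∈ 𝓝 (0 : k) := inter_mem hT (Metric.ball_mem_nhds 0 one_pos)
  refine ⟨U ∩ P ⁻¹' {z | (f z = 0 ↔ ψ z.1 = z.2) ∧ z.1 ∈ T ∩ Metric.ball 0 1}, ?_, ?_⟩
  · refine inter_mem (hU.mem_nhds hxU) (hPc.continuousAt.preimage_mem_nhds ?_)
    rw [hPx]
    exact hψf.and (continuousAt_fst.preimage_mem_nhds hB)
  · have hsub : S ∩ (U ∩ P ⁻¹' {z | (f z = 0 ↔ ψ z.1 = z.2) ∧ z.1 ∈ T ∩ Metric.ball 0 1}) ⊆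
        Φ '' (T ∩ Metric.ball 0 1) := by
      rintro y ⟨hyS, hyU, hy1, hy2⟩
      refine ⟨(P y).1, hy2, ?_⟩
      have hgy : g y = 0 := by
        have : y ∈ S ∩ U := ⟨hyS, hyU⟩
        rw [hSU] at this
        exact this.2
      have h1 : f (P y) = 0 := by
        simp only [hf]
        rw [hPy, hgy]
      simp only [hΦ]
      rw [hy1.1 h1, hPy]
    refine (measure_mono hsub).trans_lt
      (((hK.mono inter_subset_left).euclideanHausdorffMeasure_image_le 2).trans_lt ?_)
    refine ENNReal.mul_lt_top (by simp) ?_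
    have h1 : Measure.euclideanHausdorffMeasure 2 (Metric.ball (0 : k) 1) < ⊤ := by
      rw [← hrank]
      exact measure_ball_lt_top
    exact (measure_mono inter_subset_right).trans_lt h1

lemma IsSmoothHypersurface.measure_lt_top {S K : Set E3} (hS : IsSmoothHypersurface S)
    (hK : IsCompact K) (hKS : K ⊆ S) : surfaceMeasure S K < ⊤ := by
  refine hK.measure_lt_top_of_nhdsWithin fun x hx => ?_
  obtain ⟨V, hV, hlt⟩ := (hS x (hKS hx)).exists_measure_lt_top (hKS hx)
  refine ⟨V, mem_nhdsWithin_of_mem_nhds hV, ?_⟩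
  rw [surfaceMeasure, Measure.restrict_apply' hS.measurableSet, inter_comm]
  exact hlt

lemma IsSmoothCompactlySupportedOn.continuousOn {S : Set E3} {ρ : E3 → ℝ}
    (hρ : IsSmoothCompactlySupportedOn S ρ) : ContinuousOn ρ S := by
  intro x hx
  obtain ⟨g, hg, hgρ⟩ := hρ.1 x hx
  exact (hg.continuous.continuousWithinAt).congr_of_eventuallyEq hgρ
    (hgρ.self_of_nhdsWithin hx)

/-- Needed because the integral of a non-integrable function is 0 by convention: without
integrability the averages could not be bounded from below. -/
lemma integrable_mul_density {S : Set E3} {ρ : E3 → ℝ} (hS : IsSmoothHypersurface S)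
    (hρ : IsSmoothCompactlySupportedOn S ρ) {f : E3 → ℝ} (hf : Continuous f) :
    Integrable (fun y => f y * ρ y) (surfaceMeasure S) := by
  have hSm := hS.measurableSet
  obtain ⟨K, hKS, hK, hKρ⟩ := hρ.2
  have hc : ContinuousOn (fun y => f y * ρ y) S := hf.continuousOn.mul hρ.continuousOn
  have hfin := hS.measure_lt_top hK hKS
  have h1 : IntegrableOn (fun y => f y * ρ y) K (surfaceMeasure S) := by
    obtain ⟨C, hC⟩ := hK.exists_bound_of_continuousOn (hc.mono hKS)
    refine Measure.integrableOn_of_bounded hfin.ne (M := C) (hc.aestronglyMeasurable hSm) ?_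
    exact (ae_restrict_iff' hK.measurableSet).2 (Eventually.of_forall hC)
  have h2 : IntegrableOn (fun y => f y * ρ y) (S \ K) (surfaceMeasure S) := by
    refine integrableOn_zero.congr_fun (fun y hy => ?_) (hSm.diff hK.measurableSet)
    simp [hKρ y hy]
  have h3 := h1.union h2
  rw [union_sdiff_cancel hKS] at h3
  rw [IntegrableOn, surfaceMeasure, Measure.restrict_restrict hSm, inter_self] at h3
  exact h3

/-- The horizontal projection, with values in the Euclidean plane. -/
def horizontalProj (y : E3) : EuclideanSpace ℝ (Fin 2) := !₂[y 0, y 1]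

lemma lipschitzWith_horizontalProj : LipschitzWith 1 horizontalProj := by
  refine LipschitzWith.of_dist_le_mul fun x y => ?_
  rw [NNReal.coe_one, one_mul, EuclideanSpace.dist_eq, EuclideanSpace.dist_eq]
  refine Real.sqrt_le_sqrt ?_
  simp only [Fin.sum_univ_two, Fin.sum_univ_three, horizontalProj]
  simp

/-- The horizontal projection is 1-Lipschitz and undoes the graph map. This replaces the area
formula, since only an inequality is needed. -/
lemma volume_le_measure_graph (F : E3 ≃ᵃⁱ[ℝ] E3) (φ : ℝ × ℝ → ℝ) (A : Set (ℝ × ℝ)) :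
    volume A ≤ Measure.euclideanHausdorffMeasure 2 (F.symm '' (graphPoint φ '' A)) := by
  rw [F.symm.isometry.euclideanHausdorffMeasure_image]
  have h1 := (lipschitzWith_horizontalProj.lipschitzOnWith
    (s := graphPoint φ '' A)).euclideanHausdorffMeasure_image_le 2
  rw [ENNReal.coe_one, ENNReal.one_rpow, one_mul] at h1
  refine le_trans ?_ h1
  rw [EuclideanSpace.euclideanHausdorffMeasure_eq_volume]
  set e : ℝ × ℝ ≃ᵐ EuclideanSpace ℝ (Fin 2) :=
    (MeasurableEquiv.finTwoArrow (α := ℝ)).symm.trans (MeasurableEquiv.toLp 2 (Fin 2 → ℝ)) with he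
  have hmp : MeasurePreserving e volume volume :=
    (EuclideanSpace.volume_preserving_symm_measurableEquiv_toLp (Fin 2)).symm.comp
      (volume_preserving_finTwoArrow ℝ).symm
  have hA : e ⁻¹' (horizontalProj '' (graphPoint φ '' A)) = A := by
    rw [← image_comp]
    have h2 : horizontalProj ∘ graphPoint φ = e := by
      ext u i
      fin_cases i <;> simp [horizontalProj, graphPoint, he, MeasurableEquiv.finTwoArrow]
    rw [h2, preimage_image_eq _ e.injective]
  rw [← hmp.measure_preimage_equiv, hA]

end SurfaceMeasure

/-! ### Consequences of the maximal inequality for sublevel sets -/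

section MaximalBound

lemma graphPoint_eq (φ : ℝ × ℝ → ℝ) (u : ℝ × ℝ) :
    graphPoint φ u = u.1 • (!₂[1, 0, 0] : E3) + u.2 • (!₂[0, 1, 0] : E3) +
      (1 + φ u) • (!₂[0, 0, 1] : E3) := by
  ext i
  fin_cases i <;> simp [graphPoint]

lemma ContDiffAt.graphPoint {n : WithTop ℕ∞} {φ : ℝ × ℝ → ℝ} {u : ℝ × ℝ}
    (hφ : ContDiffAt ℝ n φ u) : ContDiffAt ℝ n (graphPoint φ) u := by
  have : _root_.graphPoint φ = fun u => u.1 • (!₂[1, 0, 0] : E3) + u.2 • (!₂[0, 1, 0] : E3) +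
      (1 + φ u) • (!₂[0, 0, 1] : E3) := funext (graphPoint_eq φ)
  rw [this]
  exact ((contDiffAt_fst.smul contDiffAt_const).add (contDiffAt_snd.smul contDiffAt_const)).add
    ((contDiffAt_const.add hφ).smul contDiffAt_const)

lemma graphPoint_injective (φ : ℝ × ℝ → ℝ) : Function.Injective (graphPoint φ) := by
  intro u v h
  have h0 := congrArg (fun y : E3 => y 0) h
  have h1 := congrArg (fun y : E3 => y 1) h
  exact Prod.ext (by simpa [graphPoint] using h0) (by simpa [graphPoint] using h1)

lemma AffineIsometryEquiv.apply_eq_add (F : E3 ≃ᵃⁱ[ℝ] E3) (y : E3) :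
    F y = F.linearIsometryEquiv y + F 0 := by
  have := F.map_vadd 0 y
  simpa using this

lemma AffineIsometryEquiv.contDiff (F : E3 ≃ᵃⁱ[ℝ] E3) {n : WithTop ℕ∞} :
    ContDiff ℝ n F := by
  have : (F : E3 → E3) = fun y => F.linearIsometryEquiv y + F 0 := funext F.apply_eq_add
  rw [this]
  exact F.linearIsometryEquiv.contDiff.add contDiff_const

lemma hasDerivAt_graphPoint_smul {φ : ℝ × ℝ → ℝ} (hφ : HasFDerivAt φ (0 : ℝ × ℝ →L[ℝ] ℝ) 0)
    (w : ℝ × ℝ) : HasDerivAt (fun s : ℝ => graphPoint φ (s • w))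
      (w.1 • (!₂[1, 0, 0] : E3) + w.2 • (!₂[0, 1, 0] : E3)) 0 := by
  have hd1 : HasDerivAt (fun s : ℝ => φ (s • w)) 0 0 := by
    have h2 : HasDerivAt (fun s : ℝ => s • w) w 0 := by
      simpa using (hasDerivAt_id (0 : ℝ)).smul_const w
    rw [← zero_smul ℝ w] at hφ
    exact (hφ.comp_hasDerivAt (0 : ℝ) h2).congr_deriv (by simp)
  have e : (fun s : ℝ => graphPoint φ (s • w)) = fun s : ℝ => (s * w.1) • (!₂[1, 0, 0] : E3) +
      (s * w.2) • (!₂[0, 1, 0] : E3) + (1 + φ (s • w)) • (!₂[0, 0, 1] : E3) := by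
    ext1 s; rw [graphPoint_eq]; simp
  rw [e]
  have h4 := ((((hasDerivAt_id (0 : ℝ)).mul_const w.1).smul_const (!₂[1, 0, 0] : E3)).add
    (((hasDerivAt_id (0 : ℝ)).mul_const w.2).smul_const (!₂[0, 1, 0] : E3))).add
    ((hd1.const_add 1).smul_const (!₂[0, 0, 1] : E3))
  exact h4.congr_deriv (by simp)

lemma graphPoint_zero {φ : ℝ × ℝ → ℝ} (hφ : φ 0 = 0) : graphPoint φ 0 = !₂[0, 0, 1] := by
  ext i; fin_cases i <;> simp [graphPoint, hφ]

lemma symm_graphPoint_mem {S : Set E3} {φ : ℝ × ℝ → ℝ} {F : E3 ≃ᵃⁱ[ℝ] E3} {U : Set E3}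
    {Ω : Set (ℝ × ℝ)} (hS : (F '' S) ∩ U = graphPoint φ '' Ω) {u : ℝ × ℝ} (hu : u ∈ Ω) :
    F.symm (graphPoint φ u) ∈ S := by
  have h2 : graphPoint φ u ∈ (F '' S) ∩ U := by
    rw [hS]; exact mem_image_of_mem _ hu
  obtain ⟨y, hy, hy'⟩ := h2.1
  rwa [← hy', F.symm_apply_apply]

/-- A transversal surface has no tangent plane through the origin. -/
lemma IsTransversal.apply_zero_ne {S : Set E3} (htrans : IsTransversal S) {x₀ : E3} (hx₀ : x₀ ∈ S)
    {φ : ℝ × ℝ → ℝ} {F : E3 ≃ᵃⁱ[ℝ] E3} {U : Set E3} {Ω : Set (ℝ × ℝ)} (hF : F x₀ = !₂[0, 0, 1])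
    (hΩ : IsOpen Ω) (h0 : (0 : ℝ × ℝ) ∈ Ω) (hφ : ContDiffOn ℝ ∞ φ Ω) (hφ0 : φ 0 = 0)
    (hφ' : fderiv ℝ φ 0 = 0) (hS : (F '' S) ∩ U = graphPoint φ '' Ω) : F 0 2 ≠ 1 := by
  intro hc
  refine htrans x₀ hx₀ ⟨-x₀, ?_, by simp⟩
  -- If F 0 had height 1 it would lie in the moved tangent plane, and the curve on the graph over s
  -- ↦ s w would have velocity F 0 - F x₀ there, which the inverse motion takes to -x₀.
  set w : ℝ × ℝ := (F 0 0, F 0 1) with hw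
  have hφat : ContDiffAt ℝ ∞ φ 0 := hφ.contDiffAt (hΩ.mem_nhds h0)
  have hline : ContDiff ℝ ∞ fun s : ℝ => s • w := contDiff_id.smul contDiff_const
  have hgp0 : graphPoint φ 0 = F x₀ := by rw [hF, graphPoint_zero hφ0]
  refine ⟨fun s => F.symm (graphPoint φ (s • w)), ?_, ?_, ?_, ?_⟩
  · simp [hgp0]
  · have h1 : ∀ᶠ s in 𝓝 (0 : ℝ), s • w ∈ Ω := by
      refine hline.continuous.continuousAt.preimage_mem_nhds ?_
      simpa using hΩ.mem_nhds h0
    exact h1.mono fun s hs => symm_graphPoint_mem hS hs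
  · have hFs : ContDiff ℝ ∞ (F.symm : E3 → E3) := F.symm.contDiff
    refine hFs.contDiffAt.comp (0 : ℝ) (f := fun s : ℝ => graphPoint φ (s • w)) ?_
    refine ContDiffAt.comp (0 : ℝ) (g := graphPoint φ) (f := fun s : ℝ => s • w) ?_
      hline.contDiffAt
    rw [zero_smul]
    exact hφat.graphPoint
  · have hd2 : HasDerivAt (fun s : ℝ => graphPoint φ (s • w)) (F 0 - F x₀) 0 := by
      refine (hasDerivAt_graphPoint_smul (hφ' ▸
        (hφat.differentiableAt (by simp)).hasFDerivAt) w).congr_deriv ?_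
      rw [hF]
      ext i
      fin_cases i <;> simp [hw, hc]
    have e2 : (fun s : ℝ => F.symm (graphPoint φ (s • w))) = fun s : ℝ =>
        F.symm.linearIsometryEquiv (graphPoint φ (s • w)) + F.symm 0 :=
      funext fun s => F.symm.apply_eq_add _
    rw [e2]
    have h5 := (F.symm.linearIsometryEquiv.toContinuousLinearEquiv.hasFDerivAt
      (x := graphPoint φ ((0 : ℝ) • w))).comp_hasDerivAt (0 : ℝ) hd2
    refine (h5.add_const (F.symm 0)).congr_deriv ?_
    have h6 := F.symm.apply_eq_add (F 0)
    have h7 := F.symm.apply_eq_add (F x₀)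
    rw [F.symm_apply_apply] at h6 h7
    change F.symm.linearIsometryEquiv (F 0 - F x₀) = -x₀
    rw [map_sub]
    rw [← sub_eq_iff_eq_add] at h6 h7
    rw [← h6, ← h7]
    abel

lemma E3.abs_apply_le_norm (y : E3) (i : Fin 3) : |y i| ≤ ‖y‖ := by
  simpa using PiLp.norm_apply_le y i

lemma volume_slab_le (L : E3 ≃ₗᵢ[ℝ] E3) {R η : ℝ} (hR : 0 ≤ R) :
    volume {x : E3 | ‖x‖ ≤ R ∧ |L x 2| ≤ η} ≤ ENNReal.ofReal (8 * R ^ 2 * η) := by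
  have h1 : {x : E3 | ‖x‖ ≤ R ∧ |L x 2| ≤ η} = L ⁻¹' {y : E3 | ‖y‖ ≤ R ∧ |y 2| ≤ η} := by
    ext x; simp
  rw [h1, L.measurePreserving.measure_preimage_emb L.toHomeomorph.measurableEmbedding]
  have h2 : {y : E3 | ‖y‖ ≤ R ∧ |y 2| ≤ η} ⊆ (WithLp.ofLp : E3 → Fin 3 → ℝ) ⁻¹'
      (Set.pi univ ![Icc (-R) R, Icc (-R) R, Icc (-η) η]) := by
    rintro y ⟨hy1, hy2⟩ i -
    fin_cases i
    · exact abs_le.1 ((E3.abs_apply_le_norm y 0).trans hy1)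
    · exact abs_le.1 ((E3.abs_apply_le_norm y 1).trans hy1)
    · exact abs_le.1 hy2
  refine (measure_mono h2).trans ?_
  rw [(PiLp.volume_preserving_ofLp (Fin 3)).measure_preimage
    ((MeasurableSet.univ_pi fun i => by
      fin_cases i <;> exact measurableSet_Icc).nullMeasurableSet), volume_pi_pi,
    Fin.prod_univ_three]
  simp only [Matrix.cons_val_zero, Matrix.cons_val_one, Matrix.cons_val, Real.volume_Icc]
  rw [← ENNReal.ofReal_mul (by linarith), ← ENNReal.ofReal_mul (by nlinarith)]
  refine ENNReal.ofReal_le_ofReal (le_of_eq ?_)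
  ring

/-- A smooth approximation of `v ↦ |v| ^ (-1 / P)`, truncated at `|v| = 2 ^ (-J)`. -/
noncomputable def dyadicProfile (θ : ContDiffBump (0 : ℝ)) (P : ℝ) (J : ℕ) (v : ℝ) : ℝ :=
  ∑ j ∈ Finset.range J, (2 ^ (1 / P)) ^ j * θ (2 ^ j * v)

lemma dyadicProfile_nonneg (θ : ContDiffBump (0 : ℝ)) (P : ℝ) (J : ℕ) (v : ℝ) :
    0 ≤ dyadicProfile θ P J v :=
  Finset.sum_nonneg fun _ _ => mul_nonneg (by positivity) θ.nonneg

lemma contDiff_dyadicProfile (θ : ContDiffBump (0 : ℝ)) (P : ℝ) (J : ℕ) :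
    ContDiff ℝ ∞ (dyadicProfile θ P J) :=
  ContDiff.sum fun _ _ => contDiff_const.mul (θ.contDiff.comp (contDiff_const.mul contDiff_id))

/-- The coefficients grow geometrically, so the sum over the scales active at v is comparable to its
last term, whose P-th power is 2^m. -/
lemma exists_dyadicProfile_rpow_le (θ : ContDiffBump (0 : ℝ)) (hθ : θ.rOut = 4) {P : ℝ}
    (hP : 0 < P) : ∃ A : ℝ, 0 ≤ A ∧ ∀ J v, dyadicProfile θ P J v ^ P ≤
      A * ∑ j ∈ Finset.range J, if |v| ≤ 4 * (1 / 2) ^ j then 2 ^ j else 0 := by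
  set a : ℝ := 2 ^ (1 / P) with ha
  have ha1 : 1 < a := Real.one_lt_rpow one_lt_two (by positivity)
  have ha0 : 0 < a := by linarith
  have haP : a ^ P = 2 := by
    rw [ha, ← Real.rpow_mul (by norm_num), one_div_mul_cancel hP.ne', Real.rpow_one]
  refine ⟨(a / (a - 1)) ^ P, Real.rpow_nonneg (div_nonneg ha0.le (by linarith)) _, fun J v => ?_⟩
  have hdiv : 0 ≤ a / (a - 1) := div_nonneg ha0.le (by linarith)
  set s := (Finset.range J).filter fun j => |v| ≤ 4 * (1 / 2) ^ j with hs
  have hle : dyadicProfile θ P J v ≤ ∑ j ∈ s, a ^ j := by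
    rw [hs, Finset.sum_filter, dyadicProfile]
    refine Finset.sum_le_sum fun j _ => ?_
    split_ifs with hj
    · exact mul_le_of_le_one_right (by positivity) θ.le_one
    · rw [θ.zero_of_le_dist, mul_zero]
      rw [hθ, Real.dist_eq, sub_zero, abs_mul, abs_of_pos (by positivity : (0 : ℝ) < 2 ^ j)]
      rw [not_le, one_div_pow, mul_one_div, div_lt_iff₀ (by positivity)] at hj
      linarith
  rcases s.eq_empty_or_nonempty with h | h
  · rw [h, Finset.sum_empty] at hle
    rw [le_antisymm hle (dyadicProfile_nonneg _ _ _ _), Real.zero_rpow hP.ne']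
    exact mul_nonneg (Real.rpow_nonneg hdiv _) (Finset.sum_nonneg fun j _ => by positivity)
  · set m := s.max' h with hm
    have hms : m ∈ s := s.max'_mem h
    have h1 : ∑ j ∈ s, a ^ j ≤ a / (a - 1) * a ^ m := by
      calc ∑ j ∈ s, a ^ j ≤ ∑ j ∈ Finset.range (m + 1), a ^ j := by
            refine Finset.sum_le_sum_of_subset_of_nonneg (fun j hj => ?_) fun j _ _ => by positivity
            exact Finset.mem_range.2 (Nat.lt_succ_of_le (s.le_max' j hj))
        _ = (a ^ (m + 1) - 1) / (a - 1) := geom_sum_eq ha1.ne' _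
        _ ≤ a ^ (m + 1) / (a - 1) := by
            gcongr
            · linarith
        _ = a / (a - 1) * a ^ m := by rw [pow_succ]; ring
    calc dyadicProfile θ P J v ^ P ≤ (a / (a - 1) * a ^ m) ^ P :=
          Real.rpow_le_rpow (dyadicProfile_nonneg _ _ _ _) (hle.trans h1) hP.le
      _ = (a / (a - 1)) ^ P * 2 ^ m := by
          rw [Real.mul_rpow hdiv (by positivity), ← Real.rpow_natCast a, ← Real.rpow_mul ha0.le,
            mul_comm (m : ℝ), Real.rpow_mul ha0.le, haP, Real.rpow_natCast]
      _ ≤ _ := by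
          refine mul_le_mul_of_nonneg_left ?_ (Real.rpow_nonneg hdiv _)
          rw [← Finset.sum_filter]
          exact Finset.single_le_sum (f := fun j => (2 : ℝ) ^ j) (fun j _ => by positivity) hms

/-- Each of the J scales contributes 2^j times the volume of a slab of thickness about 2^(-j), a
bounded amount; hence linear growth in J. -/
lemma exists_eLpNorm_profile_le (L : E3 ≃ₗᵢ[ℝ] E3) (χ : ContDiffBump (0 : E3))
    (θ : ContDiffBump (0 : ℝ)) (hθ : θ.rOut = 4) {p : ℝ≥0∞} (hp0 : p ≠ 0) (hp : p ≠ ⊤) :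
    ∃ A : ℝ, 0 ≤ A ∧ ∀ J : ℕ,
      eLpNorm (fun x => χ x * dyadicProfile θ p.toReal J (L x 2)) p volume ≤
        ENNReal.ofReal ((A * J) ^ (1 / p.toReal)) := by
  have hP : 0 < p.toReal := ENNReal.toReal_pos hp0 hp
  obtain ⟨A, hA, hprof⟩ := exists_dyadicProfile_rpow_le θ hθ hP
  set R := χ.rOut with hR
  have hR0 : 0 < R := χ.rOut_pos
  refine ⟨A * (32 * R ^ 2), by positivity, fun J => ?_⟩
  rw [eLpNorm_eq_lintegral_rpow_enorm_toReal hp0 hp, ← ENNReal.ofReal_rpow_of_nonneg (by positivity)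
    (by positivity)]
  refine ENNReal.rpow_le_rpow ?_ (by positivity)
  set B : ℕ → Set E3 := fun j => {x : E3 | ‖x‖ ≤ R ∧ |L x 2| ≤ 4 * (1 / 2) ^ j} with hB
  have hBm : ∀ j, MeasurableSet (B j) := fun j => by
    have h1 : IsClosed {x : E3 | ‖x‖ ≤ R} := isClosed_le (by fun_prop) (by fun_prop)
    have h2 : IsClosed {x : E3 | |L x 2| ≤ 4 * (1 / 2) ^ j} :=
      isClosed_le (by fun_prop) (by fun_prop)
    exact h1.measurableSet.inter h2.measurableSet
  have hpt : ∀ x, ‖χ x * dyadicProfile θ p.toReal J (L x 2)‖ₑ ^ p.toReal ≤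
      ENNReal.ofReal A * ∑ j ∈ Finset.range J, (B j).indicator (fun _ => ENNReal.ofReal (2 ^ j)) x := by
    intro x
    have hnn := dyadicProfile_nonneg θ p.toReal J (L x 2)
    rw [Real.enorm_eq_ofReal (mul_nonneg χ.nonneg hnn), ENNReal.ofReal_rpow_of_nonneg
      (mul_nonneg χ.nonneg hnn) hP.le]
    by_cases hx : ‖x‖ ≤ R
    · have h1 : ∑ j ∈ Finset.range J, (B j).indicator (fun _ => ENNReal.ofReal (2 ^ j)) x =
          ENNReal.ofReal (∑ j ∈ Finset.range J, if |L x 2| ≤ 4 * (1 / 2) ^ j then 2 ^ j else 0) := by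
        rw [ENNReal.ofReal_sum_of_nonneg fun j _ => by positivity]
        refine Finset.sum_congr rfl fun j _ => ?_
        simp only [hB, indicator, mem_ofPred_eq, hx, true_and]
        split_ifs <;> simp
      rw [h1, ← ENNReal.ofReal_mul hA]
      refine ENNReal.ofReal_le_ofReal ((Real.rpow_le_rpow (mul_nonneg χ.nonneg hnn)
        (mul_le_of_le_one_left hnn χ.le_one) hP.le).trans (hprof J _))
    · rw [χ.zero_of_le_dist (by rw [dist_zero_right]; exact (not_le.1 hx).le), zero_mul,
        Real.zero_rpow hP.ne', ENNReal.ofReal_zero]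
      exact zero_le
  calc _ ≤ ∫⁻ x, ENNReal.ofReal A *
        ∑ j ∈ Finset.range J, (B j).indicator (fun _ => ENNReal.ofReal (2 ^ j)) x :=
        lintegral_mono hpt
    _ = ENNReal.ofReal A * ∑ j ∈ Finset.range J, ENNReal.ofReal (2 ^ j) * volume (B j) := by
        rw [lintegral_const_mul' _ _ ENNReal.ofReal_ne_top, lintegral_finsetSum _
          fun j _ => measurable_const.indicator (hBm j)]
        congr 1
        refine Finset.sum_congr rfl fun j _ => ?_
        rw [lintegral_indicator_const (hBm j)]
    _ ≤ ENNReal.ofReal A * ∑ _j ∈ Finset.range J, ENNReal.ofReal (32 * R ^ 2) := by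
        gcongr with j _
        refine (mul_le_mul_right (volume_slab_le L hR0.le) _).trans ?_
        rw [← ENNReal.ofReal_mul (by positivity)]
        refine ENNReal.ofReal_le_ofReal (le_of_eq ?_)
        rw [one_div_pow]
        field_simp
        norm_num
    _ = ENNReal.ofReal (A * (32 * R ^ 2) * J) := by
        rw [Finset.sum_const, Finset.card_range, nsmul_eq_mul, ← ENNReal.ofReal_natCast,
          ← ENNReal.ofReal_mul (by positivity), ← ENNReal.ofReal_mul hA]
        congr 1
        ring

lemma measurableSet_sublevelSet {φ : ℝ × ℝ → ℝ} {δ : ℝ} (hφ : ContinuousOn φ (Metric.ball 0 δ))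
    (ε : ℝ) : MeasurableSet (sublevelSet φ δ ε) := by
  have h1 : IsOpen (Metric.ball 0 δ ∩ φ ⁻¹' {v | ε < |v|}) :=
    hφ.isOpen_inter_preimage Metric.isOpen_ball (isOpen_lt continuous_const continuous_abs)
  have h2 : sublevelSet φ δ ε = Metric.ball 0 δ \ (Metric.ball 0 δ ∩ φ ⁻¹' {v | ε < |v|}) := by
    ext u
    simp [sublevelSet]
  rw [h2]
  exact Metric.isOpen_ball.measurableSet.diff h1.measurableSet

/-- On a fixed ball about x₀ the maximal function of the profile is at least a multiple of the sum
on the left, while the norm of the profile is O(J^(1/p)). All scales are tested at once, and this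
decides the endpoint s = 1/p. -/
lemma exists_sum_volume_sublevelSet_le {S : Set E3} (hS : IsSmoothHypersurface S)
    (htrans : IsTransversal S) {ρ : E3 → ℝ} (hρ : IsSmoothCompactlySupportedOn S ρ)
    (hρ_nonneg : ∀ x ∈ S, 0 ≤ ρ x) {p : ℝ≥0∞} (hp : p ≠ 0) (hp' : p ≠ ⊤)
    (hM : MaximalOperatorBounded S ρ p) {x₀ : E3} (hx₀ : x₀ ∈ S) (hρ_pos : 0 < ρ x₀)
    {φ : ℝ × ℝ → ℝ} (hrep : RepresentsAt S x₀ φ) :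
    ∃ δ > 0, ∃ D : ℝ≥0∞, D ≠ ⊤ ∧ ∀ J : ℕ, ∑ j ∈ Finset.range J,
      ENNReal.ofReal ((2 ^ (1 / p.toReal)) ^ j) * volume (sublevelSet φ δ ((1 / 2) ^ j)) ≤
        D * ENNReal.ofReal ((J : ℝ) ^ (1 / p.toReal)) := by
  obtain ⟨F, U, Ω, hF, hU, hFU, hΩ, h0, hφ, hφ0, hφ', hSU⟩ := hrep
  have hP : 0 < p.toReal := ENNReal.toReal_pos hp hp'
  set L := F.linearIsometryEquiv with hL
  set c : ℝ := 1 - F 0 2 with hc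
  have hc0 : c ≠ 0 :=
    sub_ne_zero.2 (htrans.apply_zero_ne hx₀ hF hΩ h0 hφ hφ0 hφ' hSU).symm
  have hL2 : ∀ y, L y 2 = F y 2 - F 0 2 := fun y => by
    rw [F.apply_eq_add y]; simp [hL]
  have hLx₀ : L x₀ 2 = c := by rw [hL2, hF]; simp [hc]
  set ψ : ℝ × ℝ → E3 := fun u => F.symm (graphPoint φ u) with hψ
  have hLψ : ∀ u, L (ψ u) 2 = c + φ u := fun u => by
    rw [hL2, hψ]; simp [graphPoint, hc]; ring
  have hψ0 : ψ 0 = x₀ := by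
    rw [hψ]
    simp only [graphPoint_zero hφ0, ← hF, F.symm_apply_apply]
  have hψc : ContinuousOn ψ Ω := fun u hu =>
    (F.symm.continuous.continuousAt.comp
      (hφ.contDiffAt (hΩ.mem_nhds hu)).graphPoint.continuousAt).continuousWithinAt
  have hψS : ∀ u ∈ Ω, ψ u ∈ S := fun u hu => symm_graphPoint_mem hSU hu
  have hψinj : Function.Injective ψ := F.symm.injective.comp (graphPoint_injective φ)
  obtain ⟨δ, hδ, hball⟩ : ∃ δ > 0, Metric.ball (0 : ℝ × ℝ) δ ⊆
      {u | u ∈ Ω ∧ ρ x₀ / 2 < ρ (ψ u) ∧ ‖ψ u‖ < ‖x₀‖ + 1} := by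
    refine Metric.mem_nhds_iff.1 ?_
    have h1 : ∀ᶠ u in 𝓝 (0 : ℝ × ℝ), u ∈ Ω := hΩ.mem_nhds h0
    have h2 : ContinuousAt ψ 0 := hψc.continuousAt (hΩ.mem_nhds h0)
    have h3 : Tendsto ψ (𝓝 0) (𝓝[S] x₀) := by
      refine tendsto_nhdsWithin_iff.2 ⟨?_, h1.mono hψS⟩
      rw [← hψ0]; exact h2
    have h4 : ∀ᶠ y in 𝓝[S] x₀, ρ x₀ / 2 < ρ y :=
      (hρ.continuousOn x₀ hx₀).eventually (lt_mem_nhds (half_lt_self hρ_pos))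
    have h5 : ∀ᶠ y in 𝓝[S] x₀, ‖y‖ < ‖x₀‖ + 1 :=
      (continuous_norm.continuousWithinAt).eventually (gt_mem_nhds (lt_add_one _))
    filter_upwards [h1, h3.eventually h4, h3.eventually h5] with u a b c using ⟨a, b, c⟩
  have hδΩ : Metric.ball (0 : ℝ × ℝ) δ ⊆ Ω := fun u hu => (hball hu).1
  set T : ℕ → Set E3 := fun j => ψ '' sublevelSet φ δ ((1 / 2) ^ j) with hT
  have hsub : ∀ j, sublevelSet φ δ ((1 / 2) ^ j) ⊆ Metric.ball 0 δ := fun j u hu => by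
    simpa using hu.1
  have hTm : ∀ j, MeasurableSet (T j) := fun j =>
    (measurableSet_sublevelSet (hφ.continuousOn.mono hδΩ) _).image_of_continuousOn_injOn
      (hψc.mono ((hsub j).trans hδΩ)) hψinj.injOn
  have hTS : ∀ j, T j ⊆ S := by
    rintro j _ ⟨u, hu, rfl⟩
    exact hψS u (hδΩ (hsub j hu))
  have hTvol : ∀ j, volume (sublevelSet φ δ ((1 / 2) ^ j)) ≤ surfaceMeasure S (T j) := fun j => by
    rw [surfaceMeasure, Measure.restrict_apply (hTm j), inter_eq_left.2 (hTS j), hT]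
    have := volume_le_measure_graph F φ (sublevelSet φ δ ((1 / 2) ^ j))
    rwa [image_image] at this
  -- the test functions
  let θ : ContDiffBump (0 : ℝ) := ⟨2, 4, by norm_num, by norm_num⟩
  set R : ℝ := ‖x₀‖ + |c| + 2 * (‖x₀‖ + 1) with hR
  have hR0 : 0 < R := by positivity
  let χ : ContDiffBump (0 : E3) := ⟨R, R + 1, hR0, lt_add_one R⟩
  obtain ⟨A, hA, hAf⟩ := exists_eLpNorm_profile_le L χ θ rfl hp hp'
  obtain ⟨C, hC⟩ := hM
  set a : ℝ := 2 ^ (1 / p.toReal) with ha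
  have ha0 : 0 < a := by positivity
  -- Radius |c|/2 keeps the dilation t chosen below within 1/2 of 1.
  set B : Set E3 := Metric.ball x₀ (|c| / 2) with hB
  have hBpos : volume B ≠ 0 :=
    (Metric.measure_ball_pos volume x₀ (by positivity)).ne'
  have hBtop : volume B ≠ ⊤ := measure_ball_lt_top.ne
  set b : ℝ≥0∞ := volume B ^ (1 / p.toReal) with hb
  have hb0 : b ≠ 0 := by
    rw [hb]; simp [ENNReal.rpow_eq_zero_iff, hBpos, hBtop]
  have hbtop : b ≠ ⊤ := ENNReal.rpow_ne_top_of_nonneg (by positivity) hBtop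
  set r : ℝ≥0∞ := ENNReal.ofReal (ρ x₀ / 2) with hr
  have hr0 : r ≠ 0 := by rw [hr]; simpa using hρ_pos
  have hrtop : r ≠ ⊤ := ENNReal.ofReal_ne_top
  refine ⟨δ, hδ, (r * b)⁻¹ * (C * ENNReal.ofReal (A ^ (1 / p.toReal))), ?_, fun J => ?_⟩
  · exact ENNReal.mul_ne_top (ENNReal.inv_ne_top.2 (mul_ne_zero hr0 hb0))
      (ENNReal.mul_ne_top ENNReal.coe_ne_top ENNReal.ofReal_ne_top)
  set f : E3 → ℝ := fun x => χ x * dyadicProfile θ p.toReal J (L x 2) with hf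
  have hLc : ContDiff ℝ ∞ fun x : E3 => L x 2 :=
    (EuclideanSpace.proj (𝕜 := ℝ) (2 : Fin 3)).contDiff.comp L.contDiff
  have hfc : ContDiff ℝ ∞ f := χ.contDiff.mul ((contDiff_dyadicProfile θ p.toReal J).comp hLc)
  have hfs : HasCompactSupport f := χ.hasCompactSupport.mul_right
  have hf0 : ∀ x, 0 ≤ f x := fun x => mul_nonneg χ.nonneg (dyadicProfile_nonneg _ _ _ _)
  set Q : ℝ≥0∞ := ∑ j ∈ Finset.range J,
    ENNReal.ofReal (a ^ j) * volume (sublevelSet φ δ ((1 / 2) ^ j)) with hQ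
  have hlow : ∀ x ∈ B, r * Q ≤ maximalOperator S ρ f x := by
    intro x hx
    -- This dilation makes the third coordinate of L(x - t ψ(u)) equal to -t φ(u): the dilated
    -- tangent plane passes through x.
    set t : ℝ := L x 2 / c with ht
    have hxd : ‖x - x₀‖ < |c| / 2 := by simpa [hB, dist_eq_norm] using hx
    have ht1 : |t - 1| < 1 / 2 := by
      have h1 : |L x 2 - c| < |c| / 2 := by
        have h2 := (E3.abs_apply_le_norm (L (x - x₀)) 2).trans_eq (L.norm_map _)
        rw [map_sub, PiLp.sub_apply, hLx₀] at h2
        exact h2.trans_lt hxd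
      have h2 : t - 1 = (L x 2 - c) / c := by rw [ht]; field_simp
      rw [h2, abs_div, div_lt_iff₀ (abs_pos.2 hc0)]
      linarith
    obtain ⟨ht2, ht3⟩ := abs_lt.1 ht1
    have ht0 : 0 < t := by linarith
    refine le_trans ?_ (le_iSup₂_of_le t ht0 le_rfl)
    have hcf : Continuous fun y => f (x - t • y) :=
      hfc.continuous.comp (by fun_prop : Continuous fun y : E3 => x - t • y)
    have hint := integrable_mul_density hS hρ hcf
    have hnn : 0 ≤ᵐ[surfaceMeasure S] fun y => f (x - t • y) * ρ y :=
      (ae_restrict_iff' hS.measurableSet).2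
        (Eventually.of_forall fun y hy => mul_nonneg (hf0 _) (hρ_nonneg y hy))
    rw [_root_.average, Real.enorm_eq_ofReal (integral_nonneg_of_ae hnn),
      ofReal_integral_eq_lintegral_ofReal hint hnn]
    have hpt : ∀ y, r * ∑ j ∈ Finset.range J, (T j).indicator (fun _ => ENNReal.ofReal (a ^ j)) y ≤
        ENNReal.ofReal (f (x - t • y) * ρ y) := by
      intro y
      by_cases hy : ∃ u ∈ Metric.ball (0 : ℝ × ℝ) δ, ψ u = y
      · obtain ⟨u, hu, rfl⟩ := hy
        obtain ⟨huΩ, huρ, hun⟩ := hball hu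
        have hLu : L (x - t • ψ u) 2 = -(t * φ u) := by
          have : L x 2 = t * c := by rw [ht]; field_simp
          rw [map_sub, map_smul]
          simp only [PiLp.sub_apply, PiLp.smul_apply, smul_eq_mul, hLψ, this]
          ring
        have hχ : χ (x - t • ψ u) = 1 := by
          refine χ.one_of_mem_closedBall ?_
          rw [mem_closedBall_zero_iff]
          have h1 : ‖x‖ ≤ ‖x - x₀‖ + ‖x₀‖ := by simpa using norm_add_le (x - x₀) x₀
          have h2 : ‖t • ψ u‖ ≤ 2 * (‖x₀‖ + 1) := by
            rw [norm_smul, Real.norm_of_nonneg ht0.le]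
            gcongr
            linarith
          have h3 := norm_sub_le x (t • ψ u)
          change _ ≤ R
          have := abs_nonneg c
          linarith
        rw [ENNReal.ofReal_mul (hf0 _), mul_comm]
        refine mul_le_mul' ?_ (ENNReal.ofReal_le_ofReal huρ.le)
        have h4 : ∑ j ∈ Finset.range J, (T j).indicator (fun _ => ENNReal.ofReal (a ^ j)) (ψ u) =
            ENNReal.ofReal (∑ j ∈ Finset.range J, (T j).indicator (fun _ => a ^ j) (ψ u)) := by
          rw [ENNReal.ofReal_sum_of_nonneg fun j _ => indicator_nonneg (fun _ _ => by positivity) _]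
          refine Finset.sum_congr rfl fun j _ => ?_
          by_cases hj : ψ u ∈ T j <;> simp [hj]
        rw [h4]
        refine ENNReal.ofReal_le_ofReal ?_
        simp only [hf, hχ, one_mul, dyadicProfile, hLu]
        refine Finset.sum_le_sum fun j _ => ?_
        by_cases hj : ψ u ∈ T j
        · have hju : |φ u| ≤ (1 / 2) ^ j := by
            obtain ⟨v, hv, hvu⟩ := hj
            rw [← hψinj hvu]
            exact hv.2
          -- θ equals 1 on [-2, 2], and t ≤ 2 with |φ| ≤ 2^(-j) puts 2^j t φ there.
          rw [indicator_of_mem hj, θ.one_of_mem_closedBall, mul_one]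
          rw [mem_closedBall_zero_iff, Real.norm_eq_abs, abs_mul, abs_neg, abs_mul,
            abs_of_pos ht0, abs_of_pos (by positivity : (0 : ℝ) < 2 ^ j)]
          change _ ≤ (2 : ℝ)
          calc (2 : ℝ) ^ j * (t * |φ u|) ≤ 2 ^ j * (2 * (1 / 2) ^ j) := by
                gcongr
                linarith
            _ = 2 := by rw [one_div_pow]; field_simp
        · rw [indicator_of_notMem hj]
          exact mul_nonneg (by positivity) θ.nonneg
      · have h5 : ∀ j, y ∉ T j := by
          rintro j ⟨u, hu, rfl⟩
          exact hy ⟨u, hsub j hu, rfl⟩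
        simp [h5]
    refine le_trans ?_ (lintegral_mono hpt)
    rw [lintegral_const_mul' _ _ hrtop, lintegral_finsetSum _
      fun j _ => measurable_const.indicator (hTm j), hQ]
    gcongr with j _
    rw [lintegral_indicator_const (hTm j)]
    gcongr
    exact hTvol j
  have hnorm : r * Q * b ≤ eLpNorm (maximalOperator S ρ f) p volume := by
    have h1 : eLpNorm (B.indicator fun _ => r * Q) p volume = r * Q * b := by
      rw [eLpNorm_indicator_const measurableSet_ball hp hp', enorm_eq_self]
    rw [← h1]
    refine eLpNorm_mono_enorm fun x => ?_
    rw [enorm_eq_self, enorm_eq_self]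
    by_cases hx : x ∈ B
    · rw [indicator_of_mem hx]; exact hlow x hx
    · rw [indicator_of_notMem hx]; exact zero_le
  have hfin : r * b * Q ≤ C * ENNReal.ofReal (A ^ (1 / p.toReal)) *
      ENNReal.ofReal ((J : ℝ) ^ (1 / p.toReal)) := by
    calc r * b * Q = r * Q * b := by ring
      _ ≤ C * eLpNorm f p volume := hnorm.trans (hC f hfc hfs)
      _ ≤ C * ENNReal.ofReal ((A * J) ^ (1 / p.toReal)) := by gcongr; exact hAf J
      _ = _ := by
        rw [Real.mul_rpow hA J.cast_nonneg, ENNReal.ofReal_mul (Real.rpow_nonneg hA _), mul_assoc]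
  rw [mul_assoc]
  rwa [← ENNReal.mul_le_iff_le_inv (mul_ne_zero hr0 hb0) (ENNReal.mul_ne_top hrtop hbtop)]

/-- For s ≤ 1/p a lower bound c ε^s makes every late term of the dyadic sum at least c. The sum
would grow linearly in J, against the bound J^(1/p) with p > 1. -/
lemma MaximalOperatorBounded.exists_not_le_volume_sublevelSet {S : Set E3}
    (hS : IsSmoothHypersurface S) (htrans : IsTransversal S) {ρ : E3 → ℝ}
    (hρ : IsSmoothCompactlySupportedOn S ρ) (hρ_nonneg : ∀ x ∈ S, 0 ≤ ρ x) {p : ℝ≥0∞} (hp : 1 < p)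
    (hp' : p ≠ ⊤) (hM : MaximalOperatorBounded S ρ p) {x₀ : E3} (hx₀ : x₀ ∈ S) (hρ_pos : 0 < ρ x₀)
    {φ : ℝ × ℝ → ℝ} (hrep : RepresentsAt S x₀ φ) :
    ∃ δ > 0, ∀ s ≤ 1 / p.toReal, ∀ c > 0, ∀ ε₀ > 0, ¬ ∀ ε, 0 < ε → ε < ε₀ →
      ENNReal.ofReal (c * ε ^ s) ≤ volume (sublevelSet φ δ ε) := by
  have hp0 : p ≠ 0 := (zero_lt_one.trans hp).ne'
  obtain ⟨δ, hδ, D, hD, hsum⟩ :=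
    exists_sum_volume_sublevelSet_le hS htrans hρ hρ_nonneg hp0 hp' hM hx₀ hρ_pos hrep
  refine ⟨δ, hδ, fun s hs c hc ε₀ hε₀ hlow => ?_⟩
  have hP : 1 < p.toReal := by
    rw [← ENNReal.toReal_one]
    exact (ENNReal.toReal_lt_toReal ENNReal.one_ne_top hp').2 hp
  set a : ℝ := 2 ^ (1 / p.toReal) with ha
  obtain ⟨m, hm⟩ := exists_pow_lt_of_lt_one hε₀ (by norm_num : (1 / 2 : ℝ) < 1)
  have hterm : ∀ j ≥ m, ENNReal.ofReal c ≤
      ENNReal.ofReal (a ^ j) * volume (sublevelSet φ δ ((1 / 2) ^ j)) := by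
    intro j hj
    have h1 := hlow ((1 / 2) ^ j) (by positivity)
      ((pow_le_pow_of_le_one (by norm_num) (by norm_num) hj).trans_lt hm)
    refine le_trans ?_ (mul_le_mul_right h1 _)
    rw [← ENNReal.ofReal_mul (by positivity)]
    refine ENNReal.ofReal_le_ofReal ?_
    have h2 : 1 ≤ a ^ j * ((1 / 2 : ℝ) ^ j) ^ s := by
      rw [one_div_pow, ← Real.rpow_natCast 2 j, ← Real.rpow_natCast a j, ha,
        ← Real.rpow_mul (by norm_num), one_div ((2 : ℝ) ^ (j : ℝ)), ← Real.rpow_neg (by norm_num),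
        ← Real.rpow_mul (by norm_num), ← Real.rpow_add (by norm_num)]
      refine Real.one_le_rpow (by norm_num) ?_
      have : (0 : ℝ) ≤ j := j.cast_nonneg
      nlinarith
    nlinarith
  have hbound : ∀ J : ℕ, 0 < J →
      c ≤ D.toReal * (J : ℝ) ^ (-(1 - 1 / p.toReal)) + c * m / J := by
    intro J hJ
    have hJ' : (0 : ℝ) < J := by exact_mod_cast hJ
    have h1 : ENNReal.ofReal (c * ((J : ℝ) - m)) ≤
        ENNReal.ofReal (D.toReal * (J : ℝ) ^ (1 / p.toReal)) := by
      rw [ENNReal.ofReal_mul ENNReal.toReal_nonneg, ENNReal.ofReal_toReal hD]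
      refine le_trans ?_ (hsum J)
      rcases le_total J m with h | h
      · rw [ENNReal.ofReal_of_nonpos]
        · exact zero_le
        · have : (J : ℝ) ≤ m := by exact_mod_cast h
          nlinarith
      · calc ENNReal.ofReal (c * ((J : ℝ) - m)) = ∑ _j ∈ Finset.Ico m J, ENNReal.ofReal c := by
              rw [Finset.sum_const, Nat.card_Ico, nsmul_eq_mul, mul_comm, ← Nat.cast_sub h,
                ENNReal.ofReal_mul (by positivity), ENNReal.ofReal_natCast]
          _ ≤ ∑ j ∈ Finset.Ico m J,
                ENNReal.ofReal (a ^ j) * volume (sublevelSet φ δ ((1 / 2) ^ j)) :=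
              Finset.sum_le_sum fun j hj => hterm j (Finset.mem_Ico.1 hj).1
          _ ≤ _ := Finset.sum_le_sum_of_subset fun j hj =>
              Finset.mem_range.2 (Finset.mem_Ico.1 hj).2
    have h2 := (ENNReal.ofReal_le_ofReal_iff (mul_nonneg ENNReal.toReal_nonneg
      (by positivity))).1 h1
    have h3 : (J : ℝ) ^ (1 / p.toReal) = (J : ℝ) ^ (-(1 - 1 / p.toReal)) * J := by
      rw [← Real.rpow_add_one hJ'.ne']
      congr 1; ring
    rw [h3] at h2
    rw [← sub_le_iff_le_add, le_iff_le_of_cmp_eq_cmp rfl]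
    rw [← mul_le_mul_iff_of_pos_right hJ', sub_mul, div_mul_cancel₀ _ hJ'.ne']
    linarith
  have hlim : Tendsto (fun J : ℕ => D.toReal * (J : ℝ) ^ (-(1 - 1 / p.toReal)) + c * m / J) atTop
      (𝓝 (D.toReal * 0 + 0)) := by
    have h1 : 1 / p.toReal < 1 := by rw [div_lt_one (by linarith)]; exact hP
    exact ((tendsto_rpow_neg_atTop (sub_pos.2 h1)).comp tendsto_natCast_atTop_atTop).const_mul _
      |>.add (tendsto_const_div_atTop_nhds_zero_nat _)
  have := ge_of_tendsto hlim ((eventually_gt_atTop 0).mono hbound)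
  linarith

end MaximalBound

/-! ### Sublevel sets of analytic functions -/

section SublevelSets

variable {φ : ℝ × ℝ → ℝ} {s : ℝ}

lemma sublevelMass_zero_zero {g : ℝ × ℝ → ℝ} {A : Set (ℝ × ℝ)} (hA : MeasurableSet A) {ε : ℝ}
    (h : MeasurableSet (A ∩ {x | |g x| ≤ ε})) :
    sublevelMass g 0 0 A ε = volume (A ∩ {x | |g x| ≤ ε}) := by
  simp only [sublevelMass, pow_zero, one_mul, ENNReal.ofReal_one]
  rw [← lintegral_indicator hA, indicator_indicator, lintegral_indicator_const h, one_mul]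

lemma measurableSet_halfBox_inter {g : ℝ × ℝ → ℝ} {δ : ℝ} (hg : ContinuousOn g (Metric.ball 0 δ))
    (ε : ℝ) : MeasurableSet (halfBox 0 δ ∩ {x | |g x| ≤ ε}) := by
  have h : halfBox 0 δ ∩ {x | |g x| ≤ ε} = halfBox 0 δ ∩ sublevelSet g δ ε := by
    ext x
    simp only [mem_inter_iff, mem_halfBox, sublevelSet, mem_ofPred_eq, Prod.norm_def, max_lt_iff,
      Real.norm_eq_abs, sub_zero]
    constructor
    · rintro ⟨⟨h1, h2, h3⟩, h4⟩
      exact ⟨⟨h1, h2, h3⟩, ⟨by rwa [abs_of_pos h1], h3⟩, h4⟩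
    · rintro ⟨h1, -, h3⟩
      exact ⟨h1, h3⟩
  rw [h]
  exact (measurableSet_halfBox 0 δ).inter (measurableSet_sublevelSet hg ε)

lemma exists_continuousOn_comp_ball (hφ : ∀ᶠ u in 𝓝 (0 : ℝ × ℝ), ContinuousAt φ u)
    (e : (ℝ × ℝ) ≃L[ℝ] ℝ × ℝ) : ∃ δ > 0, ContinuousOn (φ ∘ e) (Metric.ball 0 δ) := by
  have h1 : ∀ᶠ x in 𝓝 (0 : ℝ × ℝ), ContinuousAt φ (e x) := by
    have : Tendsto e (𝓝 0) (𝓝 0) := by simpa using e.continuous.tendsto 0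
    exact this.eventually hφ
  obtain ⟨δ, hδ, H⟩ := Metric.eventually_nhds_iff_ball.1 h1
  exact ⟨δ, hδ, fun x hx => ((H x hx).comp e.continuous.continuousAt).continuousWithinAt⟩

lemma LowerAt.le_volume_sublevelSet (hφ : ∀ᶠ u in 𝓝 (0 : ℝ × ℝ), ContinuousAt φ u)
    (e : (ℝ × ℝ) ≃L[ℝ] ℝ × ℝ) (h : LowerAt (φ ∘ e) 0 0 s 0) {δ : ℝ} (hδ : 0 < δ) :
    ∃ c > 0, ∃ ε₀ > 0, ∀ ε, 0 < ε → ε < ε₀ →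
      ENNReal.ofReal (c * ε ^ s) ≤ volume (sublevelSet φ δ ε) := by
  obtain ⟨δ₁, hδ₁, hc⟩ := exists_continuousOn_comp_ball hφ e
  obtain ⟨δ₂, hδ₂, hb⟩ : ∃ δ₂ > 0, Metric.ball (0 : ℝ × ℝ) δ₂ ⊆ e ⁻¹' Metric.ball 0 δ := by
    refine Metric.mem_nhds_iff.1 (e.continuous.continuousAt.preimage_mem_nhds ?_)
    rw [map_zero]
    exact Metric.ball_mem_nhds 0 hδ
  set r := min δ₁ δ₂ with hr
  have hr0 : 0 < r := lt_min hδ₁ hδ₂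
  obtain ⟨c, hc0, ε₀, hε₀, hl⟩ := h.2 r hr0
  set k := |((e : (ℝ × ℝ) →L[ℝ] ℝ × ℝ) : (ℝ × ℝ) →ₗ[ℝ] ℝ × ℝ).det| with hk
  have hk0 : 0 < k := abs_pos.2 e.toLinearEquiv.isUnit_det'.ne_zero
  refine ⟨k * c, by positivity, ε₀, hε₀, fun ε h1 h2 => ?_⟩
  have h3 := hl ε h1 h2
  rw [sublevelMass_zero_zero (measurableSet_halfBox 0 r) (measurableSet_halfBox_inter
    (hc.mono (Metric.ball_subset_ball (min_le_left _ _))) ε)] at h3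
  have h4 : e '' (halfBox 0 r ∩ {x | |(φ ∘ e) x| ≤ ε}) ⊆ sublevelSet φ δ ε := by
    rintro _ ⟨x, ⟨hx1, hx2⟩, rfl⟩
    refine ⟨?_, hx2⟩
    have : x ∈ Metric.ball (0 : ℝ × ℝ) δ₂ := by
      rw [mem_halfBox, sub_zero] at hx1
      rw [mem_ball_zero_iff, Prod.norm_def, max_lt_iff, Real.norm_eq_abs, Real.norm_eq_abs,
        abs_of_pos hx1.1]
      exact ⟨hx1.2.1.trans_le (min_le_right _ _), hx1.2.2.trans_le (min_le_right _ _)⟩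
    simpa using hb this
  refine le_trans ?_ (measure_mono h4)
  rw [Measure.addHaar_image_continuousLinearEquiv, mul_assoc, ENNReal.ofReal_mul hk0.le]
  exact mul_le_mul' le_rfl h3

/-- The measure of the sublevel sets of `φ` near `0` decays like a power with exponent `κ`. -/
def SublevelDecay (φ : ℝ × ℝ → ℝ) (κ : ℝ) : Prop :=
  ∃ δ > 0, ∃ C : ℝ, ∀ ε, 0 < ε → ε ≤ 1 → volume (sublevelSet φ δ ε) ≤ ENNReal.ofReal (C * ε ^ κ)

/-- A larger height would give sublevel sets of size at least c ε^r with r < κ, incompatible with C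
ε^κ as ε → 0. -/
lemma SublevelDecay.functionHeight_le {κ : ℝ} (hκ : 0 < κ) (h : SublevelDecay φ κ)
    {Ω : Set (ℝ × ℝ)} (hΩ : IsOpen Ω) (h0 : 0 ∈ Ω) (hφ : ContDiffOn ℝ ∞ φ Ω) :
    functionHeight φ ≤ ENNReal.ofReal (1 / κ) := by
  by_contra! hlt
  obtain ⟨δ, hδ, C, hC⟩ := h
  obtain ⟨r, hr, c, hc, ε₀, hε₀, hl⟩ := exists_le_volume_sublevelSet hΩ h0 hφ hκ hlt hδ
  have hev : ∀ᶠ ε in 𝓝[>] (0 : ℝ), c ≤ C * ε ^ (κ - r) := by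
    have h1 : ∀ᶠ ε in 𝓝[>] (0 : ℝ), ε < min ε₀ 1 :=
      nhdsWithin_le_nhds (gt_mem_nhds (lt_min hε₀ one_pos))
    filter_upwards [h1, self_mem_nhdsWithin] with ε hε hε0
    have hε0 : 0 < ε := hε0
    have h2 := (hl ε hε0 (hε.trans_le (min_le_left _ _))).trans
      (hC ε hε0 (hε.le.trans (min_le_right _ _)))
    have h3 : c * ε ^ r ≤ C * ε ^ κ := by
      by_contra! hlt
      rw [← not_lt] at h2
      exact h2 ((ENNReal.ofReal_lt_ofReal_iff (by positivity)).2 hlt)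
    have h4 : ε ^ κ = ε ^ (κ - r) * ε ^ r := by rw [← Real.rpow_add hε0]; congr 1; ring
    rw [h4, ← mul_assoc] at h3
    exact le_of_mul_le_mul_right h3 (by positivity)
  have hlim : Tendsto (fun ε : ℝ => C * ε ^ (κ - r)) (𝓝[>] 0) (𝓝 (C * 0)) := by
    refine Tendsto.const_mul _ (tendsto_nhdsWithin_of_tendsto_nhds ?_)
    have := (Real.continuousAt_rpow_const 0 (κ - r) (Or.inr (by linarith))).tendsto
    rwa [Real.zero_rpow (by linarith)] at this
  have := ge_of_tendsto hlim hev
  linarith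

/-- The reflection `(t, y) ↦ (-t, y)`. -/
noncomputable def fstReflection : (ℝ × ℝ) ≃L[ℝ] ℝ × ℝ :=
  (ContinuousLinearEquiv.neg ℝ).prodCongr (ContinuousLinearEquiv.refl ℝ ℝ)

/-- Half boxes see only t > 0; the reflection supplies t < 0, and the line t = 0 is null. -/
lemma UpperAt.sublevelDecay (hφ : ∀ᶠ u in 𝓝 (0 : ℝ × ℝ), ContinuousAt φ u)
    (e : (ℝ × ℝ) ≃L[ℝ] ℝ × ℝ) (h : UpperAt (φ ∘ e) 0 0 s 0)
    (h' : UpperAt (φ ∘ (fstReflection.trans e)) 0 0 s 0) :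
    ∃ κ > s, SublevelDecay φ κ := by
  obtain ⟨δ₁, hδ₁, hc⟩ := exists_continuousOn_comp_ball hφ e
  obtain ⟨δ₂, hδ₂, hc'⟩ := exists_continuousOn_comp_ball hφ (fstReflection.trans e)
  obtain ⟨δ₃, hδ₃, η, hη, C, hC⟩ := h
  obtain ⟨δ₄, hδ₄, η', hη', C', hC'⟩ := h'
  obtain ⟨r, hr, hr1, hr2, hr3, hr4⟩ : ∃ r > 0, r ≤ δ₁ ∧ r ≤ δ₂ ∧ r ≤ δ₃ ∧ r ≤ δ₄ :=
    ⟨min (min δ₁ δ₂) (min δ₃ δ₄), by positivity, by simp, by simp, by simp, by simp⟩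
  obtain ⟨δ, hδ, hb⟩ : ∃ δ > 0, Metric.ball (0 : ℝ × ℝ) δ ⊆ e.symm ⁻¹' Metric.ball 0 r := by
    refine Metric.mem_nhds_iff.1 (e.symm.continuous.continuousAt.preimage_mem_nhds ?_)
    rw [map_zero]
    exact Metric.ball_mem_nhds 0 hr
  set k := |((e : (ℝ × ℝ) →L[ℝ] ℝ × ℝ) : (ℝ × ℝ) →ₗ[ℝ] ℝ × ℝ).det| with hk
  set k' := |((fstReflection.trans e : (ℝ × ℝ) →L[ℝ] ℝ × ℝ) : (ℝ × ℝ) →ₗ[ℝ] ℝ × ℝ).det| with hk'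
  refine ⟨s + min η η', by simp [hη, hη'], δ, hδ, k * |C| + k' * |C'|, fun ε h1 h2 => ?_⟩
  have hsub : sublevelSet φ δ ε ⊆ e '' (halfBox 0 r ∩ {x | |(φ ∘ e) x| ≤ ε}) ∪
      (fstReflection.trans e) '' (halfBox 0 r ∩ {x | |(φ ∘ (fstReflection.trans e)) x| ≤ ε}) ∪
      e '' ({0} ×ˢ univ) := by
    rintro u ⟨hu, huε⟩
    have hx : e.symm u ∈ Metric.ball (0 : ℝ × ℝ) r := hb (by simpa using hu)
    obtain ⟨⟨t, y⟩, rfl⟩ := e.surjective u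
    rw [e.symm_apply_apply, mem_ball_zero_iff, Prod.norm_def, max_lt_iff, Real.norm_eq_abs,
      Real.norm_eq_abs] at hx
    obtain ⟨hxt, hxy⟩ := hx
    rcases lt_trichotomy t 0 with ht | ht | ht
    · refine Or.inl (Or.inr ⟨(-t, y), ⟨mem_halfBox.2 ⟨by simpa using ht, ?_, by simpa using hxy⟩,
        ?_⟩, ?_⟩)
      · rwa [abs_of_neg ht] at hxt
      · simpa [fstReflection] using huε
      · simp [fstReflection]
    · exact Or.inr ⟨(t, y), by simp [ht], rfl⟩
    · refine Or.inl (Or.inl ⟨(t, y), ⟨mem_halfBox.2 ⟨ht, ?_, by simpa using hxy⟩, huε⟩, rfl⟩)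
      rwa [abs_of_pos ht] at hxt
  have hnull : volume (e '' ({0} ×ˢ univ)) = 0 := by
    rw [Measure.addHaar_image_continuousLinearEquiv, Measure.volume_eq_prod, Measure.prod_prod]
    simp
  have hb1 : volume (e '' (halfBox 0 r ∩ {x | |(φ ∘ e) x| ≤ ε})) ≤
      ENNReal.ofReal (k * |C| * ε ^ (s + min η η')) := by
    rw [Measure.addHaar_image_continuousLinearEquiv, mul_assoc, ENNReal.ofReal_mul (abs_nonneg _),
      ← sublevelMass_zero_zero (measurableSet_halfBox 0 r)
        (measurableSet_halfBox_inter (hc.mono (Metric.ball_subset_ball hr1)) ε)]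
    refine mul_le_mul' le_rfl ?_
    refine ((sublevelMass_mono (halfBox_mono hr3) ε).trans (hC ε h1 h2)).trans
      (ENNReal.ofReal_le_ofReal ?_)
    exact mul_le_mul (le_abs_self C) (Real.rpow_le_rpow_of_exponent_ge h1 h2 (by simp))
      (by positivity) (abs_nonneg C)
  have hb2 : volume ((fstReflection.trans e) ''
      (halfBox 0 r ∩ {x | |(φ ∘ (fstReflection.trans e)) x| ≤ ε})) ≤
      ENNReal.ofReal (k' * |C'| * ε ^ (s + min η η')) := by
    rw [Measure.addHaar_image_continuousLinearEquiv, mul_assoc, ENNReal.ofReal_mul (abs_nonneg _),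
      ← sublevelMass_zero_zero (measurableSet_halfBox 0 r)
        (measurableSet_halfBox_inter (hc'.mono (Metric.ball_subset_ball hr2)) ε)]
    refine mul_le_mul' le_rfl ?_
    refine ((sublevelMass_mono (halfBox_mono hr4) ε).trans (hC' ε h1 h2)).trans
      (ENNReal.ofReal_le_ofReal ?_)
    exact mul_le_mul (le_abs_self C') (Real.rpow_le_rpow_of_exponent_ge h1 h2 (by simp))
      (by positivity) (abs_nonneg C')
  calc volume (sublevelSet φ δ ε) ≤ _ := measure_mono hsub
    _ ≤ _ := (measure_union_le _ _).trans (add_le_add (measure_union_le _ _) le_rfl)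
    _ ≤ ENNReal.ofReal (k * |C| * ε ^ (s + min η η')) +
          ENNReal.ofReal (k' * |C'| * ε ^ (s + min η η')) := by
        rw [hnull, add_zero]
        exact add_le_add hb1 hb2
    _ = _ := by
        rw [← ENNReal.ofReal_add (by positivity) (by positivity)]
        congr 1
        ring

/-- A real analytic function that does not vanish near the origin has, in suitable linear
coordinates, finite order in the second variable. -/
lemma AnalyticAt.exists_sndDeriv_iterate_comp_ne_zero (hφ : AnalyticAt ℝ φ 0) (hφ0 : φ 0 = 0)
    (hne : ¬ φ =ᶠ[𝓝 0] 0) : ∃ (e : (ℝ × ℝ) ≃L[ℝ] ℝ × ℝ) (m : ℕ),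
      sndDeriv^[m] (φ ∘ e) 0 ≠ 0 ∧ sndDeriv^[m] (φ ∘ (fstReflection.trans e)) 0 ≠ 0 := by
  obtain ⟨r, hr, hr'⟩ := Metric.eventually_nhds_iff_ball.1 hφ.eventually_analyticAt
  obtain ⟨v, hv, hvr⟩ : ∃ v, φ v ≠ 0 ∧ v ∈ Metric.ball (0 : ℝ × ℝ) r :=
    ((not_eventually.1 hne).and_eventually (Metric.ball_mem_nhds 0 hr)).exists
  have hv0 : v ≠ 0 := fun h => hv (h ▸ hφ0)
  have hvn : 0 < v.1 ^ 2 + v.2 ^ 2 := by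
    rcases not_and_or.1 (mt Prod.ext_iff.2 hv0) with h | h
    · have h : v.1 ≠ 0 := h
      positivity
    · have h : v.2 ≠ 0 := h
      positivity
  -- A multiple of a rotation that takes (0, 1) to v, so the second variable runs along a direction
  -- in which φ is not identically zero.
  let f : (ℝ × ℝ) →ₗ[ℝ] ℝ × ℝ :=
    (LinearMap.fst ℝ ℝ ℝ).smulRight (-v.2, v.1) + (LinearMap.snd ℝ ℝ ℝ).smulRight v
  have hf : ∀ x, f x = (x.2 * v.1 - x.1 * v.2, x.2 * v.2 + x.1 * v.1) := fun x => by
    ext <;> simp [f] <;> ring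
  have hinj : Function.Injective f := by
    rw [← LinearMap.ker_eq_bot, LinearMap.ker_eq_bot']
    intro x hx
    rw [hf, Prod.mk_eq_zero] at hx
    obtain ⟨h1, h2⟩ := hx
    have h3 : x.1 * (v.1 ^ 2 + v.2 ^ 2) = 0 := by linear_combination v.1 * h2 - v.2 * h1
    have h4 : x.2 * (v.1 ^ 2 + v.2 ^ 2) = 0 := by linear_combination v.1 * h1 + v.2 * h2
    exact Prod.ext ((mul_eq_zero.1 h3).resolve_right hvn.ne')
      ((mul_eq_zero.1 h4).resolve_right hvn.ne')
  let e : (ℝ × ℝ) ≃L[ℝ] ℝ × ℝ := (LinearEquiv.ofInjectiveEndo f hinj).toContinuousLinearEquiv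
  have he : ∀ y : ℝ, e (0, y) = y • v := fun y => by
    change f (0, y) = _
    rw [hf]; ext <;> simp
  have he' : ∀ y : ℝ, fstReflection.trans e (0, y) = y • v := fun y => by
    rw [← he]; simp [fstReflection]
  have hseg : ∀ y ∈ Icc (0 : ℝ) 1, y • v ∈ Metric.ball (0 : ℝ × ℝ) r := by
    intro y hy
    rw [mem_ball_zero_iff] at hvr ⊢
    rw [norm_smul, Real.norm_of_nonneg hy.1]
    exact (mul_le_of_le_one_left (norm_nonneg _) hy.2).trans_lt hvr
  set h : ℝ → ℝ := fun y => φ (y • v) with hh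
  have hhan : AnalyticOnNhd ℝ h (Icc 0 1) := fun y hy => by
    have h1 : AnalyticAt ℝ (fun y : ℝ => y • v) y := analyticAt_id.smul analyticAt_const
    exact AnalyticAt.comp (f := fun y : ℝ => y • v) (hr' _ (hseg y hy)) h1
  obtain ⟨m, hm⟩ : ∃ m, iteratedDeriv m h 0 ≠ 0 := by
    -- If all derivatives at 0 vanished, φ would be zero along the whole segment from 0 to v, by the
    -- identity theorem.
    by_contra! hcon
    have h0 := hhan 0 (by simp)
    have h1 : analyticOrderAt h 0 = ⊤ := by
      refine ENat.eq_top_iff_forall_ge.2 fun n => ?_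
      exact (natCast_le_analyticOrderAt_iff_iteratedDeriv_eq_zero h0).2 fun i _ => hcon i
    have h2 := hhan.eqOn_zero_of_preconnected_of_eventuallyEq_zero isPreconnected_Icc
      (z₀ := 0) (by simp) (analyticOrderAt_eq_top.1 h1)
    exact hv (by simpa [hh] using h2 (right_mem_Icc.2 zero_le_one))
  have key : ∀ e' : (ℝ × ℝ) ≃L[ℝ] ℝ × ℝ, (∀ y : ℝ, e' (0, y) = y • v) →
      sndDeriv^[m] (φ ∘ e') 0 ≠ 0 := by
    intro e' he'
    have h1 : AnalyticAt ℝ (φ ∘ e') (0, 0) := by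
      refine AnalyticAt.comp ?_ (e'.analyticAt _)
      rw [← Prod.zero_eq_mk, map_zero]
      exact hφ
    have h2 := iteratedDeriv_slice (f := φ ∘ e') (s := 0) (t := 0)
      (h1.eventually_analyticAt.mono fun x hx => hx.contDiffAt) m
    rw [Prod.zero_eq_mk, ← h2]
    have h3 : (fun t : ℝ => (φ ∘ e') (0, t)) = h := by
      ext t; simp [hh, he']
    rwa [h3]
  exact ⟨e, m, key e he, key _ he'⟩

/-- Either the sublevel sets of a real analytic function are large at the exponent `s`, or they
decay with a better exponent. -/
lemma AnalyticAt.sublevelSet_dichotomy (hφ : AnalyticAt ℝ φ 0) (hφ0 : φ 0 = 0)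
    (hne : ¬ φ =ᶠ[𝓝 0] 0) (hs : 0 ≤ s) :
    (0 < s ∧ ∀ δ > 0, ∃ c > 0, ∃ ε₀ > 0, ∀ ε, 0 < ε → ε < ε₀ →
      ENNReal.ofReal (c * ε ^ s) ≤ volume (sublevelSet φ δ ε)) ∨ ∃ κ > s, SublevelDecay φ κ := by
  have hc : ∀ᶠ u in 𝓝 (0 : ℝ × ℝ), ContinuousAt φ u :=
    hφ.eventually_analyticAt.mono fun u hu => hu.continuousAt
  obtain ⟨e, m, hm, hm'⟩ := hφ.exists_sndDeriv_iterate_comp_ne_zero hφ0 hne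
  have han : ∀ e' : (ℝ × ℝ) ≃L[ℝ] ℝ × ℝ, AnalyticAt ℝ (φ ∘ e') (0, 0) := fun e' => by
    refine AnalyticAt.comp ?_ (e'.analyticAt _)
    rw [← Prod.zero_eq_mk, map_zero]
    exact hφ
  rcases analytic_dichotomy hs m 0 0 (han e) hm with h | h
  · exact Or.inl ⟨h.1, fun δ hδ => h.le_volume_sublevelSet hc e hδ⟩
  rcases analytic_dichotomy hs m 0 0 (han (fstReflection.trans e)) hm' with h' | h'
  · exact Or.inl ⟨h'.1, fun δ hδ => h'.le_volume_sublevelSet hc _ hδ⟩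
  exact Or.inr (h.sublevelDecay hc e h')

end SublevelSets

/-! ### Different functions representing the surface at a point -/

section Representations

lemma taylorSupport_eq_empty_of_eventuallyEq_zero {φ : ℝ × ℝ → ℝ} (h : φ =ᶠ[𝓝 0] 0) :
    taylorSupport φ = ∅ := by
  refine eq_empty_of_forall_notMem fun jk hjk => hjk ?_
  have h1 : ∀ᶠ s in 𝓝 (0 : ℝ), ∀ᶠ t in 𝓝 (0 : ℝ), φ (s, t) = 0 := by
    have h2 : ∀ᶠ z in 𝓝 (0 : ℝ) ×ˢ 𝓝 (0 : ℝ), φ z = 0 := by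
      rw [← nhds_prod_eq]; exact h
    exact h2.curry
  have h3 : (fun s => iteratedDeriv jk.2 (fun t => φ (s, t)) 0) =ᶠ[𝓝 0] fun _ => (0 : ℝ) := by
    filter_upwards [h1] with s hs
    have h4 : (fun t => φ (s, t)) =ᶠ[𝓝 0] fun _ => (0 : ℝ) := hs
    rw [h4.iteratedDeriv_eq, iteratedDeriv_fun_const_zero]
  rw [taylorCoeff, h3.iteratedDeriv_eq, iteratedDeriv_fun_const_zero, zero_div]

/-- A priori φ is only smooth, but it solves an analytic equation G(u, φ(u)) = 0. As dφ(0) = 0, the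
horizontal derivatives of G vanish at 0, so the vertical one cannot; the analytic implicit solution
is unique, hence equal to φ near 0. -/
lemma RepresentsAt.analyticAt {S : Set E3} {x₀ : E3} {φ : ℝ × ℝ → ℝ} (hrep : RepresentsAt S x₀ φ)
    (hS : IsAnalyticHypersurfaceAt S x₀) : AnalyticAt ℝ φ 0 := by
  obtain ⟨F, U, Ω, hF, hU, hFU, hΩ, h0, hφ, hφ0, hφ', hSU⟩ := hrep
  obtain ⟨V, g, hV, hxV, hg, hg', hSV⟩ := hS
  have hφat : ContDiffAt ℝ ∞ φ 0 := hφ.contDiffAt (hΩ.mem_nhds h0)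
  set q : (ℝ × ℝ) × ℝ → E3 := fun z => F.symm (z.1.1 • (!₂[1, 0, 0] : E3) +
    z.1.2 • (!₂[0, 1, 0] : E3) + (1 + z.2) • (!₂[0, 0, 1] : E3)) with hq
  have hFs : ContDiff ℝ ω (F.symm : E3 → E3) := F.symm.contDiff
  have hqc : ContDiff ℝ ω q := hFs.comp
    ((((contDiff_fst.comp contDiff_fst).smul contDiff_const).add
      ((contDiff_snd.comp contDiff_fst).smul contDiff_const)).add
      ((contDiff_const.add contDiff_snd).smul contDiff_const))
  have hqφ : ∀ u, q (u, φ u) = F.symm (graphPoint φ u) := fun u => by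
    rw [graphPoint_eq]
  have hq0 : q 0 = x₀ := by
    have := hqφ 0
    rw [hφ0, graphPoint_zero hφ0, ← hF, F.symm_apply_apply] at this
    exact this
  set qi : E3 → (ℝ × ℝ) × ℝ := fun y => ((F y 0, F y 1), F y 2 - 1) with hqi
  have hqqi : ∀ y, q (qi y) = y := fun y => by
    have : (F y 0) • (!₂[1, 0, 0] : E3) + (F y 1) • (!₂[0, 1, 0] : E3) +
        (1 + (F y 2 - 1)) • (!₂[0, 0, 1] : E3) = F y := by
      ext i; fin_cases i <;> simp
    simp only [hq, hqi, this, F.symm_apply_apply]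
  have hFc : ContDiff ℝ ω (F : E3 → E3) := F.contDiff
  have hFi : ∀ i, ContDiff ℝ ω fun y : E3 => F y i := fun i =>
    (EuclideanSpace.proj (𝕜 := ℝ) i).contDiff.comp hFc
  have hqic : ContDiff ℝ ω qi := ((hFi 0).prodMk (hFi 1)).prodMk ((hFi 2).sub contDiff_const)
  have hqi0 : qi x₀ = 0 := by simp [hqi, hF]
  have hgat : ContDiffAt ℝ ω g x₀ := hg.contDiffAt (hV.mem_nhds hxV)
  set G : (ℝ × ℝ) × ℝ → ℝ := g ∘ q with hG
  have hGc : ContDiffAt ℝ ω G 0 := by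
    refine ContDiffAt.comp 0 ?_ hqc.contDiffAt
    rwa [hq0]
  have hGφ : ∀ᶠ u in 𝓝 (0 : ℝ × ℝ), G (u, φ u) = 0 := by
    have h1 : ∀ᶠ u in 𝓝 (0 : ℝ × ℝ), q (u, φ u) ∈ V := by
      have : ContinuousAt (fun u => q (u, φ u)) 0 :=
        hqc.continuous.continuousAt.comp (continuousAt_id.prodMk hφat.continuousAt)
      refine this.preimage_mem_nhds ?_
      rw [hφ0]
      exact hV.mem_nhds (by rwa [← Prod.zero_eq_mk, hq0])
    filter_upwards [h1, hΩ.mem_nhds h0] with u hu huΩ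
    have h2 : q (u, φ u) ∈ S ∩ V := ⟨by rw [hqφ]; exact symm_graphPoint_mem hSU huΩ, hu⟩
    rw [hSV] at h2
    exact h2.2
  have hGd : HasFDerivAt G (fderiv ℝ G 0) 0 := (hGc.differentiableAt (by simp)).hasFDerivAt
  have hφd : HasFDerivAt φ (0 : ℝ × ℝ →L[ℝ] ℝ) 0 :=
    hφ' ▸ (hφat.differentiableAt (by simp)).hasFDerivAt
  have htan : ∀ u, fderiv ℝ G 0 (u, 0) = 0 := by
    intro u
    have h1 : HasFDerivAt (fun u => (u, φ u)) ((ContinuousLinearMap.id ℝ (ℝ × ℝ)).prod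
        (0 : ℝ × ℝ →L[ℝ] ℝ)) (0 : ℝ × ℝ) := (hasFDerivAt_id 0).prodMk hφd
    have h2 : HasFDerivAt (fun u => G (u, φ u)) ((fderiv ℝ G 0).comp
        ((ContinuousLinearMap.id ℝ (ℝ × ℝ)).prod (0 : ℝ × ℝ →L[ℝ] ℝ))) (0 : ℝ × ℝ) := by
      refine HasFDerivAt.comp (g := G) (f := fun u => (u, φ u)) (0 : ℝ × ℝ) ?_ h1
      rwa [hφ0]
    have h3 : HasFDerivAt (fun u => G (u, φ u)) (0 : ℝ × ℝ →L[ℝ] ℝ) 0 :=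
      (hasFDerivAt_const (0 : ℝ) (0 : ℝ × ℝ)).congr_of_eventuallyEq hGφ
    simpa using congrArg (fun l : ℝ × ℝ →L[ℝ] ℝ => l u) (h2.unique h3)
  have hsnd : sndDeriv G (0, 0) ≠ 0 := by
    intro hcon
    have hcon : fderiv ℝ G 0 (0, 1) = 0 := hcon
    have hzero : fderiv ℝ G 0 = 0 := by
      refine ContinuousLinearMap.ext fun z => ?_
      have hz : z = (z.1, 0) + z.2 • ((0 : ℝ × ℝ), (1 : ℝ)) := by ext <;> simp
      rw [hz, map_add, map_smul, htan, hcon]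
      simp
    have h1 : HasFDerivAt (G ∘ qi) (0 : E3 →L[ℝ] ℝ) x₀ := by
      have h2 : HasFDerivAt G (0 : (ℝ × ℝ) × ℝ →L[ℝ] ℝ) (qi x₀) := by
        rw [hqi0, ← hzero]; exact hGd
      have := h2.comp x₀ (hqic.differentiable (by simp) x₀).hasFDerivAt
      rwa [ContinuousLinearMap.zero_comp] at this
    have h3 : G ∘ qi = g := by
      ext y; simp [hG, hqqi]
    rw [h3] at h1
    exact hg' x₀ hxV h1.fderiv
  have hG0 : G (0, 0) = 0 := by
    have := hGφ.self_of_nhds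
    rwa [hφ0] at this
  obtain ⟨ψ, hψ, -, hψG⟩ := hGc.exists_implicit (by simp) hG0 hsnd
  have hlim : Tendsto (fun u => (u, φ u)) (𝓝 0) (𝓝 ((0 : ℝ × ℝ), (0 : ℝ))) := by
    have : ContinuousAt (fun u => (u, φ u)) (0 : ℝ × ℝ) := continuousAt_id.prodMk hφat.continuousAt
    rw [ContinuousAt, hφ0] at this
    exact this
  have hψφ : ψ =ᶠ[𝓝 0] φ := by
    filter_upwards [hlim.eventually hψG, hGφ] with u h1 h2 using h1.1 h2
  exact (hψ.congr_of_eventuallyEq hψφ.symm).analyticAt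

/-- A curve on S with horizontal velocity in one frame stays on the other graph, whose height
function is critical at the base point. Its velocity is therefore horizontal in that frame too. -/
lemma tangent_apply_two_eq_zero {S : Set E3} {x₀ : E3} {φ φ' : ℝ × ℝ → ℝ} {F F' : E3 ≃ᵃⁱ[ℝ] E3}
    {U U' : Set E3} {Ω Ω' : Set (ℝ × ℝ)} (hF : F x₀ = !₂[0, 0, 1]) (hU : IsOpen U)
    (hFU : F x₀ ∈ U) (hφd : HasFDerivAt φ (0 : ℝ × ℝ →L[ℝ] ℝ) 0)
    (hSU : (F '' S) ∩ U = graphPoint φ '' Ω) (hF' : F' x₀ = !₂[0, 0, 1]) (hΩ' : IsOpen Ω')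
    (h0' : 0 ∈ Ω') (hφ0' : φ' 0 = 0) (hφd' : HasFDerivAt φ' (0 : ℝ × ℝ →L[ℝ] ℝ) 0)
    (hSU' : (F' '' S) ∩ U' = graphPoint φ' '' Ω') (w : ℝ × ℝ) :
    F.linearIsometryEquiv (F'.symm.linearIsometryEquiv
      (w.1 • (!₂[1, 0, 0] : E3) + w.2 • (!₂[0, 1, 0] : E3))) 2 = 0 := by
  set a := w.1 • (!₂[1, 0, 0] : E3) + w.2 • (!₂[0, 1, 0] : E3) with ha
  set Λ : E3 ≃L[ℝ] E3 := (F'.symm.linearIsometryEquiv.trans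
    F.linearIsometryEquiv).toContinuousLinearEquiv with hΛ
  set γ : ℝ → E3 := fun s => F (F'.symm (graphPoint φ' (s • w))) with hγ
  have hγd : HasDerivAt γ (Λ a) 0 := by
    have h1 : γ = fun s => Λ (graphPoint φ' (s • w)) + (F.linearIsometryEquiv (F'.symm 0) + F 0) := by
      ext1 s
      simp only [hγ]
      rw [F.apply_eq_add, F'.symm.apply_eq_add, map_add, add_assoc]
      rfl
    rw [h1]
    exact ((Λ.hasFDerivAt (x := graphPoint φ' ((0 : ℝ) • w))).comp_hasDerivAt (0 : ℝ)
      (hasDerivAt_graphPoint_smul hφd' w)).add_const _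
  have hγ0 : γ 0 = F x₀ := by
    simp only [hγ, zero_smul, graphPoint_zero hφ0', ← hF', F'.symm_apply_apply]
  have hγi : ∀ i, HasDerivAt (fun s => γ s i) (Λ a i) 0 := fun i =>
    (EuclideanSpace.proj (𝕜 := ℝ) i).hasFDerivAt.comp_hasDerivAt (0 : ℝ) hγd
  have hev : ∀ᶠ s in 𝓝 (0 : ℝ), γ s 2 = 1 + φ (γ s 0, γ s 1) := by
    have h1 : ∀ᶠ s in 𝓝 (0 : ℝ), γ s ∈ U :=
      hγd.continuousAt.preimage_mem_nhds (by rw [hγ0]; exact hU.mem_nhds hFU)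
    have h2 : ∀ᶠ s in 𝓝 (0 : ℝ), s • w ∈ Ω' := by
      have : ContinuousAt (fun s : ℝ => s • w) 0 := by fun_prop
      exact this.preimage_mem_nhds (by rw [zero_smul]; exact hΩ'.mem_nhds h0')
    filter_upwards [h1, h2] with s hs1 hs2
    have h3 : γ s ∈ (F '' S) ∩ U := ⟨mem_image_of_mem _ (symm_graphPoint_mem hSU' hs2), hs1⟩
    rw [hSU] at h3
    obtain ⟨u, -, hu⟩ := h3
    rw [← hu]
    simp [graphPoint]
  have hd : HasDerivAt (fun s => 1 + φ (γ s 0, γ s 1)) 0 0 := by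
    have h1 : HasFDerivAt φ (0 : ℝ × ℝ →L[ℝ] ℝ) (γ 0 0, γ 0 1) := by
      rw [hγ0, hF]; simpa using! hφd
    have h2 := h1.comp_hasDerivAt (0 : ℝ) ((hγi 0).prodMk (hγi 1))
    simpa [Function.comp_def] using! h2.const_add 1
  exact ((hγi 2).congr_of_eventuallyEq (EventuallyEq.symm hev)).unique hd

/-- The decay of the sublevel sets does not depend on the motion. -/
lemma SublevelDecay.of_representsAt {S : Set E3} {x₀ : E3} {φ φ' : ℝ × ℝ → ℝ} {κ : ℝ}
    (h : SublevelDecay φ κ) (hrep : RepresentsAt S x₀ φ) (hrep' : RepresentsAt S x₀ φ') :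
    SublevelDecay φ' κ := by
  obtain ⟨F, U, Ω, hF, hU, hFU, hΩ, h0, hφ, hφ0, hφ1, hSU⟩ := hrep
  obtain ⟨F', U', Ω', hF', hU', hFU', hΩ', h0', hφ', hφ0', hφ1', hSU'⟩ := hrep'
  have hφat : ContDiffAt ℝ ∞ φ 0 := hφ.contDiffAt (hΩ.mem_nhds h0)
  have hφat' : ContDiffAt ℝ ∞ φ' 0 := hφ'.contDiffAt (hΩ'.mem_nhds h0')
  have hφd : HasFDerivAt φ (0 : ℝ × ℝ →L[ℝ] ℝ) 0 :=
    hφ1 ▸ (hφat.differentiableAt (by simp)).hasFDerivAt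
  have hφd' : HasFDerivAt φ' (0 : ℝ × ℝ →L[ℝ] ℝ) 0 :=
    hφ1' ▸ (hφat'.differentiableAt (by simp)).hasFDerivAt
  set Λ : E3 ≃ₗᵢ[ℝ] E3 := F'.symm.linearIsometryEquiv.trans F.linearIsometryEquiv with hΛ
  have htan : ∀ w : ℝ × ℝ, Λ (w.1 • (!₂[1, 0, 0] : E3) + w.2 • (!₂[0, 1, 0] : E3)) 2 = 0 :=
    tangent_apply_two_eq_zero hF hU hFU hφd hSU hF' hΩ' h0' hφ0' hφd' hSU'
  -- `Λ` maps the vertical direction to itself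
  obtain ⟨k, hk, hΛ3⟩ : ∃ k : ℝ, |k| = 1 ∧ Λ !₂[0, 0, 1] = k • !₂[0, 0, 1] := by
    -- Pairing with z reads off the third coordinate after Λ, so `htan` makes z orthogonal to the
    -- horizontal plane; being a unit vector it is ± the vertical one.
    set z := Λ.symm !₂[0, 0, 1] with hz
    have h1 : ∀ y : E3, inner ℝ z y = Λ y 2 := fun y => by
      rw [← Λ.inner_map_map, hz, Λ.apply_symm_apply, PiLp.inner_apply, Fin.sum_univ_three]
      simp
    have hz0 : z 0 = 0 := by
      have h2 := htan (1, 0)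
      rw [← h1, PiLp.inner_apply, Fin.sum_univ_three] at h2
      simpa using h2
    have hz1 : z 1 = 0 := by
      have h2 := htan (0, 1)
      rw [← h1, PiLp.inner_apply, Fin.sum_univ_three] at h2
      simpa using h2
    have hz2 : z = z 2 • !₂[0, 0, 1] := by
      ext i; fin_cases i <;> simp [hz0, hz1]
    have hn : |z 2| = 1 := by
      have h3 : ‖z‖ = 1 := by
        rw [hz, Λ.symm.norm_map, EuclideanSpace.norm_eq, Fin.sum_univ_three]
        simp
      rw [EuclideanSpace.norm_eq, Fin.sum_univ_three, hz0, hz1] at h3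
      simpa [Real.sqrt_sq_eq_abs] using h3
    refine ⟨z 2, hn, ?_⟩
    have h4 : Λ z = !₂[0, 0, 1] := Λ.apply_symm_apply _
    rw [hz2, map_smul] at h4
    have h5 : z 2 * z 2 = 1 := by rw [← abs_mul_abs_self, hn, one_mul]
    have h6 := congrArg (fun y => z 2 • y) h4
    simp only [smul_smul, h5, one_smul] at h6
    exact h6
  -- the induced map of the horizontal plane
  let f : (ℝ × ℝ) →ₗ[ℝ] ℝ × ℝ :=
    { toFun := fun w => (Λ (w.1 • (!₂[1, 0, 0] : E3) + w.2 • (!₂[0, 1, 0] : E3)) 0,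
        Λ (w.1 • (!₂[1, 0, 0] : E3) + w.2 • (!₂[0, 1, 0] : E3)) 1)
      map_add' := fun v w => by
        ext <;> simp [add_mul] <;> ring
      map_smul' := fun c w => by
        ext <;> simp [mul_add, mul_assoc] }
  have hf : ∀ w : ℝ × ℝ, Λ (w.1 • (!₂[1, 0, 0] : E3) + w.2 • (!₂[0, 1, 0] : E3)) =
      !₂[(f w).1, (f w).2, 0] := fun w => by
    ext i
    fin_cases i
    · rfl
    · rfl
    · exact htan w
  have hinj : Function.Injective f := by
    rw [← LinearMap.ker_eq_bot, LinearMap.ker_eq_bot']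
    intro w hw
    have h1 := hf w
    rw [hw] at h1
    have h2 : Λ (w.1 • (!₂[1, 0, 0] : E3) + w.2 • (!₂[0, 1, 0] : E3)) = 0 := by
      rw [h1]; ext i; fin_cases i <;> simp
    rw [map_eq_zero_iff _ Λ.injective] at h2
    have h3 := congrArg (fun y : E3 => y 0) h2
    have h4 := congrArg (fun y : E3 => y 1) h2
    exact Prod.ext (by simpa using h3) (by simpa using h4)
  let e : (ℝ × ℝ) ≃L[ℝ] ℝ × ℝ := (LinearEquiv.ofInjectiveEndo f hinj).toContinuousLinearEquiv
  have he : ∀ w, e w = f w := fun w => rfl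
  have hmap : ∀ u, F (F'.symm (graphPoint φ' u)) = !₂[(e u).1, (e u).2, 1 + k * φ' u] := by
    intro u
    have h1 : ∀ y y', F (F'.symm y) = Λ (y - y') + F (F'.symm y') := fun y y' => by
      rw [F.apply_eq_add, F'.symm.apply_eq_add, F.apply_eq_add (F'.symm y'),
        F'.symm.apply_eq_add y', map_add, map_add, map_sub]
      simp only [hΛ, LinearIsometryEquiv.trans_apply]
      abel
    have h2 : F (F'.symm !₂[0, 0, 1]) = !₂[0, 0, 1] := by
      rw [← hF', F'.symm_apply_apply, hF, hF']
    have h3 : graphPoint φ' u - !₂[0, 0, 1] = u.1 • (!₂[1, 0, 0] : E3) + u.2 • (!₂[0, 1, 0] : E3) +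
        φ' u • (!₂[0, 0, 1] : E3) := by
      rw [graphPoint_eq, add_smul, one_smul]; abel
    rw [h1 _ !₂[0, 0, 1], h2, h3, map_add, hf, map_smul, hΛ3]
    ext i
    fin_cases i <;> simp [he]
    ring
  -- Two representing functions differ by a linear change of variables and a sign, so their sublevel
  -- sets correspond under `e`.
  have hrel : ∀ᶠ u in 𝓝 (0 : ℝ × ℝ), φ (e u) = k * φ' u := by
    have hc : ContinuousAt (fun u => F (F'.symm (graphPoint φ' u))) 0 :=
      F.continuous.continuousAt.comp
        (F'.symm.continuous.continuousAt.comp hφat'.graphPoint.continuousAt)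
    have h1 : ∀ᶠ u in 𝓝 (0 : ℝ × ℝ), F (F'.symm (graphPoint φ' u)) ∈ U := by
      refine hc.preimage_mem_nhds (hU.mem_nhds ?_)
      rwa [graphPoint_zero hφ0', ← hF', F'.symm_apply_apply]
    filter_upwards [h1, hΩ'.mem_nhds h0'] with u hu1 hu2
    have h3 : F (F'.symm (graphPoint φ' u)) ∈ (F '' S) ∩ U :=
      ⟨mem_image_of_mem _ (symm_graphPoint_mem hSU' hu2), hu1⟩
    rw [hSU] at h3
    obtain ⟨v, -, hv⟩ := h3
    rw [hmap] at hv
    have hv0 : v.1 = (e u).1 := by simpa [graphPoint] using congrArg (fun y : E3 => y 0) hv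
    have hv1 : v.2 = (e u).2 := by simpa [graphPoint] using congrArg (fun y : E3 => y 1) hv
    have hv2 : φ v = k * φ' u := by simpa [graphPoint] using congrArg (fun y : E3 => y 2) hv
    rw [← hv2, ← Prod.ext hv0 hv1]
  obtain ⟨δ, hδ, C, hC⟩ := h
  obtain ⟨δ', hδ', hb⟩ : ∃ δ' > 0, Metric.ball (0 : ℝ × ℝ) δ' ⊆
      {u | φ (e u) = k * φ' u ∧ e u ∈ Metric.ball 0 δ} := by
    refine Metric.mem_nhds_iff.1 (hrel.and ?_)
    have : Tendsto e (𝓝 0) (𝓝 0) := by simpa using e.continuous.tendsto 0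
    exact this.eventually (Metric.ball_mem_nhds 0 hδ)
  set d : ℝ := |LinearMap.det ((e.symm : (ℝ × ℝ) →L[ℝ] ℝ × ℝ) : (ℝ × ℝ) →ₗ[ℝ] ℝ × ℝ)| with hd
  refine ⟨δ', hδ', d * C, fun ε h1 h2 => ?_⟩
  have hsub : sublevelSet φ' δ' ε ⊆ e.symm '' sublevelSet φ δ ε := by
    rintro u ⟨hu, huε⟩
    obtain ⟨hu1, hu2⟩ := hb (mem_ball_zero_iff.2 hu)
    refine ⟨e u, ⟨mem_ball_zero_iff.1 hu2, ?_⟩, e.symm_apply_apply u⟩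
    rwa [hu1, abs_mul, hk, one_mul]
  refine (measure_mono hsub).trans ?_
  rw [Measure.addHaar_image_continuousLinearEquiv, mul_assoc, ENNReal.ofReal_mul (abs_nonneg _)]
  exact mul_le_mul' le_rfl (hC ε h1 h2)

end Representations

theorem theorem1p3 (S : Set E3) (hS : IsSmoothHypersurface S) (hfin : IsFiniteType S)
    (htrans : IsTransversal S) (ρ : E3 → ℝ) (hρ : IsSmoothCompactlySupportedOn S ρ)
    (hρ_nonneg : ∀ x ∈ S, 0 ≤ ρ x) (p : ℝ≥0∞) (hp : 1 < p)
    (hM : MaximalOperatorBounded S ρ p) (x₀ : E3) (hx₀ : x₀ ∈ S) (hρ_pos : 0 < ρ x₀) :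
    surfaceHeight S x₀ ≤ p ∧ (IsAnalyticHypersurfaceAt S x₀ → surfaceHeight S x₀ < p) := by
  have hp0 : p ≠ 0 := (zero_lt_one.trans hp).ne'
  constructor
  · rcases eq_or_ne p ⊤ with rfl | hp'
    · exact le_top
    refine iSup₂_le fun φ hrep => ?_
    by_contra! hlt
    have hP : 0 < p.toReal := ENNReal.toReal_pos hp0 hp'
    obtain ⟨δ, hδ, hnot⟩ := hM.exists_not_le_volume_sublevelSet hS htrans hρ hρ_nonneg hp hp' hx₀
      hρ_pos hrep
    obtain ⟨F, U, Ω, -, -, -, hΩ, h0, hφ, -⟩ := hrep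
    obtain ⟨r, hr, c, hc, ε₀, hε₀, hl⟩ := exists_le_volume_sublevelSet hΩ h0 hφ
      (one_div_pos.2 hP) (by rwa [one_div_one_div, ENNReal.ofReal_toReal hp']) hδ
    exact hnot r hr.le c hc ε₀ hε₀ hl
  · intro han
    -- The existence of a representing function is not established: without one the supremum
    -- defining the height is over the empty set, hence 0.
    by_cases hex : ∃ φ, RepresentsAt S x₀ φ
    · obtain ⟨φ, hrep⟩ := hex
      have hφ0 : φ 0 = 0 := by
        obtain ⟨F, U, Ω, -, -, -, -, -, -, h, -⟩ := hrep
        exact h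
      have hne : ¬ φ =ᶠ[𝓝 0] 0 := fun h =>
        (hfin x₀ hx₀ φ hrep).ne_empty (taylorSupport_eq_empty_of_eventuallyEq_zero h)
      -- For p = ∞ this exponent is 0 by the convention for `toReal`. The lower alternative requires
      -- a positive exponent, so only decay remains and the height is finite.
      have hs : 0 ≤ 1 / p.toReal := by positivity
      rcases (hrep.analyticAt han).sublevelSet_dichotomy hφ0 hne hs with ⟨h1, h2⟩ | ⟨κ, hκ, hdec⟩
      · have hp' : p ≠ ⊤ := by
          rintro rfl
          simp at h1
        obtain ⟨δ, hδ, hnot⟩ := hM.exists_not_le_volume_sublevelSet hS htrans hρ hρ_nonneg hp hp'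
          hx₀ hρ_pos hrep
        obtain ⟨c, hc, ε₀, hε₀, hl⟩ := h2 δ hδ
        exact (hnot _ le_rfl c hc ε₀ hε₀ hl).elim
      · have hκ0 : 0 < κ := hs.trans_lt hκ
        have hle : surfaceHeight S x₀ ≤ ENNReal.ofReal (1 / κ) := by
          refine iSup₂_le fun φ' hrep' => ?_
          have hdec' := hdec.of_representsAt hrep hrep'
          obtain ⟨F, U, Ω, -, -, -, hΩ, h0, hφ, -⟩ := hrep'
          exact hdec'.functionHeight_le hκ0 hΩ h0 hφ
        refine hle.trans_lt ?_
        rcases eq_or_ne p ⊤ with rfl | hp'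
        · exact ENNReal.ofReal_lt_top
        · have hP : 0 < p.toReal := ENNReal.toReal_pos hp0 hp'
          rw [ENNReal.ofReal_lt_iff_lt_toReal (by positivity) hp']
          exact (one_div_lt hP hκ0).1 hκ
    · have : surfaceHeight S x₀ = 0 := by
        simp only [surfaceHeight, ENNReal.iSup_eq_zero]
        exact fun φ hφ => (hex ⟨φ, hφ⟩).elim
      rw [this]
      exact zero_lt_one.trans hp
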